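/- **Setting.** Let $\mathcal T$ be a theory expanding the theory of Henselian valued fields of equi-characteristic $0$, with sorts the valued field $K$ and $\mathrm{RV}^{\mathrm{eq}}$, where $\mathrm{RV}=\{0\}\cup K^\times/(1+\mathcal M_K)$ and $\mathrm{RV}^{\mathrm{eq}}$ consists of the *auxiliary sorts*, i.e. the quotients of $\emptyset$-definable subsets of powers of $\mathrm{RV}$ by $\emptyset$-definable equivalence relations. Let $v$ be the valuation, $\Gamma$ the value group, $k$ the residue field, $\mathrm{res}$ the residue map and $\mathrm{rv}\colon K\to\mathrm{RV}$ the canonical map. "Definable" means definable with parameters. A *ball* in $K^n$ is a set $\{x: v(x-a)>\delta\}$ with $\delta\in\Gamma\cup\{-\infty\}$ or $\{x: v(x-a)\ge\delta\}$ with $\delta\in\Gamma$, where $v(x)=\min_i v(x_i)$ on $K^n$. Assume that in every model of $\mathcal T$: * every definable subset of $\mathrm{RV}^m$ is definable with parameters from $\mathrm{RV}$; * every definable map $\mathrm{RV}\to K$ has finite image; * ($b$-minimality with centers) for every set of parameters $A\subseteq K\cup\mathrm{RV}^{\mathrm{eq}}$: (i) every $A$-definable $X\subseteq K$ has a partition $(c(q)+\mathrm{rv}^{-1}(\xi(q)))_{q\in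 Q}$ with $Q\subseteq\mathrm{RV}^{\mathrm{eq}}$, $c\colon Q\to K$, $\xi\colon Q\to\mathrm{RV}$ all $A$-definable; (ii) no definable map from a subset of an auxiliary sort to a ball of $K$ is surjective; (iii) for every $A$-definable $f\colon X\to K$ with $X\subseteq K$ there is an $A$-definable map $\chi$ from $X$ to an auxiliary sort such that $f$ is injective or constant on each fiber of $\chi$. Let $K$ be a model of $\mathcal T$. **Definitions.** Let $\mathrm{rv}\colon K^n\to\mathrm{RV}^{(n)}:=K^n/{\sim}$ be the canonical map, where $x\sim y$ iff $v(x-y)>v(x)$ or $x=y=0$. A *risometry* $X\to Y$ between subsets of $K^n$ is a bijection $\phi$ with $\mathrm{rv}(\phi(x)-\phi(x'))=\mathrm{rv}(x-x')$ for all $x,x'\in X$. A *coloring* of a set is a definable map from it to an auxiliary sort. A coloring $\chi'$ *refines* $\chi$ if $\chi'(x)=\chi'(x')$ implies $\chi(x)=\chi(x')$; a map $\phi\colon B_0\to B_0$ *respects* $\chi$ if $\chi\circ\phi=\chi$. A definable partition $(S_i)_{i\le n}$ is treated as the coloring telling in which $S_i$ a point lies. A coloring $\chi$ of a ball $B\subseteq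 K^n$ is *$d$-translatable* on $B$ if there are a $d$-dimensional subspace $V\subseteq k^n$, a subspace $\tilde V\subseteq K^n$ with $\mathrm{res}(\tilde V\cap\mathcal O_K^n)=V$ and a definable risometry $\phi\colon B\to B$ such that $\chi(\phi(x))=\chi(\phi(x'))$ whenever $x,x'\in B$ and $x-x'\in\tilde V$. The dimension of a definable $X\subseteq K^n$ is the largest $d$ such that the image of $X$ under some coordinate projection $K^n\to K^d$ contains a ball, and $-\infty$ if $X=\emptyset$. A *t-stratification* of a ball $B_0\subseteq K^n$ is a partition of $B_0$ into definable sets $S_0,\dots,S_n$ (possibly empty) such that for each $d$: $\dim S_d\le d$, and $(S_i)_i$ is $d$-translatable on each ball $B\subseteq S_d\cup\dots\cup S_n$. It *reflects* a coloring $\chi$ of $B_0$ if, for each $d$ and each ball $B\subseteq S_d\cup\dots\cup S_n$, the product $((S_i)_i,\chi)$ is $d$-translatable on $B$. Its *rainbow* is the coloring $x\mapsto(\mathrm{rv}(x-S_i))_{i\le n}$ of $B_0$ (up to coding the tuple of sets $\mathrm{rv}(x-S_i)=\{\mathrm{rv}(x-s): s\in S_i\}$ by an element of $\mathrm{RV}^{\mathrm{eq}}$).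 **Proposition.** Let $(S_i)_{i\le n}$ be a t-stratification of a ball $B_0\subseteq K^n$ and let $\chi$ be a coloring of $B_0$. The following are equivalent: 1. $(S_i)_i$ reflects $\chi$; 2. the rainbow of $(S_i)_i$ refines $\chi$; 3. every definable risometry $\phi\colon B_0\to B_0$ respecting $(S_i)_i$ also respects $\chi$. -/

import Mathlib

open FirstOrder

universe u

namespace TStrat

/-! ### Henselian valued fields of equi-characteristic zero -/

/-- A Henselian valued field of equi-characteristic `0`. The valuation is given by its valuation
ring. (Residue characteristic `0` forces characteristic `0`.) -/
class HenselianVF (K : Type u) extends Field K where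
  integers : ValuationSubring K
  henselian : HenselianLocalRing integers
  residue_charZero : CharZero (IsLocalRing.ResidueField integers)

section ValuedField

variable (K : Type u) [HenselianVF K]

/-- The valuation ring. -/
abbrev O : ValuationSubring K := HenselianVF.integers

/-- The residue field. -/
abbrev Res : Type u := IsLocalRing.ResidueField (O K)

/-- The value group together with the valuation of `0`, written multiplicatively: the order is
the reverse of the one on `Γ ∪ {∞}`, and `∞` becomes `0`. -/
abbrev Val : Type u := (O K).ValueGroup

variable {K}

/-- The valuation `K → Γ ∪ {∞}` (multiplicative notation). -/
noncomputable def val (x : K) : Val K := (O K).valuation x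

/-- The valuation on `K ^ n`. The minimum of the valuations of the coordinates is a supremum
in multiplicative notation. -/
noncomputable def valn {n : ℕ} (x : Fin n → K) : Val K := Finset.univ.sup fun i => val (x i)

theorem valn_sub_le {n : ℕ} (x y : Fin n → K) : valn (x - y) ≤ max (valn x) (valn y) := by
  refine Finset.sup_le fun i _ => ?_
  refine ((O K).valuation.map_sub (x i) (y i)).trans (max_le_max ?_ ?_)
  · exact Finset.le_sup (f := fun i => val (x i)) (Finset.mem_univ i)
  · exact Finset.le_sup (f := fun i => val (y i)) (Finset.mem_univ i)

theorem valn_sub_comm {n : ℕ} (x y : Fin n → K) : valn (x - y) = valn (y - x) := by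
  unfold valn val
  congr 1
  funext i
  exact (O K).valuation.map_sub_swap (x i) (y i)

theorem valn_le_of_sub_lt {n : ℕ} {x y : Fin n → K} (h : valn (x - y) < valn x) :
    valn x ≤ valn y := by
  by_contra hlt
  have h1 : valn x ≤ max (valn (x - y)) (valn y) := by
    have h2 := valn_sub_le (x - y) (-y)
    have h3 : valn (-y) = valn y := by
      have := valn_sub_comm (0 : Fin n → K) y
      simpa using this
    rw [h3] at h2
    simpa using h2
  exact absurd (lt_of_le_of_lt h1 (max_lt h (not_le.mp hlt))) (lt_irrefl _)

/-- `x ∼ y` iff `v (x - y) > v x` or `x = y = 0`. -/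
def rvSetoid (K : Type u) [HenselianVF K] (n : ℕ) : Setoid (Fin n → K) where
  r x y := valn (x - y) < valn x ∨ (x = 0 ∧ y = 0)
  iseqv := by
    refine ⟨fun x => ?_, ?_, ?_⟩
    · by_cases hx : x = 0
      · exact Or.inr ⟨hx, hx⟩
      · left
        obtain ⟨i, hi⟩ := Function.ne_iff.mp hx
        have h0 : (0 : Val K) < val (x i) :=
          zero_lt_iff.mpr ((O K).valuation.ne_zero_iff.mpr hi)
        have h1 : val (x i) ≤ valn x :=
          Finset.le_sup (f := fun i => val (x i)) (Finset.mem_univ i)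
        refine lt_of_le_of_lt (Finset.sup_le fun j _ => ?_) (h0.trans_le h1)
        simp [val]
    · rintro x y (h | ⟨hx, hy⟩)
      · left
        rw [valn_sub_comm]
        exact h.trans_le (valn_le_of_sub_lt h)
      · exact Or.inr ⟨hy, hx⟩
    · rintro x y z (h | ⟨hx, hy⟩) (h' | ⟨hy', hz⟩)
      · left
        have hyx : valn y ≤ valn x :=
          valn_le_of_sub_lt (by
            rw [valn_sub_comm]
            exact h.trans_le (valn_le_of_sub_lt h))
        have h2 := valn_sub_le (x - y) (z - y)
        rw [sub_sub_sub_cancel_right, valn_sub_comm z y] at h2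
        exact lt_of_le_of_lt h2 (max_lt h (h'.trans_le hyx))
      · subst hy'
        subst hz
        exact Or.inl h
      · subst hx
        subst hy
        exact Or.inl h'
      · exact Or.inr ⟨hx, hz⟩

/-- The sort `RV^(n)`. -/
def RVn (K : Type u) [HenselianVF K] (n : ℕ) : Type u := Quotient (rvSetoid K n)

/-- `rv : K ^ n → RV^(n)`. -/
def rvn {n : ℕ} (x : Fin n → K) : RVn K n := Quotient.mk (rvSetoid K n) x

/-- The leading term structure `RV = RV^(1) = {0} ∪ Kˣ / (1 + M)`. -/
abbrev RV (K : Type u) [HenselianVF K] : Type u := RVn K 1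

/-- `rv : K → RV`. -/
def rv (x : K) : RV K := rvn fun _ => x

/-- Open balls of `K ^ n`; the whole space is the open ball of radius `-∞`. -/
def IsOpenBall {n : ℕ} (B : Set (Fin n → K)) : Prop :=
  B = Set.univ ∨ ∃ (a : Fin n → K) (δ : Val K), δ ≠ 0 ∧ B = {x | valn (x - a) < δ}

/-- Closed balls of `K ^ n`. -/
def IsClosedBall {n : ℕ} (B : Set (Fin n → K)) : Prop :=
  ∃ (a : Fin n → K) (δ : Val K), δ ≠ 0 ∧ B = {x | valn (x - a) ≤ δ}

def IsBall {n : ℕ} (B : Set (Fin n → K)) : Prop := IsOpenBall B ∨ IsClosedBall B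

/-- The dimension of `X ⊆ K ^ n`: the maximal `d` such that some coordinate projection
`K ^ n → K ^ d` maps `X` onto a set containing a ball; `⊥` for the empty set. -/
noncomputable def dim {n : ℕ} (X : Set (Fin n → K)) : WithBot ℕ∞ :=
  ⨆ d ∈ {d : ℕ | ∃ (e : Fin d ↪o Fin n) (B : Set (Fin d → K)),
    IsBall B ∧ B ⊆ (fun x : Fin n → K => x ∘ e) '' X}, ((d : ℕ∞) : WithBot ℕ∞)

/-- The Jacobian property of a map on a subset of `K ^ n`. -/
def HasJacobianProperty {n : ℕ} (X : Set (Fin n → K)) (f : (Fin n → K) → K) : Prop :=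
  (∀ x ∈ X, ∀ x' ∈ X, f x = f x') ∨
  ∃ z : Fin n → K, z ≠ 0 ∧ ∀ x ∈ X, ∀ x' ∈ X, x ≠ x' →
    val (f x - f x' - ∑ i, z i * (x i - x' i)) < valn z * valn (x - x')

/-- A map `φ : X → Y` between subsets of `K ^ n` is a risometry. -/
def IsRisometry {n : ℕ} {X Y : Set (Fin n → K)} (φ : X → Y) : Prop :=
  Function.Bijective φ ∧
    ∀ x x' : X, rvn ((φ x : Fin n → K) - (φ x' : Fin n → K)) =
      rvn ((x : Fin n → K) - (x' : Fin n → K))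

/-- `W ⊆ K ^ n` is a lift of `V ⊆ k ^ n`, i.e. `res W = V`. -/
def IsLift {n : ℕ} (W : Submodule K (Fin n → K)) (V : Submodule (Res K) (Fin n → Res K)) : Prop :=
  (V : Set (Fin n → Res K)) =
    {w | ∃ x : Fin n → O K, (fun i => (x i : K)) ∈ W ∧ w = fun i => IsLocalRing.residue (O K) (x i)}

end ValuedField

/-! ### The language -/

/-- The only relation symbol of the valued field language: membership in the valuation ring. -/
inductive IntegersRel : ℕ → Type
  | mem : IntegersRel 1

def integersLanguage : FirstOrder.Language.{0, 0} := ⟨fun _ => Empty, IntegersRel⟩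

/-- Expansions of the language of valued fields: the ring language, a predicate for the valuation
ring, and the symbols of an arbitrary language `L`. Symbols live on the field sort. The sort `RV`
and the sorts of `RV^eq` are definable quotients of powers of the field and are constructed as
such below; a symbol on those sorts corresponds to its preimage in powers of the field. -/
abbrev expand (L : FirstOrder.Language.{u, u}) : FirstOrder.Language.{u, u} :=
  (FirstOrder.Language.ring.sum integersLanguage).sum L

section Structure

variable (K : Type u) [HenselianVF K]

noncomputable instance : FirstOrder.Ring.CompatibleRing K := FirstOrder.Ring.compatibleRingOfRing K

instance : integersLanguage.Structure K where
  funMap := fun f => Empty.elim f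
  RelMap := fun {n} (r : IntegersRel n) =>
    match n, r with
    | _, .mem => fun x => x 0 ∈ O K

end Structure

/-! ### Interpreted sorts and definability -/

/-- A presentation of `X` as a quotient of a power of `K`. -/
class Interpreted (K : Type u) (X : Type u) where
  Idx : Type
  proj : (Idx → K) → X

instance (K : Type u) : Interpreted K K := ⟨Unit, fun y => y ()⟩

instance (K : Type u) [HenselianVF K] (n : ℕ) : Interpreted K (RVn K n) := ⟨Fin n, rvn⟩

instance (K X Y : Type u) [Interpreted K X] [Interpreted K Y] : Interpreted K (X × Y) :=
  ⟨Interpreted.Idx K X ⊕ Interpreted.Idx K Y,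
    fun y => (Interpreted.proj (y ∘ Sum.inl), Interpreted.proj (y ∘ Sum.inr))⟩

instance (K : Type u) {m : ℕ} (X : Fin m → Type u) [∀ i, Interpreted K (X i)] :
    Interpreted K (∀ i, X i) :=
  ⟨Σ i, Interpreted.Idx K (X i), fun y i => Interpreted.proj fun j => y ⟨i, j⟩⟩

section Definability

variable (L : FirstOrder.Language.{u, u}) (K : Type u) [HenselianVF K] [L.Structure K]

/-- `∅`-definable subsets of an interpreted sort. -/
def ZeroDefinable {X : Type u} [Interpreted K X] (S : Set X) : Prop :=
  (∅ : Set K).Definable (expand L) {y : Interpreted.Idx K X → K | Interpreted.proj y ∈ S}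

/-- An auxiliary sort, i.e. a sort of `RV^eq`: the quotient of `RV ^ k` by a `∅`-definable
equivalence relation. (The quotient of a `∅`-definable subset of `RV ^ k` is a `∅`-definable
subset of such a sort: let the complement be one further class.) -/
structure AuxSort where
  k : ℕ
  rel : Setoid (Fin k → RV K)
  definable : ZeroDefinable L K {p : (Fin k → RV K) × (Fin k → RV K) | rel p.1 p.2}

variable {L K}

/-- The underlying set of an auxiliary sort. -/
def AuxSort.Carrier (s : AuxSort L K) : Type u := Quotient s.rel

instance (s : AuxSort L K) : Interpreted K s.Carrier :=
  ⟨Interpreted.Idx K (Fin s.k → RV K), fun y => Quotient.mk s.rel (Interpreted.proj y)⟩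

variable (L K) in
/-- Parameters: the disjoint union of `K` and all auxiliary sorts. -/
abbrev Param : Type u := K ⊕ (Σ s : AuxSort L K, s.Carrier)

/-- `A`-definable subsets of an interpreted sort, for `A ⊆ K ∪ RV^eq`: the fibers, over finite
tuples from `A`, of `∅`-definable sets. -/
def DefinableOver {X : Type u} [Interpreted K X] (A : Set (Param L K)) (S : Set X) : Prop :=
  ∃ (m : ℕ) (a : Fin m → K) (r : ℕ) (s : Fin r → AuxSort L K) (b : ∀ j, (s j).Carrier)
    (W : Set (X × (Fin m → K) × (∀ j, (s j).Carrier))),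
    (∀ i, Sum.inl (a i) ∈ A) ∧ (∀ j, Sum.inr ⟨s j, b j⟩ ∈ A) ∧
    ZeroDefinable L K W ∧ S = {x | (x, a, b) ∈ W}

/-- `A`-definable maps: those with `A`-definable graph. -/
def DefinableMapOver {X Y : Type u} [Interpreted K X] [Interpreted K Y] (A : Set (Param L K))
    {D : Set X} (f : D → Y) : Prop :=
  DefinableOver A {p : X × Y | ∃ h : p.1 ∈ D, f ⟨p.1, h⟩ = p.2}

variable (L)

/-- Definable sets (with arbitrary parameters). -/
def Definable {X : Type u} [Interpreted K X] (S : Set X) : Prop :=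
  DefinableOver (Set.univ : Set (Param L K)) S

/-- Definable maps (with arbitrary parameters). -/
def DefinableMap {X Y : Type u} [Interpreted K X] [Interpreted K Y] {D : Set X} (f : D → Y) :
    Prop :=
  DefinableMapOver (Set.univ : Set (Param L K)) f

end Definability

/-! ### Requirements on the theory -/

section Requirements

variable (L : FirstOrder.Language.{u, u}) (K : Type u) [HenselianVF K] [L.Structure K]

/-- Every definable subset of `RV ^ n` is definable with parameters from `RV`. -/
def RVStablyEmbedded : Prop :=
  ∀ (n : ℕ) (S : Set (Fin n → RV K)), Definable (K := K) L S →
    ∃ (m : ℕ) (c : Fin m → RV K) (W : Set ((Fin n → RV K) × (Fin m → RV K))),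
      ZeroDefinable L K W ∧ S = {x | (x, c) ∈ W}

/-- Every definable map from `RV` to `K` has finite image. -/
def FiniteImages : Prop :=
  ∀ f : RV K → K, DefinableMap (K := K) L (fun x : (Set.univ : Set (RV K)) => f x) →
    (Set.range f).Finite

/-- The conditions of b-minimality with centers, in one model. -/
structure BMinimalWithCenters : Prop where
  /-- An `A`-definable `X ⊆ K` is partitioned into sets `c q + rv⁻¹ (ξ q)`. -/
  centers : ∀ (A : Set (Param L K)) (X : Set K), DefinableOver A X →
    ∃ (s : AuxSort L K) (Q : Set s.Carrier) (c : Q → K) (ξ : Q → RV K),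
      DefinableOver A Q ∧ DefinableMapOver A c ∧ DefinableMapOver A ξ ∧
      (∀ q q' : Q, q ≠ q' → Disjoint {x : K | rv (x - c q) = ξ q} {x : K | rv (x - c q') = ξ q'}) ∧
      (⋃ q : Q, {x : K | rv (x - c q) = ξ q}) = X
  /-- No definable map from an auxiliary set is onto a ball of `K`. -/
  no_surjection : ∀ (s : AuxSort L K) (Q : Set s.Carrier) (f : Q → K), DefinableMap (K := K) L f →
    ¬ IsBall {x : Fin 1 → K | x 0 ∈ Set.range f}
  injective_or_constant : ∀ (A : Set (Param L K)) (X : Set K) (f : X → K),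
    DefinableOver A X → DefinableMapOver A f →
    ∃ (s : AuxSort L K) (χ : X → s.Carrier), DefinableMapOver A χ ∧
      ∀ q : s.Carrier, Set.InjOn f (χ ⁻¹' {q}) ∨ ∀ x ∈ χ ⁻¹' {q}, ∀ x' ∈ χ ⁻¹' {q}, f x = f x'

/-- The Jacobian property up to dimension `n₀`, in one model. -/
def JacobianUpTo (n₀ : ℕ) : Prop :=
  ∀ n ≤ n₀, ∀ (A : Set (Param L K)) (f : (Fin n → K) → K),
    DefinableMapOver A (fun x : (Set.univ : Set (Fin n → K)) => f x) →
    ∃ (s : AuxSort L K) (χ : (Fin n → K) → s.Carrier),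
      DefinableMapOver A (fun x : (Set.univ : Set (Fin n → K)) => χ x) ∧
      ∀ q : s.Carrier, dim (χ ⁻¹' {q}) = ((n : ℕ∞) : WithBot ℕ∞) →
        HasJacobianProperty (χ ⁻¹' {q}) f

end Requirements

/-- The general hypothesis on the expansion of the theory of Henselian valued fields of
equi-characteristic `0` by the sentences `T`, with the Jacobian property required up to
dimension `n₀`. Each condition is required in all models. -/
structure GeneralHypothesis {L : FirstOrder.Language.{u, u}} (T : (expand L).Theory)
    (n₀ : ℕ) : Prop where
  stablyEmbedded : ∀ (K : Type u) [HenselianVF K] [L.Structure K], K ⊨ T → RVStablyEmbedded L K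
  finiteImages : ∀ (K : Type u) [HenselianVF K] [L.Structure K], K ⊨ T → FiniteImages L K
  bMinimal : ∀ (K : Type u) [HenselianVF K] [L.Structure K], K ⊨ T → BMinimalWithCenters L K
  jacobian : ∀ (K : Type u) [HenselianVF K] [L.Structure K], K ⊨ T → JacobianUpTo L K n₀

/-! ### Colorings, translatability, t-stratifications -/

section Stratifications

variable (L : FirstOrder.Language.{u, u}) {K : Type u} [HenselianVF K] [L.Structure K] {n : ℕ}

/-- A coloring of `X ⊆ K ^ n`: a definable map to an auxiliary sort. -/
structure Coloring (X : Set (Fin n → K)) where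
  sort : AuxSort L K
  toFun : X → sort.Carrier
  definable : DefinableMap (K := K) L toFun

/-- `χ'` refines `χ`. -/
def Refines {X C C' : Type*} (χ' : X → C') (χ : X → C) : Prop :=
  ∀ x₁ x₂, χ' x₁ = χ' x₂ → χ x₁ = χ x₂

/-- `V`-translatability of `χ` on `B`: for some lift `W` of `V` and some definable risometry
`φ : B → B`, the map `χ ∘ φ` is `W`-translation invariant. Only the equivalence relation `having
the same color` matters, so the colors may form any type. -/
def IsTranslatable {C : Type*} {B : Set (Fin n → K)} (χ : B → C)
    (V : Submodule (Res K) (Fin n → Res K)) : Prop :=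
  ∃ (W : Submodule K (Fin n → K)) (φ : B → B), IsLift W V ∧
    DefinableMap (K := K) L (fun x : B => (φ x : Fin n → K)) ∧
    IsRisometry φ ∧ ∀ x x' : B, (x : Fin n → K) - (x' : Fin n → K) ∈ W → χ (φ x) = χ (φ x')

/-- `d`-translatability. -/
def IsDTranslatable {C : Type*} {B : Set (Fin n → K)} (χ : B → C) (d : ℕ) : Prop :=
  ∃ V : Submodule (Res K) (Fin n → Res K),
    Module.finrank (Res K) V = d ∧ IsTranslatable L χ V

variable (S : Fin (n + 1) → Set (Fin n → K)) (B₀ : Set (Fin n → K))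

/-- The family of sets `S 0, …, S n`, restricted to `B` and viewed as a coloring: two points have
the same color iff they lie in the same members of the family. -/
def stratColor (B : Set (Fin n → K)) (x : B) : Fin (n + 1) → Prop := fun i => (x : Fin n → K) ∈ S i

/-- `S_{≥ d}`. -/
def upper (d : Fin (n + 1)) : Set (Fin n → K) := ⋃ i, ⋃ (_ : d ≤ i), S i

/-- `S 0, …, S n` is a t-stratification of `B₀`. -/
structure IsTStratification : Prop where
  definable : ∀ i, Definable (K := K) L (S i)
  disjoint : ∀ i j, i ≠ j → Disjoint (S i) (S j)
  iUnion_eq : ⋃ i, S i = B₀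
  dim_le : ∀ d : Fin (n + 1), dim (S d) ≤ (((d : ℕ) : ℕ∞) : WithBot ℕ∞)
  translatable : ∀ (d : Fin (n + 1)) (B : Set (Fin n → K)), IsBall B → B ⊆ upper S d →
    IsDTranslatable L (stratColor S B) d

variable {B₀}

/-- The t-stratification `S` of `B₀` reflects `χ`. -/
def Reflects {C : Type*} (χ : B₀ → C) : Prop :=
  ∀ (d : Fin (n + 1)) (B : Set (Fin n → K)) (hB : B ⊆ B₀), IsBall B → B ⊆ upper S d →
    IsDTranslatable L (fun x : B => (stratColor S B x, χ (Set.inclusion hB x))) d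

/-- The rainbow of `S`, with the color of `x` being the tuple of sets `rv (x - S i)` itself
instead of a code for it. -/
def rainbow (x : B₀) : Fin (n + 1) → Set (RVn K n) :=
  fun i => (fun s : Fin n → K => rvn ((x : Fin n → K) - s)) '' S i

/-- A map between subsets of `B₀`, here from `B₀` to itself, respects a map on `B₀`. -/
def Respects {X C : Type*} (φ : X → X) (χ : X → C) : Prop := χ ∘ φ = χ

end Stratifications

end TStrat

set_option linter.unusedSectionVars false

/-! The implication from 2 to 3 is formal: a risometry respecting the strata carries the points of
`S i` seen from `x` to the points of `S i` seen from `φ x`, without changing leading terms, so it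
preserves the rainbow (`rainbow_risometry`).

For 3 to 1, let `F` straighten the stratification on a ball `B` along `W`. A translation by an
element of `W` preserving `B`, conjugated by `F` and extended by the identity, is a definable
risometry of `B₀` respecting the strata (`exists_defRiso_translation`). By assumption it preserves
`χ`, so the same `F` and `W` also straighten `χ`.

The substance is 1 to 2 (`Reflects.rainbow_refines`). Let `x`, `x'` have equal rainbow, and let `B`
be the smallest closed ball containing both, with `B` inside `S_{≥ d}`. Moving `x'` along a
straightened leaf of `B` changes neither its color nor its rainbow, so `x - x'` may be taken
transversal to the leaves. If `S d` then met the new, possibly smaller, ball spanned by the two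
points at some `z`, equality of rainbows would give a point of `S d` near `z - (x - x')`, and by
iteration points near `z - m (x - x')` for all `m`. In residue characteristic zero these lie on
pairwise disjoint leaves, all contained in `S d`, and every leaf meets every coordinate fiber over a
ball of `K ^ d`. Thus `S d` would have dimension at least `d + 1` (`notMem_of_rainbow_eq`). Hence
the new ball lies in `S_{≥ d+1}`, and the argument is repeated.

Two facts about the theory carry this. Infinite fibers over a `d`-dimensional ball force dimension
at least `d + 1` (`le_dim_of_big_infinite`); this follows from b-minimality once definable maps from
auxiliary sorts to `K` are known to have finite image and definable families to be uniformly finite.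
A leaf meets each fiber because a definable map infinitesimally close to the identity on a closed
ball has a zero (`exists_eq_zero_of_risometry`), which rests on definable spherical completeness
(`exists_mem_forall_ball`). Compactness arguments are made with ultrapowers. -/

namespace TStrat

/-! ### Ultrapowers of Henselian valued fields -/

section Ultrapower

variable {I : Type u}

/-- The ultrapower of `K`. -/
def UPow (U : Ultrafilter I) (K : Type u) : Type u := (U : Filter I).Product fun _ => K

variable (U : Ultrafilter I) (K : Type u)

noncomputable instance [Field K] : Field (UPow U K) :=
  inferInstanceAs (Field (Filter.Germ (U : Filter I) K))

variable {K}

/-- The class of a family in the ultrapower. -/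
def UPow.mk (x : I → K) : UPow U K := (x : (U : Filter I).Product fun _ => K)

namespace UPow

theorem mk_surjective : Function.Surjective (mk U : (I → K) → UPow U K) :=
  Quotient.mk_surjective

variable {U}

theorem mk_eq {x y : I → K} : mk U x = mk U y ↔ ∀ᶠ i in U, x i = y i := Quotient.eq''

section Ring

variable [Field K]

theorem mk_mul (x y : I → K) : mk U (x * y) = mk U x * mk U y := rfl
theorem mk_sub (x y : I → K) : mk U (x - y) = mk U x - mk U y := rfl
theorem mk_inv (x : I → K) : mk U (x⁻¹) = (mk U x)⁻¹ := rfl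
theorem mk_zero : mk U (0 : I → K) = 0 := rfl

variable (U) in
/-- The class map as a ring homomorphism. -/
noncomputable def mkHom : (I → K) →+* UPow U K where
  toFun := mk U
  map_one' := rfl
  map_mul' _ _ := rfl
  map_zero' := rfl
  map_add' _ _ := rfl

end Ring

variable [HenselianVF K]

variable (U K) in
/-- The valuation ring of the ultrapower. -/
noncomputable def integers : ValuationSubring (UPow U K) where
  carrier := {x | ∃ y : I → K, (∀ i, y i ∈ O K) ∧ mk U y = x}
  mul_mem' := by
    rintro _ _ ⟨x, hx, rfl⟩ ⟨y, hy, rfl⟩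
    exact ⟨x * y, fun i => mul_mem (hx i) (hy i), rfl⟩
  one_mem' := ⟨1, fun _ => one_mem _, rfl⟩
  add_mem' := by
    rintro _ _ ⟨x, hx, rfl⟩ ⟨y, hy, rfl⟩
    exact ⟨x + y, fun i => add_mem (hx i) (hy i), rfl⟩
  zero_mem' := ⟨0, fun _ => zero_mem _, rfl⟩
  neg_mem' := by
    rintro _ ⟨x, hx, rfl⟩
    exact ⟨-x, fun i => neg_mem (hx i), rfl⟩
  mem_or_inv_mem' := by
    classical
    intro x
    obtain ⟨x, rfl⟩ := mk_surjective U x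
    rcases Ultrafilter.em U (fun i => x i ∈ O K) with h | h
    -- The carrier asks for a representative that is integral at every index, so the coordinates at
    -- the exceptional indices are replaced by `0`.
    · refine Or.inl ⟨fun i => if x i ∈ O K then x i else 0, fun i => ?_, ?_⟩
      · dsimp only
        split_ifs with hi
        · exact hi
        · exact zero_mem _
      · rw [mk_eq]
        filter_upwards [h] with i hi
        simp [hi]
    · refine Or.inr ⟨fun i => if x i ∈ O K then 0 else (x i)⁻¹, fun i => ?_, ?_⟩
      · dsimp only
        split_ifs with hi
        · exact zero_mem _
        · exact ((O K).mem_or_inv_mem (x i)).resolve_left hi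
      · rw [← mk_inv, mk_eq]
        filter_upwards [h] with i hi
        simp [hi]

theorem mk_mem_integers {x : I → K} : mk U x ∈ integers U K ↔ ∀ᶠ i in U, x i ∈ O K := by
  classical
  constructor
  · rintro ⟨y, hy, hyx⟩
    filter_upwards [mk_eq.mp hyx] with i hi
    exact hi ▸ hy i
  · intro h
    refine ⟨fun i => if x i ∈ O K then x i else 0, fun i => ?_, ?_⟩
    · dsimp only
      split_ifs with hi
      · exact hi
      · exact zero_mem _
    · rw [mk_eq]
      filter_upwards [h] with i hi
      simp [hi]

end UPow

theorem isUnit_integers_iff {F : Type*} [Field F] (R : ValuationSubring F) (x : R) :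
    IsUnit x ↔ (x : F) ≠ 0 ∧ (x : F)⁻¹ ∈ R := by
  constructor
  · rintro ⟨y, rfl⟩
    have h : ((y : R) : F) * ((y⁻¹ : Rˣ) : R) = 1 := by
      rw [← MulMemClass.coe_mul, y.mul_inv]; rfl
    refine ⟨left_ne_zero_of_mul_eq_one h, ?_⟩
    rw [inv_eq_of_mul_eq_one_right h]
    exact Subtype.property _
  · rintro ⟨h0, h⟩
    exact IsUnit.of_mul_eq_one ⟨_, h⟩ (Subtype.ext (mul_inv_cancel₀ h0))

theorem natCast_isUnit {K : Type u} [HenselianVF K] {m : ℕ} (hm : m ≠ 0) :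
    IsUnit (m : O K) := by
  have := HenselianVF.residue_charZero (K := K)
  by_contra h
  have h1 : IsLocalRing.residue (O K) (m : O K) = 0 := by
    rw [IsLocalRing.residue_eq_zero_iff]
    exact h
  rw [map_natCast, Nat.cast_eq_zero] at h1
  exact hm h1

namespace UPow

variable {U} [HenselianVF K]

variable (U K) in
/-- The class map of the valuation ring of the ultrapower. -/
noncomputable def mkInt : (I → O K) →+* integers U K :=
  ((mkHom U).comp (RingHom.pi fun i => (O K).subtype.comp (Pi.evalRingHom _ i))).codRestrict
    (integers U K) fun x => ⟨fun i => x i, fun i => (x i).2, rfl⟩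

theorem coe_mkInt (x : I → O K) : (mkInt U K x : UPow U K) = mk U fun i => (x i : K) := rfl

theorem mkInt_surjective : Function.Surjective (mkInt U K) := by
  rintro ⟨_, y, hy, rfl⟩
  exact ⟨fun i => ⟨y i, hy i⟩, rfl⟩

theorem isUnit_mkInt {x : I → O K} : IsUnit (mkInt U K x) ↔ ∀ᶠ i in U, IsUnit (x i) := by
  simp only [isUnit_integers_iff]
  rw [coe_mkInt, ← mk_inv, mk_mem_integers, ← mk_zero, ne_eq, mk_eq,
    ← Ultrafilter.eventually_not, ← Filter.eventually_and]
  rfl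

theorem mkInt_mem_maximalIdeal {x : I → O K} :
    mkInt U K x ∈ IsLocalRing.maximalIdeal _ ↔
      ∀ᶠ i in U, x i ∈ IsLocalRing.maximalIdeal (O K) := by
  simp only [IsLocalRing.mem_maximalIdeal, mem_nonunits_iff, isUnit_mkInt,
    ← Ultrafilter.eventually_not]

theorem eval_mkInt (F : Polynomial (I → O K)) (a : I → O K) :
    (F.map (mkInt U K)).eval (mkInt U K a) =
      mkInt U K fun i => (F.map (Pi.evalRingHom _ i)).eval (a i) := by
  rw [Polynomial.eval_map, Polynomial.eval₂_at_apply]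
  congr 1
  funext i
  have := Polynomial.eval₂_at_apply (p := F) (Pi.evalRingHom (fun _ => O K) i) a
  rw [Polynomial.eval_map]
  exact this.symm

/-- Roots are lifted index by index: a monic polynomial lifts to a monic polynomial over the product
ring, Hensel's lemma applies at almost every index, and the roots found there form a class in the
ultrapower. -/
theorem henselian : HenselianLocalRing (integers U K) := by
  classical
  have hO := HenselianVF.henselian (K := K)
  refine { is_henselian := fun f hf a₀ h0 h1 => ?_ }
  have hlift : f ∈ Polynomial.lifts (mkInt U K) := by
    rw [Polynomial.mem_lifts]
    exact Polynomial.map_surjective _ mkInt_surjective f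
  obtain ⟨F, rfl, -, hF⟩ := Polynomial.lifts_and_degree_eq_and_monic hlift hf
  obtain ⟨a, rfl⟩ := mkInt_surjective a₀
  rw [eval_mkInt, mkInt_mem_maximalIdeal] at h0
  rw [Polynomial.derivative_map, eval_mkInt, isUnit_mkInt] at h1
  have key : ∀ᶠ i in U, ∃ b : O K, (F.map (Pi.evalRingHom _ i)).IsRoot b ∧
      b - a i ∈ IsLocalRing.maximalIdeal (O K) := by
    filter_upwards [h0, h1] with i h0 h1
    refine HenselianLocalRing.is_henselian _ (hF.map _) (a i) h0 ?_
    rwa [Polynomial.derivative_map]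
  let b : I → O K := fun i => Classical.epsilon fun b : O K =>
    (F.map (Pi.evalRingHom _ i)).IsRoot b ∧ b - a i ∈ IsLocalRing.maximalIdeal (O K)
  have hb : ∀ᶠ i in U, (F.map (Pi.evalRingHom _ i)).IsRoot (b i) ∧
      b i - a i ∈ IsLocalRing.maximalIdeal (O K) := by
    filter_upwards [key] with i hi
    exact Classical.epsilon_spec hi
  refine ⟨mkInt U K b, ?_, ?_⟩
  · rw [Polynomial.IsRoot, eval_mkInt]
    refine Subtype.ext ?_
    rw [coe_mkInt, ZeroMemClass.coe_zero, ← mk_zero, mk_eq]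
    filter_upwards [hb] with i hi
    rw [hi.1.eq_zero]
    rfl
  · rw [← map_sub, mkInt_mem_maximalIdeal]
    filter_upwards [hb] with i hi
    exact hi.2

noncomputable instance : HenselianVF (UPow U K) where
  integers := integers U K
  henselian := henselian
  residue_charZero := by
    refine ⟨fun m n h => ?_⟩
    have key : ∀ {m n : ℕ}, m < n → (m : IsLocalRing.ResidueField (integers U K)) ≠ n := by
      intro m n hmn h
      have h1 : IsLocalRing.residue (integers U K) ((n - m : ℕ) : integers U K) = 0 := by
        rw [map_natCast, Nat.cast_sub hmn.le, ← h, sub_self]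
      rw [IsLocalRing.residue_eq_zero_iff] at h1
      refine h1 ?_
      rw [← map_natCast (mkInt U K), isUnit_mkInt]
      exact Filter.Eventually.of_forall fun i => natCast_isUnit (by omega)
    rcases lt_trichotomy m n with hmn | rfl | hmn
    · exact absurd h (key hmn)
    · rfl
    · exact absurd h.symm (key hmn)

theorem mem_O {x : I → K} : mk U x ∈ O (UPow U K) ↔ ∀ᶠ i in U, x i ∈ O K := mk_mem_integers

/-! #### The language -/

variable {L : FirstOrder.Language.{u, u}} [L.Structure K]

noncomputable instance : L.Structure (UPow U K) :=
  inferInstanceAs <| (L.Structure ((U : Filter I).Product fun _ => K))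

theorem funMap_mk {m : ℕ} (f : (expand L).Functions m) (y : Fin m → I → K) :
    FirstOrder.Language.Structure.funMap f (fun j => mk U (y j)) =
      mk U fun i => FirstOrder.Language.Structure.funMap f fun j => y j i := by
  rcases f with (f | f) | f
  · change FirstOrder.Language.Structure.funMap (M := UPow U K) (L := Language.ring) f _ =
      mk U fun i : I => FirstOrder.Language.Structure.funMap (M := K) (L := Language.ring) f _
    cases f
    · simp only [FirstOrder.Ring.CompatibleRing.funMap_add]; rfl
    · simp only [FirstOrder.Ring.CompatibleRing.funMap_mul]; rfl
    · simp only [FirstOrder.Ring.CompatibleRing.funMap_neg]; rfl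
    · simp only [FirstOrder.Ring.CompatibleRing.funMap_zero]; rfl
    · simp only [FirstOrder.Ring.CompatibleRing.funMap_one]; rfl
  · exact Empty.elim f
  · exact FirstOrder.Language.Ultraproduct.funMap_cast (L := L) (u := U) (M := fun _ : I => K) f y

theorem relMap_mk {m : ℕ} (r : (expand L).Relations m) (y : Fin m → I → K) :
    FirstOrder.Language.Structure.RelMap r (fun j => mk U (y j)) ↔
      ∀ᶠ i in U, FirstOrder.Language.Structure.RelMap r fun j => y j i := by
  rcases r with (r | r) | r
  · exact r.elim
  · cases r
    exact mem_O
  · exact FirstOrder.Language.relMap_quotient_mk' (L := L) (s := (U : Filter I).productSetoid fun _ => K)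
      (ps := FirstOrder.Language.Ultraproduct.setoidPrestructure (fun _ : I => K) U) r y

variable (U K L) in
/-- The structure of the ultrapower as an ultraproduct. -/
@[reducible] noncomputable def ultraStructure : (expand L).Structure (UPow U K) :=
  FirstOrder.Language.Ultraproduct.structure (L := expand L) (M := fun _ : I => K) (u := U)

/-- The structure on the ultrapower is assembled from its field operations, its valuation ring and
the symbols of `L`, whereas Łoś's theorem speaks of the ultraproduct structure for the whole
language. This identification makes the theorem applicable. -/
theorem structure_eq :
    FirstOrder.Language.sumStructure (FirstOrder.Language.ring.sum integersLanguage) L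
      (UPow U K) = ultraStructure U K L := by
  refine FirstOrder.Language.Structure.ext ?_ ?_
  · funext n f x
    have hx : ∀ j, ∃ y : I → K, x j = mk U y :=
      fun j => (mk_surjective U (x j)).imp fun _ h => h.symm
    choose y hy using hx
    obtain rfl : x = fun j => mk U (y j) := funext hy
    exact (funMap_mk f y).trans
      (FirstOrder.Language.Ultraproduct.funMap_cast (L := expand L) (u := U) (M := fun _ : I => K) f y).symm
  · funext n r x
    have hx : ∀ j, ∃ y : I → K, x j = mk U y :=
      fun j => (mk_surjective U (x j)).imp fun _ h => h.symm
    choose y hy using hx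
    obtain rfl : x = fun j => mk U (y j) := funext hy
    exact propext ((relMap_mk r y).trans (FirstOrder.Language.relMap_quotient_mk' (L := expand L)
      (s := (U : Filter I).productSetoid fun _ => K)
      (ps := FirstOrder.Language.Ultraproduct.setoidPrestructure (fun _ : I => K) U) r y).symm)

theorem realize_mk {α : Type*} (φ : (expand L).Formula α) (x : α → I → K) :
    φ.Realize (fun j => mk U (x j)) ↔ ∀ᶠ i in U, φ.Realize fun j => x j i := by
  rw [structure_eq]
  exact FirstOrder.Language.Ultraproduct.realize_formula_cast (u := U) (M := fun _ : I => K) φ x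

theorem models {T : (expand L).Theory} (hK : K ⊨ T) : UPow U K ⊨ T := by
  rw [FirstOrder.Language.Theory.model_iff] at hK ⊢
  intro φ hφ
  rw [structure_eq]
  exact (FirstOrder.Language.Ultraproduct.sentence_realize (u := U) (M := fun _ : I => K) φ).mpr
    (Filter.Eventually.of_forall fun _ => hK φ hφ)

variable (U) in
/-- The diagonal embedding. -/
def diag (x : K) : UPow U K := mk U fun _ => x

/-- The sets definable in `K` extend to definable sets of the ultrapower. -/
theorem exists_star {α : Type*} {S : Set (α → K)}
    (hS : (Set.univ : Set K).Definable (expand L) S) :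
    ∃ S' : Set (α → UPow U K), (Set.univ : Set (UPow U K)).Definable (expand L) S' ∧
      ∀ x : α → I → K, (fun j => mk U (x j)) ∈ S' ↔ ∀ᶠ i in U, (fun j => x j i) ∈ S := by
  rw [Set.definable_iff_exists_formula_sum] at hS
  obtain ⟨φ, rfl⟩ := hS
  let e : ((Set.univ : Set K) : Type u) → UPow U K := fun k => diag U k
  refine ⟨{v | φ.Realize (Sum.elim e v)}, ?_, fun x => ?_⟩
  · rw [Set.definable_iff_exists_formula_sum]
    refine ⟨φ.relabel (Sum.map (fun k => ⟨e k, trivial⟩) id), ?_⟩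
    ext v
    simp only [Set.mem_ofPred_eq, FirstOrder.Language.Formula.realize_relabel, Sum.elim_comp_map]
    rfl
  · have := realize_mk (U := U) φ (Sum.elim (fun k _ => (k : K)) x)
    simp only [Set.mem_ofPred_eq]
    convert this using 2
    · funext j; cases j <;> rfl
    · refine funext fun i => congrArg (φ.Realize (M := K)) (funext fun j => ?_)
      cases j <;> rfl

end UPow
end Ultrapower

/-! ### Valuations of tuples -/

section ValBasics

variable {K : Type u} [HenselianVF K] {n : ℕ}

theorem val_eq_zero {x : K} : val x = 0 ↔ x = 0 := (O K).valuation.zero_iff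

@[simp] theorem val_zero : val (0 : K) = 0 := map_zero _

theorem val_pos {x : K} : 0 < val x ↔ x ≠ 0 := by
  rw [zero_lt_iff, ne_eq, val_eq_zero]

theorem val_mul (x y : K) : val (x * y) = val x * val y := map_mul _ _ _

@[simp] theorem val_neg (x : K) : val (-x) = val x := Valuation.map_neg _ _

theorem val_add_le (x y : K) : val (x + y) ≤ max (val x) (val y) := Valuation.map_add _ _ _

theorem val_sub_comm (x y : K) : val (x - y) = val (y - x) := Valuation.map_sub_swap _ _ _

theorem val_surjective (γ : Val K) : ∃ x : K, val x = γ := (O K).valuation_surjective γ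

theorem val_le_one_iff {x : K} : val x ≤ 1 ↔ x ∈ O K := (O K).valuation_le_one_iff x

/-- Residue characteristic zero enters through this: it allows averages without loss of valuation,
and keeps the multiples of a vector by positive integers at its size. -/
theorem val_natCast {m : ℕ} (hm : m ≠ 0) : val (m : K) = 1 := by
  obtain ⟨u, hu⟩ := natCast_isUnit (K := K) hm
  have := (O K).valuation_unit u
  rw [hu] at this
  exact_mod_cast this

theorem natCast_ne_zero {m : ℕ} (hm : m ≠ 0) : (m : K) ≠ 0 := by
  rw [← val_pos, val_natCast hm]; exact zero_lt_one

instance : CharZero K := by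
  refine charZero_of_inj_zero fun m hm => ?_
  by_contra h
  exact natCast_ne_zero h hm

theorem val_le_valn (x : Fin n → K) (i : Fin n) : val (x i) ≤ valn x :=
  Finset.le_sup (f := fun i => val (x i)) (Finset.mem_univ i)

theorem valn_le_iff {x : Fin n → K} {γ : Val K} : valn x ≤ γ ↔ ∀ i, val (x i) ≤ γ := by
  simp [valn]

theorem valn_lt_iff {x : Fin n → K} {γ : Val K} (h : 0 < γ) :
    valn x < γ ↔ ∀ i, val (x i) < γ := by
  simp [valn, Finset.sup_lt_iff (show ⊥ < γ from h)]

theorem exists_val_eq_valn (x : Fin n → K) (h : valn x ≠ 0) : ∃ i, val (x i) = valn x := by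
  rcases isEmpty_or_nonempty (Fin n) with hn | hn
  · exact absurd (by simp [valn]; rfl) h
  · obtain ⟨i, -, hi⟩ := Finset.exists_mem_eq_sup (Finset.univ : Finset (Fin n))
      Finset.univ_nonempty fun i => val (x i)
    exact ⟨i, hi.symm⟩

theorem valn_eq_zero {x : Fin n → K} : valn x = 0 ↔ x = 0 := by
  rw [← le_zero_iff, valn_le_iff, funext_iff]
  simp [val_eq_zero]

@[simp] theorem valn_zero : valn (0 : Fin n → K) = 0 := valn_eq_zero.mpr rfl

theorem valn_pos {x : Fin n → K} : 0 < valn x ↔ x ≠ 0 := by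
  rw [zero_lt_iff, ne_eq, valn_eq_zero]

@[simp] theorem valn_neg (x : Fin n → K) : valn (-x) = valn x := by
  simp [valn]

theorem valn_add_le (x y : Fin n → K) : valn (x + y) ≤ max (valn x) (valn y) := by
  have := valn_sub_le x (-y)
  rwa [sub_neg_eq_add, valn_neg] at this

theorem valn_add_lt {x y : Fin n → K} {γ : Val K} (hx : valn x < γ) (hy : valn y < γ) :
    valn (x + y) < γ := (valn_add_le x y).trans_lt (max_lt hx hy)

theorem valn_sub_lt {x y : Fin n → K} {γ : Val K} (hx : valn x < γ) (hy : valn y < γ) :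
    valn (x - y) < γ := (valn_sub_le x y).trans_lt (max_lt hx hy)

theorem valn_smul (c : K) (x : Fin n → K) : valn (c • x) = val c * valn x := by
  rcases eq_or_ne c 0 with rfl | hc
  · simp
  refine le_antisymm (valn_le_iff.mpr fun i => ?_) ?_
  · rw [Pi.smul_apply, smul_eq_mul, val_mul]
    exact mul_le_mul_right (val_le_valn x i) _
  · by_cases h : valn x = 0
    · simp [h]
    · obtain ⟨i, hi⟩ := exists_val_eq_valn x h
      rw [← hi, ← val_mul]
      exact val_le_valn (c • x) i

theorem valn_const (x : K) : valn (fun _ : Fin 1 => x) = val x := by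
  simp [valn]

/-- The coordinatewise form is visibly first order. The alternative `val (x i) = 0` covers `m = 0`,
where there is no coordinate of `y` to compare with. -/
theorem valn_le_valn_iff {m : ℕ} {x : Fin n → K} {y : Fin m → K} :
    valn x ≤ valn y ↔ ∀ i, val (x i) = 0 ∨ ∃ j, val (x i) ≤ val (y j) := by
  rw [valn_le_iff]
  refine forall_congr' fun i => ⟨fun h => ?_, ?_⟩
  · by_cases h0 : valn y = 0
    · rw [h0] at h
      exact Or.inl (le_antisymm h zero_le)
    · obtain ⟨j, hj⟩ := exists_val_eq_valn y h0
      exact Or.inr ⟨j, hj ▸ h⟩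
  · rintro (h | ⟨j, hj⟩)
    · rw [h]; exact zero_le
    · exact hj.trans (val_le_valn y j)

theorem valn_eq_of_sub_lt {x y : Fin n → K} (h : valn (x - y) < valn x) : valn y = valn x := by
  refine le_antisymm ?_ (valn_le_of_sub_lt h)
  have := valn_sub_le x (x - y)
  rw [sub_sub_cancel] at this
  exact this.trans (max_le le_rfl h.le)

theorem rvn_eq_iff {x y : Fin n → K} :
    rvn x = rvn y ↔ valn (x - y) < valn x ∨ (x = 0 ∧ y = 0) := Quotient.eq

theorem valn_eq_of_rvn_eq {x y : Fin n → K} (h : rvn x = rvn y) : valn x = valn y := by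
  rcases rvn_eq_iff.mp h with h | ⟨rfl, rfl⟩
  · exact (valn_eq_of_sub_lt h).symm
  · rfl

theorem valn_sub_lt_of_rvn_eq {x y : Fin n → K} (h : rvn x = rvn y) (hx : x ≠ 0) :
    valn (x - y) < valn x := by
  rcases rvn_eq_iff.mp h with h | ⟨rfl, rfl⟩
  · exact h
  · exact absurd rfl hx

theorem rvn_eq_of_sub_lt {x y : Fin n → K} (h : valn (x - y) < valn x) : rvn x = rvn y :=
  rvn_eq_iff.mpr (Or.inl h)

theorem rvn_surjective : Function.Surjective (rvn : (Fin n → K) → RVn K n) := Quotient.mk_surjective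

theorem rv_surjective : Function.Surjective (rv : K → RV K) := fun ξ => by
  obtain ⟨x, rfl⟩ := rvn_surjective ξ
  refine ⟨x 0, congrArg rvn (funext fun i => ?_)⟩
  rw [Subsingleton.elim i 0]

theorem rv_eq_iff {x y : K} : rv x = rv y ↔ val (x - y) < val x ∨ (x = 0 ∧ y = 0) := by
  rw [rv, rv, rvn_eq_iff]
  simp only [valn_const, funext_iff, Pi.zero_apply, forall_const]
  rw [← valn_const (x - y)]
  rfl

theorem val_eq_of_rv_eq {x y : K} (h : rv x = rv y) : val x = val y := by
  simpa [valn_const] using valn_eq_of_rvn_eq h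

end ValBasics

/-! ### Definable predicates and functions -/

section Toolkit

variable (L : FirstOrder.Language.{u, u}) {K : Type u} [HenselianVF K] [L.Structure K]

/-- `P` is definable with parameters from `A`. -/
def DP (A : Set K) {X : Type u} [Interpreted K X] (P : X → Prop) : Prop :=
  A.Definable (expand L) {y : Interpreted.Idx K X → K | P (Interpreted.proj y)}

variable (K) in
/-- Sorts that are quotients of a finite power of `K` by a definable equivalence relation. -/
class GoodSort (X : Type u) [Interpreted K X] : Prop where
  finite : Finite (Interpreted.Idx K X)
  surj : Function.Surjective (Interpreted.proj : (Interpreted.Idx K X → K) → X)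
  eq_def : DP L (∅ : Set K) fun p : X × X => p.1 = p.2

/-- `f` is definable with parameters from `A`. -/
@[fun_prop] def DF (A : Set K) {X Y : Type u} [Interpreted K X] [Interpreted K Y] (f : X → Y) :
    Prop :=
  DP L A fun p : X × Y => f p.1 = p.2

theorem _root_.Set.Definable.of_iff {L' : FirstOrder.Language.{u, u}} {M : Type u} [L'.Structure M]
    {A : Set M} {α : Type*} {S T : Set (α → M)} (hS : A.Definable L' S)
    (h : ∀ v, v ∈ T ↔ v ∈ S) : A.Definable L' T := by
  rwa [show T = S from Set.ext h]

variable {L} {A : Set K} {X Y Z : Type u} [Interpreted K X] [Interpreted K Y] [Interpreted K Z]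

namespace DP

theorem mono {B : Set K} (h : A ⊆ B) {P : X → Prop} (hP : DP L A P) : DP L B P :=
  Set.Definable.mono hP h

theorem of_empty {P : X → Prop} (hP : DP L (∅ : Set K) P) : DP L A P := hP.mono (Set.empty_subset _)

theorem and {P Q : X → Prop} (hP : DP L A P) (hQ : DP L A Q) : DP L A fun x => P x ∧ Q x :=
  Set.Definable.inter hP hQ

theorem or {P Q : X → Prop} (hP : DP L A P) (hQ : DP L A Q) : DP L A fun x => P x ∨ Q x :=
  Set.Definable.union hP hQ

theorem not {P : X → Prop} (hP : DP L A P) : DP L A fun x => ¬ P x :=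
  Set.Definable.compl hP

theorem congr {P Q : X → Prop} (hP : DP L A P) (h : ∀ x, Q x ↔ P x) : DP L A Q := by
  rwa [show Q = P from funext fun x => propext (h x)]

theorem imp {P Q : X → Prop} (hP : DP L A P) (hQ : DP L A Q) : DP L A fun x => P x → Q x :=
  (hP.not.or hQ).congr fun _ => imp_iff_not_or

theorem iff {P Q : X → Prop} (hP : DP L A P) (hQ : DP L A Q) : DP L A fun x => P x ↔ Q x :=
  ((hP.imp hQ).and (hQ.imp hP)).congr fun _ => iff_iff_implies_and_implies

theorem const (p : Prop) : DP L A fun _ : X => p := by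
  by_cases hp : p
  · simp [DP, hp]
  · simp [DP, hp]

/-- A map that only rearranges coordinates of representatives can be substituted without a
quantifier. Substitution of general definable maps, which quantifies over the graph, is built on
this case. -/
theorem comp_coord {P : Y → Prop} (hP : DP L A P) {g : X → Y}
    (r : Interpreted.Idx K Y → Interpreted.Idx K X)
    (h : ∀ y : Interpreted.Idx K X → K, g (Interpreted.proj y) = Interpreted.proj (y ∘ r)) :
    DP L A fun x => P (g x) := by
  have := Set.Definable.preimage_comp r hP
  unfold DP
  convert this using 1
  ext y
  simp [h]

theorem ex [GoodSort L K Y] {Q : X → Y → Prop} (hQ : DP L A fun p : X × Y => Q p.1 p.2) :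
    DP L A fun x => ∃ y, Q x y := by
  have := GoodSort.finite (L := L) (K := K) (X := Y)
  have h := Set.Definable.exists_of_finite (α := Interpreted.Idx K X) (β := Interpreted.Idx K Y) hQ
  unfold DP
  convert h using 1
  ext y
  simp only [Set.mem_ofPred_eq]
  rw [(GoodSort.surj (L := L) (K := K) (X := Y)).exists]
  rfl

theorem all [GoodSort L K Y] {Q : X → Y → Prop} (hQ : DP L A fun p : X × Y => Q p.1 p.2) :
    DP L A fun x => ∀ y, Q x y :=
  (ex (Q := fun x y => ¬ Q x y) hQ.not).not.congr fun x => by simp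

theorem ex_fin {ι : Type*} [Finite ι] {Q : ι → X → Prop} (hQ : ∀ i, DP L A (Q i)) :
    DP L A fun x => ∃ i, Q i x := by
  have := Set.definable_iUnion_of_finite hQ
  unfold DP
  convert this using 1
  ext; simp

theorem all_fin {ι : Type*} [Finite ι] {Q : ι → X → Prop} (hQ : ∀ i, DP L A (Q i)) :
    DP L A fun x => ∀ i, Q i x := by
  have := Set.definable_iInter_of_finite hQ
  unfold DP
  convert this using 1
  ext; simp

end DP

section Coordinates

theorem DP.fst {P : X → Prop} (hP : DP L A P) : DP L A fun p : X × Y => P p.1 :=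
  hP.comp_coord (g := Prod.fst) Sum.inl fun _ => rfl

theorem DP.snd {P : Y → Prop} (hP : DP L A P) : DP L A fun p : X × Y => P p.2 :=
  hP.comp_coord (g := Prod.snd) Sum.inr fun _ => rfl

theorem DP.comp [GoodSort L K Y] {P : Y → Prop} (hP : DP L A P) {g : X → Y} (hg : DF L A g) :
    DP L A fun x => P (g x) :=
  (DP.ex (Q := fun x y => g x = y ∧ P y) (DP.and hg hP.snd)).congr fun x => by simp

namespace DF

theorem of_coord [GoodSort L K Y] {g : X → Y} (r : Interpreted.Idx K Y → Interpreted.Idx K X)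
    (h : ∀ y : Interpreted.Idx K X → K, g (Interpreted.proj y) = Interpreted.proj (y ∘ r)) :
    DF L A g := by
  refine DP.comp_coord (Y := Y × Y) (P := fun p => p.1 = p.2) (GoodSort.eq_def (K := K)).of_empty
    (g := fun p : X × Y => (g p.1, p.2)) (Sum.map r id) fun y => ?_
  exact Prod.ext (h _) rfl

@[fun_prop]
theorem id' [GoodSort L K X] : DF L A fun x : X => x := of_coord id fun _ => rfl

@[fun_prop]
theorem comp [GoodSort L K Y] [GoodSort L K Z] {f : Y → Z} {g : X → Y} (hf : DF L A f)
    (hg : DF L A g) : DF L A fun x => f (g x) := by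
  have h1 : DP L A fun q : (X × Z) × Y => g q.1.1 = q.2 :=
    DP.comp_coord (Y := X × Y) hg (g := fun q : (X × Z) × Y => (q.1.1, q.2))
      (Sum.elim (Sum.inl ∘ Sum.inl) Sum.inr) fun _ => rfl
  have h2 : DP L A fun q : (X × Z) × Y => f q.2 = q.1.2 :=
    DP.comp_coord (Y := Y × Z) hf (g := fun q : (X × Z) × Y => (q.2, q.1.2))
      (Sum.elim Sum.inr (Sum.inl ∘ Sum.inr)) fun _ => rfl
  exact (DP.ex (Q := fun x y => g x.1 = y ∧ f y = x.2) (h1.and h2)).congr fun x => by simp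

end DF

instance [GoodSort L K X] [GoodSort L K Y] : GoodSort L K (X × Y) where
  finite := by
    have := GoodSort.finite (L := L) (K := K) (X := X)
    have := GoodSort.finite (L := L) (K := K) (X := Y)
    exact inferInstanceAs (Finite (_ ⊕ _))
  surj := by
    rintro ⟨x, y⟩
    obtain ⟨a, rfl⟩ := GoodSort.surj (L := L) (K := K) x
    obtain ⟨b, rfl⟩ := GoodSort.surj (L := L) (K := K) y
    exact ⟨Sum.elim a b, rfl⟩
  eq_def := by
    have h1 : DP L (∅ : Set K) fun q : (X × Y) × (X × Y) => q.1.1 = q.2.1 :=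
      DP.comp_coord (Y := X × X) GoodSort.eq_def
        (g := fun q : (X × Y) × (X × Y) => (q.1.1, q.2.1))
        (Sum.map Sum.inl Sum.inl) fun _ => rfl
    have h2 : DP L (∅ : Set K) fun q : (X × Y) × (X × Y) => q.1.2 = q.2.2 :=
      DP.comp_coord (Y := Y × Y) GoodSort.eq_def
        (g := fun q : (X × Y) × (X × Y) => (q.1.2, q.2.2))
        (Sum.map Sum.inr Sum.inr) fun _ => rfl
    exact (h1.and h2).congr fun q => Prod.ext_iff

section Pi

variable {m : ℕ} {F : Fin m → Type u} [∀ i, Interpreted K (F i)] [∀ i, GoodSort L K (F i)]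

instance : GoodSort L K (∀ i, F i) where
  finite := by
    have := fun i => GoodSort.finite (L := L) (K := K) (X := F i)
    exact inferInstanceAs (Finite (Σ i, Interpreted.Idx K (F i)))
  surj := by
    intro x
    choose a ha using fun i => GoodSort.surj (L := L) (K := K) (x i)
    exact ⟨fun j => a j.1 j.2, funext ha⟩
  eq_def := by
    have h (i : Fin m) : DP L (∅ : Set K) fun q : (∀ i, F i) × (∀ i, F i) => q.1 i = q.2 i :=
      DP.comp_coord (Y := F i × F i) GoodSort.eq_def
        (g := fun q : (∀ i, F i) × (∀ i, F i) => (q.1 i, q.2 i))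
        (Sum.map (fun j => ⟨i, j⟩) fun j => ⟨i, j⟩) fun _ => rfl
    exact (DP.all_fin h).congr fun q => funext_iff

end Pi

namespace DF

@[fun_prop]
theorem fst' [GoodSort L K X] : DF L A fun p : X × Y => p.1 := of_coord Sum.inl fun _ => rfl

@[fun_prop]
theorem snd' [GoodSort L K Y] : DF L A fun p : X × Y => p.2 := of_coord Sum.inr fun _ => rfl

@[fun_prop]
theorem prodMk [GoodSort L K Y] [GoodSort L K Z] {f : X → Y} {g : X → Z} (hf : DF L A f)
    (hg : DF L A g) : DF L A fun x => (f x, g x) := by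
  have h1 : DP L A fun q : X × (Y × Z) => f q.1 = q.2.1 :=
    DP.comp_coord (Y := X × Y) hf (g := fun q : X × (Y × Z) => (q.1, q.2.1))
      (Sum.elim Sum.inl (Sum.inr ∘ Sum.inl)) fun _ => rfl
  have h2 : DP L A fun q : X × (Y × Z) => g q.1 = q.2.2 :=
    DP.comp_coord (Y := X × Z) hg (g := fun q : X × (Y × Z) => (q.1, q.2.2))
      (Sum.elim Sum.inl (Sum.inr ∘ Sum.inr)) fun _ => rfl
  exact (h1.and h2).congr fun q => Prod.ext_iff

variable {m : ℕ} {F : Fin m → Type u} [∀ i, Interpreted K (F i)] [∀ i, GoodSort L K (F i)]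

@[fun_prop]
theorem apply' (i : Fin m) : DF L A fun x : (∀ i, F i) => x i :=
  of_coord (fun j => ⟨i, j⟩) fun _ => rfl

@[fun_prop]
theorem pi {f : X → ∀ i, F i} (hf : ∀ i, DF L A fun x => f x i) : DF L A f := by
  have h (i : Fin m) : DP L A fun q : X × (∀ i, F i) => f q.1 i = q.2 i :=
    DP.comp_coord (Y := X × F i) (hf i) (g := fun q : X × (∀ i, F i) => (q.1, q.2 i))
      (Sum.map id (fun j => ⟨i, j⟩)) fun _ => rfl
  exact (DP.all_fin h).congr fun q => funext_iff

end DF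

theorem DP.eq [GoodSort L K Y] {f g : X → Y} [GoodSort L K X] (hf : DF L A f) (hg : DF L A g) :
    DP L A fun x => f x = g x :=
  DP.comp (Y := Y × Y) (P := fun p => p.1 = p.2) GoodSort.eq_def.of_empty (hf.prodMk hg)

instance : GoodSort L K K where
  finite := inferInstanceAs (Finite Unit)
  surj x := ⟨fun _ => x, rfl⟩
  eq_def := by
    unfold DP
    rw [Set.empty_definable_iff]
    refine ⟨FirstOrder.Language.Term.equal (FirstOrder.Language.Term.var (Sum.inl ()))
      (FirstOrder.Language.Term.var (Sum.inr ())), ?_⟩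
    ext y
    simp
    rfl

/-- Only elements of `K` are available as parameters, so an element of a quotient sort is named
through the coordinates of one representative and the definability of equality. -/
theorem DF.const [GoodSort L K X] [GoodSort L K Y] (c : Y) :
    DF L (Set.univ : Set K) fun _ : X => c := by
  have hK : ∀ k : K, DP L (Set.univ : Set K) fun y : K => k = y := by
    intro k
    unfold DP
    rw [Set.definable_iff_exists_formula_sum]
    refine ⟨FirstOrder.Language.Term.equal (FirstOrder.Language.Term.var (Sum.inl ⟨k, trivial⟩))
      (FirstOrder.Language.Term.var (Sum.inr ())), ?_⟩
    ext y
    simp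
    rfl
  obtain ⟨c, rfl⟩ := GoodSort.surj (L := L) (K := K) c
  have hf := GoodSort.finite (L := L) (K := K) (X := Y)
  have h : DP L (Set.univ : Set K) fun y : Y => Interpreted.proj c = y := by
    have h1 : (Set.univ : Set K).Definable (expand L)
        {z : Interpreted.Idx K Y ⊕ Interpreted.Idx K Y → K | (∀ i, c i = z (Sum.inr i)) ∧
          (Interpreted.proj (z ∘ Sum.inr) : Y) = Interpreted.proj (z ∘ Sum.inl)} := by
      refine Set.Definable.inter ?_ ?_
      · have := Set.definable_iInter_of_finite fun i =>
          Set.Definable.preimage_comp (fun _ : Unit =>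
            (Sum.inr i : Interpreted.Idx K Y ⊕ Interpreted.Idx K Y)) (hK (c i))
        refine this.of_iff fun z => ?_
        rw [Set.mem_iInter]
        rfl
      · exact DP.comp_coord (X := Y × Y) (Y := Y × Y) (P := fun p => p.1 = p.2)
          GoodSort.eq_def.of_empty (g := Prod.swap) Sum.swap fun _ => rfl
    have h2 := Set.Definable.exists_of_finite h1
    unfold DP
    convert h2 using 1
    ext z
    constructor
    · intro h
      exact ⟨c, fun i => rfl, h⟩
    · rintro ⟨u, hu, hu'⟩
      obtain rfl : c = u := funext hu
      exact hu'
  exact h.snd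

end Coordinates

section Field

theorem DP.equal_terms {α : Type} (s t : (expand L).Term α) :
    (∅ : Set K).Definable (expand L) {v : α → K | s.realize v = t.realize v} := by
  rw [Set.empty_definable_iff]
  refine ⟨s.equal t, ?_⟩
  ext v
  simp

namespace DF

theorem add_aux : DF L A fun p : K × K => p.1 + p.2 := by
  refine DP.of_empty ?_
  have := DP.equal_terms (L := L) (K := K)
    (FirstOrder.Language.Functions.apply₂ (L := expand L) (Sum.inl (Sum.inl FirstOrder.Ring.addFunc))
      (.var (Sum.inl (Sum.inl ()))) (.var (Sum.inl (Sum.inr ()))))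
    (.var (Sum.inr () : (Unit ⊕ Unit) ⊕ Unit))
  exact this.of_iff fun v => Iff.rfl

theorem mul_aux : DF L A fun p : K × K => p.1 * p.2 := by
  refine DP.of_empty ?_
  have := DP.equal_terms (L := L) (K := K)
    (FirstOrder.Language.Functions.apply₂ (L := expand L) (Sum.inl (Sum.inl FirstOrder.Ring.mulFunc))
      (.var (Sum.inl (Sum.inl ()))) (.var (Sum.inl (Sum.inr ()))))
    (.var (Sum.inr () : (Unit ⊕ Unit) ⊕ Unit))
  exact this.of_iff fun v => Iff.rfl

theorem neg_aux : DF L A fun x : K => -x := by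
  refine DP.of_empty ?_
  have := DP.equal_terms (L := L) (K := K)
    (FirstOrder.Language.Functions.apply₁ (L := expand L) (Sum.inl (Sum.inl FirstOrder.Ring.negFunc))
      (.var (Sum.inl ()))) (.var (Sum.inr () : Unit ⊕ Unit))
  exact this.of_iff fun v => Iff.rfl

variable [GoodSort L K X]

theorem zero : DF L A fun _ : X => (0 : K) := by
  refine DP.of_empty (DP.snd (P := fun y : K => 0 = y) ?_)
  have := DP.equal_terms (L := L) (K := K)
    (FirstOrder.Language.Constants.term (L := expand L) (Sum.inl (Sum.inl FirstOrder.Ring.zeroFunc)))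
    (.var ())
  exact this.of_iff fun v => Iff.rfl

theorem one : DF L A fun _ : X => (1 : K) := by
  refine DP.of_empty (DP.snd (P := fun y : K => 1 = y) ?_)
  have := DP.equal_terms (L := L) (K := K)
    (FirstOrder.Language.Constants.term (L := expand L) (Sum.inl (Sum.inl FirstOrder.Ring.oneFunc)))
    (.var ())
  exact this.of_iff fun v => Iff.rfl

variable {f g : X → K}

@[fun_prop]
theorem add (hf : DF L A f) (hg : DF L A g) : DF L A fun x => f x + g x :=
  add_aux.comp (hf.prodMk hg)

@[fun_prop]
theorem mul (hf : DF L A f) (hg : DF L A g) : DF L A fun x => f x * g x :=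
  mul_aux.comp (hf.prodMk hg)

@[fun_prop]
theorem neg (hf : DF L A f) : DF L A fun x => -f x := neg_aux.comp hf

@[fun_prop]
theorem sub (hf : DF L A f) (hg : DF L A g) : DF L A fun x => f x - g x := by
  simpa only [sub_eq_add_neg] using hf.add hg.neg

theorem sum {ι : Type*} (s : Finset ι) {f : ι → X → K} (hf : ∀ i, DF L A (f i)) :
    DF L A fun x => ∑ i ∈ s, f i x := by
  classical
  induction s using Finset.induction_on with
  | empty => simpa using zero
  | insert a s ha ih => simpa only [Finset.sum_insert ha] using (hf a).add ih

theorem prod {ι : Type*} (s : Finset ι) {f : ι → X → K} (hf : ∀ i, DF L A (f i)) :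
    DF L A fun x => ∏ i ∈ s, f i x := by
  classical
  induction s using Finset.induction_on with
  | empty => simpa using one
  | insert a s ha ih => simpa only [Finset.prod_insert ha] using (hf a).mul ih

variable {m : ℕ} {f' g' : X → Fin m → K}

@[fun_prop]
theorem sub_pi (hf : DF L A f') (hg : DF L A g') : DF L A fun x => f' x - g' x :=
  pi fun i => by
    simp only [Pi.sub_apply]
    exact ((apply' i).comp hf).sub ((apply' i).comp hg)

@[fun_prop]
theorem add_pi (hf : DF L A f') (hg : DF L A g') : DF L A fun x => f' x + g' x :=
  pi fun i => by
    simp only [Pi.add_apply]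
    exact ((apply' i).comp hf).add ((apply' i).comp hg)

end DF

namespace DP

variable [GoodSort L K X] {f g : X → K}

theorem mem_O (hf : DF L A f) : DP L A fun x => f x ∈ O K := by
  refine DP.comp (P := fun x : K => x ∈ O K) (DP.of_empty ?_) hf
  unfold DP
  rw [Set.empty_definable_iff]
  refine ⟨FirstOrder.Language.Relations.formula₁ (L := expand L) (Sum.inl (Sum.inr IntegersRel.mem))
    (.var ()), ?_⟩
  ext v
  rfl

/-- The value group is not a sort; the comparison is expressed as divisibility over the valuation
ring. -/
theorem val_le (hf : DF L A f) (hg : DF L A g) : DP L A fun x => val (f x) ≤ val (g x) := by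
  have : DP L A fun x => ∃ c : K, c ∈ O K ∧ f x = c * g x :=
    DP.ex (.and (mem_O (by fun_prop)) (.eq (by fun_prop) (by fun_prop)))
  refine this.congr fun x => ?_
  unfold val
  rw [ValuationSubring.valuation_le_iff]
  constructor
  · rintro ⟨a, ha⟩
    exact ⟨a, a.2, ha.symm⟩
  · rintro ⟨c, hc, h⟩
    exact ⟨⟨c, hc⟩, h.symm⟩

theorem val_lt (hf : DF L A f) (hg : DF L A g) : DP L A fun x => val (f x) < val (g x) :=
  (val_le hg hf).not.congr fun _ => not_le.symm

variable {m m' : ℕ} {f' : X → Fin m → K} {g' : X → Fin m' → K}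

theorem valn_le_val (hf : DF L A f') (hg : DF L A g) :
    DP L A fun x => valn (f' x) ≤ val (g x) :=
  (DP.all_fin fun i => val_le (f := fun x => f' x i) (by fun_prop) hg).congr fun x => by
    simp [valn]

theorem valn_lt_val (hf : DF L A f') (hg : DF L A g) :
    -- The condition `g x ≠ 0` below cannot be dropped: for `m = 0` the coordinatewise inequalities
    -- hold vacuously.
    DP L A fun x => valn (f' x) < val (g x) := by
  have : DP L A fun x => ¬ g x = 0 ∧ ∀ i, val (f' x i) < val (g x) :=
    .and (.not (.eq hg .zero)) (.all_fin fun i => val_lt (f := fun x => f' x i) (by fun_prop) hg)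
  refine this.congr fun x => ⟨fun h => ?_, fun h => ?_⟩
  · have h0 := lt_of_le_of_lt zero_le h
    exact ⟨val_pos.mp h0, (valn_lt_iff h0).mp h⟩
  · exact (valn_lt_iff (val_pos.mpr h.1)).mpr h.2

theorem valn_le (hf : DF L A f') (hg : DF L A g') :
    DP L A fun x => valn (f' x) ≤ valn (g' x) := by
  have : DP L A fun x => ∀ i, f' x i = 0 ∨ ∃ j, val (f' x i) ≤ val (g' x j) :=
    .all_fin fun i => .or (.eq (by fun_prop) .zero) (.ex_fin fun j =>
      val_le (f := fun x => f' x i) (g := fun x => g' x j) (by fun_prop) (by fun_prop))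
  exact this.congr fun x => by rw [valn_le_valn_iff]; simp only [val_eq_zero]

theorem valn_lt (hf : DF L A f') (hg : DF L A g') :
    DP L A fun x => valn (f' x) < valn (g' x) :=
  (valn_le hg hf).not.congr fun _ => not_le.symm

theorem rvn_eq_aux : DP L A fun p : (Fin m → K) × (Fin m → K) => rvn p.1 = rvn p.2 := by
  have : DP L A fun p : (Fin m → K) × (Fin m → K) => valn (p.1 - p.2) < valn p.1 ∨
      ((∀ i, p.1 i = 0) ∧ ∀ i, p.2 i = 0) :=
    .or (valn_lt (by fun_prop) (by fun_prop))
      (.and (.all_fin fun i => .eq (by fun_prop) .zero) (.all_fin fun i => .eq (by fun_prop) .zero))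
  exact this.congr fun p => by rw [rvn_eq_iff, funext_iff, funext_iff]; rfl

end DP

instance (m : ℕ) : GoodSort L K (RVn K m) where
  finite := inferInstanceAs (Finite (Fin m))
  surj := rvn_surjective
  eq_def := Set.Definable.preimage_comp (Sum.map Sigma.fst Sigma.fst)
    (DP.rvn_eq_aux (L := L) (K := K) (m := m))

@[fun_prop]
theorem DF.rv' : DF L A fun x : K => rv x :=
  .of_coord (fun _ => ()) fun _ => rfl

instance (s : AuxSort L K) : GoodSort L K s.Carrier where
  finite := GoodSort.finite (L := L) (K := K) (X := Fin s.k → RV K)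
  surj := Quotient.mk_surjective.comp (GoodSort.surj (L := L) (K := K) (X := Fin s.k → RV K))
  eq_def := Set.Definable.of_iff s.definable fun _ => Quotient.eq

/-- The quotient map onto an auxiliary sort. -/
def AuxSort.quot (s : AuxSort L K) (x : Fin s.k → RV K) : s.Carrier := Quotient.mk s.rel x

theorem AuxSort.quot_surjective (s : AuxSort L K) : Function.Surjective s.quot :=
  Quotient.mk_surjective

@[fun_prop]
theorem DF.auxQuot (s : AuxSort L K) : DF L A fun x : Fin s.k → RV K => s.quot x :=
  .of_coord id fun _ => rfl

end Field

/-! ### Definability by formulas compared with definability over parameters from all sorts -/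

section Comparison

theorem zeroDefinable_iff {S : Set X} : ZeroDefinable L K S ↔ DP L (∅ : Set K) fun x => x ∈ S :=
  Iff.rfl

variable [GoodSort L K X] [GoodSort L K Y]

theorem dp_of_definable {S : Set X} (h : Definable (K := K) L S) :
    DP L (Set.univ : Set K) fun x => x ∈ S := by
  obtain ⟨m, a, r, s, b, W, -, -, hW, rfl⟩ := h
  exact DP.comp (P := fun q => q ∈ W) (DP.of_empty hW) (DF.prodMk (by fun_prop) (DF.const (a, b)))

theorem exists_formula_of_definable {α : Type} {S : Set (α → K)}
    (h : (Set.univ : Set K).Definable (expand L) S) :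
    ∃ (m : ℕ) (a : Fin m → K) (φ : (expand L).Formula (Fin m ⊕ α)),
      ∀ v, v ∈ S ↔ φ.Realize (Sum.elim a v) := by
  rw [Set.definable_iff_finitely_definable] at h
  obtain ⟨A₀, -, h⟩ := h
  rw [Set.definable_iff_exists_formula_sum] at h
  obtain ⟨φ, rfl⟩ := h
  let e := A₀.equivFin
  refine ⟨A₀.card, fun i => e.symm i, φ.relabel (Sum.map e id), fun v => ?_⟩
  rw [FirstOrder.Language.Formula.realize_relabel, Set.mem_ofPred_eq, Sum.elim_comp_map]
  refine iff_of_eq (congrArg φ.Realize ?_)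
  congr 1
  funext i
  simp

theorem zeroDefinable_formula {α : Type} (φ : (expand L).Formula α)
    (r : α → Interpreted.Idx K X ⊕ Interpreted.Idx K Y) :
    (∅ : Set K).Definable (expand L) {v | φ.Realize (v ∘ r)} := by
  rw [Set.empty_definable_iff]
  exact ⟨φ.relabel r, by ext v; simp⟩

/-- The set of points of a sort all of whose representatives satisfy a formula. -/
theorem zeroDefinable_forall_rep {α : Type} (φ : (expand L).Formula α)
    (r : α → Interpreted.Idx K X) :
    DP L (∅ : Set K) fun x : X => ∀ y : Interpreted.Idx K X → K, Interpreted.proj y = x →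
      φ.Realize (y ∘ r) := by
  have hf := GoodSort.finite (L := L) (K := K) (X := X)
  have h1 : (∅ : Set K).Definable (expand L)
      {v : Interpreted.Idx K X ⊕ Interpreted.Idx K X → K |
        (Interpreted.proj (v ∘ Sum.inl) : X) = Interpreted.proj (v ∘ Sum.inr)} :=
    GoodSort.eq_def (L := L) (K := K) (X := X)
  have h2 := zeroDefinable_formula (X := X) (Y := X) φ (Sum.inr ∘ r)
  refine (Set.Definable.forall_of_finite (h1.compl.union h2)).of_iff fun v => ?_
  refine forall_congr' fun y => ?_
  rw [imp_iff_not_or, eq_comm]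
  rfl

/-- A formula speaks about representatives, while `Definable` needs a `∅`-definable family of points
of the sort. Quantifying over all representatives makes the family well defined for every value of
the parameters; for the given ones the formula does not depend on the representative. -/
theorem definable_of_dp {S : Set X} (h : DP L (Set.univ : Set K) fun x => x ∈ S) :
    Definable (K := K) L S := by
  obtain ⟨m, a, φ, hφ⟩ := exists_formula_of_definable h
  let P := X × (Fin m → K) × (∀ j : Fin 0, (Fin.elim0 j : AuxSort L K).Carrier)
  let r : Fin m ⊕ Interpreted.Idx K X → Interpreted.Idx K P :=
    Sum.elim (fun i => Sum.inr (Sum.inl ⟨i, ()⟩)) Sum.inl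
  refine ⟨m, a, 0, Fin.elim0, fun j => j.elim0,
    {x : P | ∀ y : Interpreted.Idx K P → K, Interpreted.proj y = x → φ.Realize (y ∘ r)},
    fun _ => trivial, fun j => j.elim0,
    zeroDefinable_forall_rep (X := P) φ r, ?_⟩
  ext x
  have key : ∀ y : Interpreted.Idx K P → K, Interpreted.proj y = ((x, a, fun j => j.elim0) : P) →
      (φ.Realize (y ∘ r) ↔ x ∈ S) := by
    intro y hy
    have h1 : Interpreted.proj (y ∘ Sum.inl) = x := congrArg Prod.fst hy
    have h2 : ∀ i, y (Sum.inr (Sum.inl ⟨i, ()⟩)) = a i :=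
      fun i => congrFun (congrArg (fun q : P => q.2.1) hy) i
    have h3 : y ∘ r = Sum.elim a (y ∘ Sum.inl) := by
      funext i
      rcases i with i | i
      · exact h2 i
      · rfl
    rw [h3, ← hφ]
    subst h1
    rfl
  constructor
  · exact fun hx y hy => (key y hy).mpr hx
  · intro hx
    obtain ⟨y, hy⟩ := GoodSort.surj (L := L) (K := K) ((x, a, fun j => j.elim0) : P)
    exact (key y hy).mp (hx y hy)

theorem definable_iff_dp {S : Set X} :
    Definable (K := K) L S ↔ DP L (Set.univ : Set K) fun x => x ∈ S :=
  ⟨dp_of_definable, definable_of_dp⟩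

end Comparison

end Toolkit

/-! ### Transfer of valuations, leading terms and definable families to ultrapowers -/

section UPowTransfer

variable {I : Type u} {U : Ultrafilter I} {K : Type u} [HenselianVF K]

namespace UPow

theorem val_le_iff {x y : I → K} : val (mk U x) ≤ val (mk U y) ↔ ∀ᶠ i in U, val (x i) ≤ val (y i) := by
  have key : ∀ {F : Type u} [HenselianVF F] (a b : F),
      val a ≤ val b ↔ (b = 0 ∧ a = 0) ∨ (b ≠ 0 ∧ a * b⁻¹ ∈ O F) := by
    intro F _ a b
    by_cases hb : b = 0
    · simp [hb, val_eq_zero]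
    · have hi : val b⁻¹ = (val b)⁻¹ := map_inv₀ _ _
      have : val b ≠ 0 := fun h => hb (val_eq_zero.mp h)
      rw [← val_le_one_iff, val_mul, hi, ← div_eq_mul_inv, div_le_one₀ (zero_lt_iff.mpr this)]
      simp [hb]
  simp only [key, ← mk_zero, ← mk_inv, ← mk_mul, mem_O, ne_eq, mk_eq, Ultrafilter.eventually_or,
    ← Ultrafilter.eventually_not, Filter.eventually_and]
  rfl

theorem val_lt_iff {x y : I → K} : val (mk U x) < val (mk U y) ↔ ∀ᶠ i in U, val (x i) < val (y i) := by
  simp only [← not_le, val_le_iff, Ultrafilter.eventually_not]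

theorem rv_eq_iff {x y : I → K} : rv (mk U x) = rv (mk U y) ↔ ∀ᶠ i in U, rv (x i) = rv (y i) := by
  simp only [TStrat.rv_eq_iff, ← mk_sub, val_lt_iff, ← mk_zero, mk_eq, Ultrafilter.eventually_or,
    Filter.eventually_and]
  rfl

theorem rvPow_eq_iff {k : ℕ} {x y : (Σ _ : Fin k, Fin 1) → I → K} :
    Interpreted.proj (K := UPow U K) (X := Fin k → RV (UPow U K)) (fun j => mk U (x j)) =
        Interpreted.proj (fun j => mk U (y j)) ↔
      ∀ᶠ i in U, Interpreted.proj (K := K) (X := Fin k → RV K) (fun j => x j i) =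
        Interpreted.proj fun j => y j i := by
  have h (F : Type u) [HenselianVF F] (z : (Σ _ : Fin k, Fin 1) → F) (i : Fin k) :
      Interpreted.proj (K := F) (X := Fin k → RV F) z i = rv (z ⟨i, 0⟩) := by
    refine congrArg rvn (funext fun j : Fin 1 => ?_)
    obtain rfl := Subsingleton.elim j 0
    rfl
  simp only [funext_iff, h, rv_eq_iff, Filter.eventually_all]

variable {L : FirstOrder.Language.{u, u}} [L.Structure K]

theorem definable_fiber {M : Type u} [(expand L).Structure M] {α β : Type*} {S : Set (α ⊕ β → M)}
    (hS : (Set.univ : Set M).Definable (expand L) S) (c : α → M) :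
    (Set.univ : Set M).Definable (expand L) {v | Sum.elim c v ∈ S} := by
  rw [Set.definable_iff_exists_formula_sum] at hS ⊢
  obtain ⟨φ, rfl⟩ := hS
  refine ⟨φ.relabel (Sum.elim Sum.inl (Sum.elim (fun a => Sum.inl ⟨c a, trivial⟩) Sum.inr)), ?_⟩
  ext v
  simp only [Set.mem_ofPred_eq, FirstOrder.Language.Formula.realize_relabel]
  refine iff_of_eq (congrArg φ.Realize (funext fun j => ?_))
  rcases j with j | j | j <;> rfl

/-- Łoś's theorem for a family of fibers of a definable set. -/
theorem exists_star_fiber {Y Z : Type u} [Interpreted K Y] [Interpreted K Z] [GoodSort L K Y]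
    {P : Y → Z → Prop} (hP : DP L (Set.univ : Set K) fun p : Y × Z => P p.1 p.2) (y : I → Y) :
    ∃ S : Set (Interpreted.Idx K Z → UPow U K),
      (Set.univ : Set (UPow U K)).Definable (expand L) S ∧
      ∀ z : Interpreted.Idx K Z → I → K, (fun j => mk U (z j)) ∈ S ↔
        ∀ᶠ i in U, P (y i) (Interpreted.proj fun j => z j i) := by
  choose c hc using fun i => GoodSort.surj (L := L) (K := K) (y i)
  obtain ⟨S, hS, h⟩ := exists_star (U := U) hP
  refine ⟨_, definable_fiber hS fun j => mk U fun i => c i j, fun z => ?_⟩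
  have := h (Sum.elim (fun j i => c i j) z)
  have e : (fun j => mk U (Sum.elim (fun j i => c i j) z j)) =
      Sum.elim (fun j => mk U fun i => c i j) fun j => mk U (z j) := by
    funext j; cases j <;> rfl
  refine (iff_of_eq (congrArg (· ∈ S) e.symm)).trans (this.trans
    (Filter.eventually_congr (Filter.Eventually.of_forall fun i => ?_)))
  rw [← hc i]
  rfl

end UPow

/-- A nonprincipal ultrafilter on the natural numbers. -/
noncomputable def natUltra : Ultrafilter (ULift.{u} ℕ) :=
  (Filter.hyperfilter ℕ).map ULift.up

theorem eventually_natUltra_gt (j : ℕ) : ∀ᶠ i : ULift.{u} ℕ in natUltra, j < i.down := by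
  change ∀ᶠ n in (Filter.hyperfilter ℕ : Filter ℕ), j < n
  have : Set.Finite {n | ¬ j < n} := (Set.finite_Iic j).subset fun n hn => not_lt.mp hn
  exact Filter.mem_hyperfilter_of_finite_compl this

/-- Sets of unbounded finite size give an infinite subset of the ultrapower. -/
theorem exists_injective_of_unbounded {A : ULift.{u} ℕ → Set K}
    (hA : ∀ i, (i.down : ℕ∞) ≤ (A i).encard) :
    ∃ s : ℕ → ULift.{u} ℕ → K, (∀ j, ∀ᶠ i in natUltra, s j i ∈ A i) ∧
      Function.Injective fun j => UPow.mk natUltra (s j) := by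
  -- At index `i` only the first `i` terms are meaningful. Each fixed term, and each pair of terms,
  -- is meaningful at almost every index.
  have h1 : ∀ i, ∃ t : ℕ → K, (∀ j < i.down, t j ∈ A i) ∧ Set.InjOn t {j | j < i.down} := by
    intro i
    obtain ⟨B, hB, hBc⟩ := Set.exists_subset_encard_eq (hA i)
    have hfin : B.Finite := Set.finite_of_encard_eq_coe hBc
    have hcard : hfin.toFinset.card = i.down := by
      rw [hfin.encard_eq_coe_toFinset_card] at hBc
      exact_mod_cast hBc
    let e := hfin.toFinset.equivFinOfCardEq hcard
    refine ⟨fun j => if h : j < i.down then e.symm ⟨j, h⟩ else 0, fun j hj => ?_, ?_⟩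
    · simp only [hj, dif_pos]
      exact hB (hfin.mem_toFinset.mp (e.symm ⟨j, hj⟩).2)
    · intro j hj j' hj' h
      simp only [Set.mem_ofPred_eq] at hj hj'
      simp only [hj, hj', dif_pos] at h
      have := e.symm.injective (Subtype.ext h)
      simpa using this
  choose t ht1 ht2 using h1
  refine ⟨fun j i => t i j, fun j => ?_, fun j j' h => ?_⟩
  · filter_upwards [eventually_natUltra_gt j] with i hi
    exact ht1 i j hi
  · obtain ⟨i, h1, h2, h3⟩ := ((UPow.mk_eq.mp h).and
      ((eventually_natUltra_gt j).and (eventually_natUltra_gt j'))).exists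
    exact ht2 i h2 h3 h1

end UPowTransfer

/-! ### Finite unions of uniformly finite definable families -/

section FiniteImage

variable {L : FirstOrder.Language.{u, u}}

section Model

variable {K : Type u} [HenselianVF K] [L.Structure K] {X Y : Type u} [Interpreted K X]
  [Interpreted K Y]

theorem definableMap_iff [GoodSort L K X] [GoodSort L K Y] {D : Set X} {f : D → Y} :
    DefinableMap (K := K) L f ↔
      DP L (Set.univ : Set K) fun p : X × Y => ∃ h : p.1 ∈ D, f ⟨p.1, h⟩ = p.2 :=
  definable_iff_dp

theorem definableMap_univ_iff [GoodSort L K X] [GoodSort L K Y] {f : X → Y} :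
    DefinableMap (K := K) L (fun x : (Set.univ : Set X) => f x) ↔ DF L (Set.univ : Set K) f := by
  rw [definableMap_iff]
  simp only [Set.mem_univ, exists_true_left]
  rfl

variable (L K X) in
/-- All definable maps to the field have finite image. -/
def FinImage : Prop := ∀ f : X → K, DF L (Set.univ : Set K) f → (Set.range f).Finite

theorem FinImage.of_surjective [GoodSort L K X] [GoodSort L K Y] (hX : FinImage L K X) {g : X → Y}
    (hg : DF L (Set.univ : Set K) g) (hs : Function.Surjective g) : FinImage L K Y := fun f hf => by
  have := hX _ (hf.comp hg)
  rwa [← Function.comp_def, hs.range_comp] at this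

/-- `t` enumerates the set `D` without repetition. -/
def Enumerates {M : ℕ} (D : K → Prop) (t : Fin M → K) : Prop :=
  Function.Injective t ∧ ∀ s, D s ↔ ∃ i, t i = s

theorem dp_enumerates [GoodSort L K X] [GoodSort L K Y] {M : ℕ} {D : X → K → Prop}
    (hD : DP L (Set.univ : Set K) fun p : X × K => D p.1 p.2) {f : Y → X}
    (hf : DF L (Set.univ : Set K) f)
    {t : Y → Fin M → K} (ht : DF L (Set.univ : Set K) t) :
    DP L (Set.univ : Set K) fun y => Enumerates (D (f y)) (t y) := by
  refine .and ?_ (.all (.iff (hD.comp (g := fun p : Y × K => (f p.1, p.2)) (by fun_prop))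
    (.ex_fin fun i => .eq (by fun_prop) (by fun_prop))))
  refine DP.congr (P := fun y => ∀ i j, t y i = t y j → i = j)
    (.all_fin fun i => .all_fin fun j => .imp (.eq (by fun_prop) (by fun_prop)) (.const _))
    fun y => Iff.rfl

theorem Enumerates.prod_eq {M : ℕ} {D : K → Prop} {t t' : Fin M → K} (h : Enumerates D t)
    (h' : Enumerates D t') (g : K → K) : ∏ i, g (t i) = ∏ i, g (t' i) := by
  classical
  have e : ∀ {t : Fin M → K}, Enumerates D t → ∏ i, g (t i) = ∏ s ∈ Finset.univ.image t, g s :=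
    fun h => (Finset.prod_image fun i _ j _ hij => h.1 hij).symm
  rw [e h, e h']
  congr 1
  ext s
  simp only [Finset.mem_image, Finset.mem_univ, true_and]
  rw [← h.2, ← h'.2]

theorem Enumerates.sum_eq {M : ℕ} {D : K → Prop} {t t' : Fin M → K} (h : Enumerates D t)
    (h' : Enumerates D t') : ∑ i, t i = ∑ i, t' i := by
  classical
  have e : ∀ {t : Fin M → K}, Enumerates D t → ∑ i, t i = ∑ s ∈ Finset.univ.image t, s :=
    fun h => (Finset.sum_image (f := id) fun i _ j _ hij => h.1 hij).symm
  rw [e h, e h']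
  congr 1
  ext s
  simp only [Finset.mem_image, Finset.mem_univ, true_and]
  rw [← h.2, ← h'.2]

theorem exists_enumerates {D : K → Prop} {N : ℕ} (h : {t | D t}.encard ≤ N) :
    ∃ M ≤ N, ∃ t : Fin M → K, Enumerates D t := by
  have hfin : {t | D t}.Finite := Set.finite_of_encard_le_coe h
  rw [hfin.encard_eq_coe_toFinset_card] at h
  refine ⟨_, by exact_mod_cast h, fun i => hfin.toFinset.equivFin.symm i,
    fun i j hij => hfin.toFinset.equivFin.symm.injective (Subtype.ext hij), fun s => ?_⟩
  constructor
  · intro hs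
    exact ⟨hfin.toFinset.equivFin ⟨s, hfin.mem_toFinset.mpr hs⟩, by simp⟩
  · rintro ⟨i, rfl⟩
    exact hfin.mem_toFinset.mp (hfin.toFinset.equivFin.symm i).2

/-- Extensionality of finite sets of size `M` through the values of their polynomials. -/
theorem Enumerates.ext_of_prod {M : ℕ} {D D' : K → Prop} {t t' : Fin M → K} (h : Enumerates D t)
    (h' : Enumerates D' t')
    (hp : ∀ a : Fin (M + 1), ∏ i, (((a : ℕ) : K) - t i) = ∏ i, (((a : ℕ) : K) - t' i)) : D = D' := by
  classical
  -- A polynomial of degree `M` is determined by its values at the `M + 1` points `0, …, M`, which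
  -- are distinct in characteristic zero; the enumerated set is its set of roots.
  let p : (Fin M → K) → Polynomial K := fun t => ∏ i, (Polynomial.X - Polynomial.C (t i))
  have hev : ∀ t a, (p t).eval a = ∏ i, (a - t i) := fun t a => by simp [p, Polynomial.eval_prod]
  have hdeg : ∀ t, (p t).degree < ((Finset.univ : Finset (Fin (M + 1))).image
      fun a : Fin (M + 1) => ((a : ℕ) : K)).card := by
    intro t
    rw [Finset.card_image_of_injective]
    · simp only [p, Polynomial.degree_prod, Polynomial.degree_X_sub_C, Finset.sum_const,
        Finset.card_univ, Fintype.card_fin, nsmul_eq_mul, mul_one]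
      exact_mod_cast Nat.lt_succ_self M
    · intro a b hab
      exact Fin.ext (Nat.cast_injective hab)
  have hpp : p t = p t' := by
    refine Polynomial.eq_of_degrees_lt_of_eval_finset_eq _ (hdeg t) (hdeg t') fun a ha => ?_
    obtain ⟨a, -, rfl⟩ := Finset.mem_image.mp ha
    rw [hev, hev, hp]
  have hroot : ∀ {D : K → Prop} {t : Fin M → K}, Enumerates D t → ∀ s, D s ↔ (p t).eval s = 0 := by
    intro D t h s
    rw [h.2, hev, Finset.prod_eq_zero_iff]
    simp only [Finset.mem_univ, true_and, sub_eq_zero, eq_comm]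
  funext s
  rw [eq_iff_iff, hroot h, hroot h', hpp]

open Classical in
/-- The function sending `x` to `F t` for any enumeration `t` of `D x`. -/
noncomputable def enumFun (M : ℕ) (D : X → K → Prop) (F : (Fin M → K) → K) (x : X) : K :=
  if h : ∃ t : Fin M → K, Enumerates (D x) t then F h.choose else 0

theorem enumFun_eq {M : ℕ} {D : X → K → Prop} {F : (Fin M → K) → K}
    (hF : ∀ (D : K → Prop) t t', Enumerates D t → Enumerates D t' → F t = F t') {x : X}
    {t : Fin M → K} (ht : Enumerates (D x) t) : enumFun M D F x = F t := by
  have h : ∃ t : Fin M → K, Enumerates (D x) t := ⟨t, ht⟩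
  rw [enumFun, dif_pos h]
  exact hF _ _ _ h.choose_spec ht

theorem df_enumFun [GoodSort L K X] {M : ℕ} {D : X → K → Prop}
    (hD : DP L (Set.univ : Set K) fun p : X × K => D p.1 p.2) {F : (Fin M → K) → K}
    (hF : ∀ (D : K → Prop) t t', Enumerates D t → Enumerates D t' → F t = F t')
    (hFd : DF L (Set.univ : Set K) F) : DF L (Set.univ : Set K) (enumFun M D F) := by
  have : DP L (Set.univ : Set K) fun p : X × K =>
      (∃ t : Fin M → K, Enumerates (D p.1) t ∧ F t = p.2) ∨
        ((¬ ∃ t : Fin M → K, Enumerates (D p.1) t) ∧ p.2 = 0) :=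
    .or (.ex (.and (dp_enumerates hD (by fun_prop) (by fun_prop)) (.eq (by fun_prop) (by fun_prop))))
      (.and (.not (.ex (dp_enumerates hD (by fun_prop) (by fun_prop)))) (.eq (by fun_prop) .zero))
  refine this.congr fun p => ?_
  by_cases h : ∃ t : Fin M → K, Enumerates (D p.1) t
  · obtain ⟨t, ht⟩ := h
    rw [enumFun_eq hF ht]
    constructor
    · exact fun h => Or.inl ⟨t, ht, h⟩
    · rintro (⟨t', ht', h⟩ | ⟨h, -⟩)
      · rw [← h]; exact hF _ _ _ ht ht'
      · exact absurd ⟨t, ht⟩ h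
  · rw [enumFun, dif_neg h]
    constructor
    · exact fun h' => Or.inr ⟨h, h'.symm⟩
    · rintro (⟨t', ht', -⟩ | ⟨-, h⟩)
      · exact absurd ⟨t', ht'⟩ h
      · exact h.symm

/-- A uniformly finite family indexed by a sort with the finite image property has finite union. -/
theorem FinImage.finite_union [GoodSort L K X] (hX : FinImage L K X) {D : X → K → Prop}
    (hD : DP L (Set.univ : Set K) fun p : X × K => D p.1 p.2) {N : ℕ}
    (hN : ∀ x, {t | D x t}.encard ≤ N) : {t | ∃ x, D x t}.Finite := by
  -- For fibers of fixed size `M`, the values at `0, …, M` of the polynomial with root set `D x` are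
  -- definable functions of `x` into `K`. They take finitely many values and determine the fiber, so
  -- only finitely many fibers occur.
  have key : ∀ M : ℕ, {t | ∃ x, D x t ∧ ∃ s : Fin M → K, Enumerates (D x) s}.Finite := by
    intro M
    let F : Fin (M + 1) → (Fin M → K) → K := fun a t => ∏ i, (((a : ℕ) : K) - t i)
    have hF : ∀ a (D : K → Prop) t t', Enumerates D t → Enumerates D t' → F a t = F a t' :=
      fun a D t t' h h' => h.prod_eq h' _
    have hFd : ∀ a, DF L (Set.univ : Set K) (F a) := fun a =>
      DF.prod _ fun i => (DF.const _).sub (by fun_prop)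
    let G : X → Fin (M + 1) → K := fun x a => enumFun M D (F a) x
    have hG : (Set.range G).Finite := by
      refine (Set.Finite.pi fun a => hX _ (df_enumFun hD (hF a) (hFd a))).subset ?_
      rintro _ ⟨x, rfl⟩ a -
      exact ⟨x, rfl⟩
    let S : Set X := {x | ∃ s : Fin M → K, Enumerates (D x) s}
    have hext : ∀ x ∈ S, ∀ y ∈ S, G x = G y → D x = D y := by
      rintro x ⟨s, hs⟩ y ⟨s', hs'⟩ h
      refine hs.ext_of_prod hs' fun a => ?_
      have := congrFun h a
      simp only [G] at this
      rwa [enumFun_eq (hF a) hs, enumFun_eq (hF a) hs'] at this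
    have hSfin : (D '' S).Finite := by
      refine Set.Finite.of_finite_image (f := fun E => G '' {x | x ∈ S ∧ D x = E}) ?_ ?_
      · exact (hG.finite_subsets).subset (by rintro _ ⟨_, -, rfl⟩; exact Set.image_subset_range _ _)
      · rintro _ ⟨x, hx, rfl⟩ _ ⟨y, hy, rfl⟩ h
        have : G x ∈ G '' {z | z ∈ S ∧ D z = D y} := by
          simp only at h
          rw [← h]
          exact ⟨x, ⟨hx, rfl⟩, rfl⟩
        obtain ⟨z, ⟨hz, hzy⟩, hzx⟩ := this
        rw [← hzy]
        exact hext x hx z hz hzx.symm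
    refine (hSfin.biUnion (t := fun E => {t | E t}) ?_).subset ?_
    · rintro _ ⟨x, ⟨s, hs⟩, rfl⟩
      refine (Set.finite_range s).subset fun t ht => ?_
      exact (hs.2 t).mp ht
    · rintro t ⟨x, hx, hs⟩
      exact Set.mem_biUnion ⟨x, hs, rfl⟩ hx
  refine ((Set.finite_Iic N).biUnion fun M _ => key M).subset ?_
  rintro t ⟨x, hx⟩
  obtain ⟨M, hM, s, hs⟩ := exists_enumerates (hN x)
  exact Set.mem_biUnion (x := M) hM ⟨x, hx, s, hs⟩

end Model

end FiniteImage

/-- The ultrapower along the natural numbers. -/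
abbrev NatPow (K : Type u) : Type u := UPow natUltra.{u} K

/-! ### Definable maps from powers of `RV` to the field -/

section FiniteImageRV

variable {L : FirstOrder.Language.{u, u}}

section Model

variable {K : Type u} [HenselianVF K] [L.Structure K] {X Y : Type u} [Interpreted K X]
  [Interpreted K Y] {A : Set K}

@[fun_prop]
theorem DF.cons [GoodSort L K X] [GoodSort L K Y] {k : ℕ} {f : X → Y} {g : X → Fin k → Y}
    (hf : DF L A f) (hg : DF L A g) :
    DF L A fun x => (Fin.cons (f x) (g x) : Fin (k + 1) → Y) :=
  .pi fun i => by
    refine Fin.cases ?_ (fun j => ?_) i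
    · simpa using hf
    · simp only [Fin.cons_succ]
      fun_prop

open Classical in
-- A partial definable function is made total with the default value `0`, since the finite image
-- property concerns total maps.
theorem exists_df_of_functional [GoodSort L K X] {R : X → K → Prop}
    (hR : DP L A fun p : X × K => R p.1 p.2) (hf : ∀ x t t', R x t → R x t' → t = t') :
    ∃ g : X → K, DF L A g ∧ ∀ x t, R x t → g x = t := by
  let g : X → K := fun x => if h : ∃ t, R x t then h.choose else 0
  have hg : ∀ x t, R x t → g x = t := fun x t h => by
    have h' : ∃ t, R x t := ⟨t, h⟩
    simp only [g, dif_pos h']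
    exact hf x _ _ h'.choose_spec h
  refine ⟨g, ?_, hg⟩
  have : DP L A fun p : X × K => R p.1 p.2 ∨ ((¬ ∃ t, R p.1 t) ∧ p.2 = 0) :=
    .or hR (.and (.not (.ex (hR.comp (g := fun q : (X × K) × K => (q.1.1, q.2)) (by fun_prop))))
      (.eq (by fun_prop) .zero))
  refine this.congr fun p => ?_
  by_cases h : ∃ t, R p.1 t
  · obtain ⟨t, ht⟩ := h
    rw [hg _ _ ht]
    constructor
    · rintro rfl; exact Or.inl ht
    · rintro (h | ⟨h, -⟩)
      · exact hf _ _ _ ht h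
      · exact absurd ⟨t, ht⟩ h
  · simp only [g, dif_neg h]
    constructor
    · exact fun h' => Or.inr ⟨h, h'.symm⟩
    · rintro (h' | ⟨-, h'⟩)
      · exact absurd ⟨_, h'⟩ h
      · exact h'.symm

/-- Choose `ξ N` such that `f (ξ N, ·)` has more than `N` values. The ultraproduct of these maps is
a definable map on the `k`-th power of `RV` of the ultrapower, and it has infinitely many values. -/
theorem finImage_upow_not {k : ℕ} {f : (Fin (k + 1) → RV K) → K}
    (hf : DF L (Set.univ : Set K) f)
    (hunb : ∀ N : ℕ, ∃ ξ, (N : ℕ∞) < {t | ∃ η, f (Fin.cons ξ η) = t}.encard) :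
    ¬ FinImage L (NatPow K) (Fin k → RV (NatPow K)) := by
  intro hfin
  choose ξ hξ using hunb
  obtain ⟨s, hs, hinj⟩ := exists_injective_of_unbounded
    (A := fun i => {t | ∃ η, f (Fin.cons (ξ i.down) η) = t}) fun i => (hξ i.down).le
  have hP : DP L (Set.univ : Set K) fun p : RV K × ((Fin k → RV K) × K) =>
      f (Fin.cons p.1 p.2.1) = p.2.2 := .eq (by fun_prop) (by fun_prop)
  obtain ⟨S, hS, hSz⟩ := UPow.exists_star_fiber (U := natUltra)
    (P := fun ξ (q : (Fin k → RV K) × K) => f (Fin.cons ξ q.1) = q.2) hP fun i => ξ i.down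
  let Z' := (Fin k → RV (NatPow K)) × (NatPow K)
  have hrep : ∀ y : Interpreted.Idx (NatPow K) Z' → (NatPow K), ∃ z : Interpreted.Idx (NatPow K) Z' → ULift.{u} ℕ → K,
      y = fun j => UPow.mk natUltra (z j) := fun y => by
    choose z hz using fun j => UPow.mk_surjective natUltra (y j)
    exact ⟨z, funext fun j => (hz j).symm⟩
  -- `S` is a set of representatives. This fact and `hinv` say that it is the preimage of the graph
  -- of a partial function.
  have hfun : ∀ y y' : Interpreted.Idx (NatPow K) Z' → (NatPow K), y ∈ S → y' ∈ S →
      (Interpreted.proj y : Z').1 = (Interpreted.proj y' : Z').1 →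
      (Interpreted.proj y : Z').2 = (Interpreted.proj y' : Z').2 := by
    intro y y' hy hy' h1
    obtain ⟨z, rfl⟩ := hrep y
    obtain ⟨z', rfl⟩ := hrep y'
    refine UPow.mk_eq.mpr ?_
    filter_upwards [(hSz z).mp hy, (hSz z').mp hy', UPow.rvPow_eq_iff.mp h1] with i h2 h3 h4
    refine h2.symm.trans (Eq.trans ?_ h3)
    exact congrArg (fun η => f (Fin.cons (ξ i.down) η)) h4
  have hinv : ∀ y y' : Interpreted.Idx (NatPow K) Z' → (NatPow K), y ∈ S →
      (Interpreted.proj y : Z') = Interpreted.proj y' → y' ∈ S := by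
    intro y y' hy h
    obtain ⟨z, rfl⟩ := hrep y
    obtain ⟨z', rfl⟩ := hrep y'
    refine (hSz z').mpr ?_
    filter_upwards [(hSz z).mp hy, UPow.rvPow_eq_iff.mp (congrArg Prod.fst h),
      UPow.mk_eq.mp (congrArg Prod.snd h)] with i h2 h3 h4
    refine Eq.trans ?_ (h2.trans h4)
    exact congrArg (fun η => f (Fin.cons (ξ i.down) η)) h3.symm
  let R : (Fin k → RV (NatPow K)) → (NatPow K) → Prop := fun η t =>
    ∃ y : Interpreted.Idx (NatPow K) Z' → (NatPow K), y ∈ S ∧ (Interpreted.proj y : Z') = (η, t)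
  have hR : DP L (Set.univ : Set (NatPow K)) fun p : Z' => R p.1 p.2 := by
    refine Set.Definable.of_iff hS fun y => ⟨?_, fun hy => ⟨y, hy, rfl⟩⟩
    rintro ⟨y', hy', h⟩
    exact hinv y' y hy' h
  obtain ⟨g, hg, hgR⟩ := exists_df_of_functional hR (by
    rintro η t t' ⟨y, hy, h⟩ ⟨y', hy', h'⟩
    have := hfun y y' hy hy' (by rw [h, h'])
    rwa [h, h'] at this)
  refine Set.infinite_of_injective_forall_mem hinj (fun j => ?_) (hfin g hg)
  have : ∀ᶠ i in (natUltra : Ultrafilter (ULift.{u} ℕ)), ∃ e : (Σ _ : Fin k, Fin 1) → K,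
      f (Fin.cons (ξ i.down) (Interpreted.proj (K := K) (X := Fin k → RV K) e)) = s j i := by
    filter_upwards [hs j] with i ⟨η, hη⟩
    obtain ⟨e, rfl⟩ := GoodSort.surj (L := L) (K := K) η
    exact ⟨e, hη⟩
  let e : ULift.{u} ℕ → (Σ _ : Fin k, Fin 1) → K := fun i => Classical.epsilon fun e =>
    f (Fin.cons (ξ i.down) (Interpreted.proj (K := K) (X := Fin k → RV K) e)) = s j i
  have he : ∀ᶠ i in (natUltra : Ultrafilter (ULift.{u} ℕ)),
      f (Fin.cons (ξ i.down) (Interpreted.proj (K := K) (X := Fin k → RV K) (e i))) = s j i := by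
    filter_upwards [this] with i hi
    exact Classical.epsilon_spec hi
  let z : (Σ _ : Fin k, Fin 1) ⊕ Unit → ULift.{u} ℕ → K :=
    Sum.elim (fun l i => e i l) fun _ => s j
  exact ⟨_, hgR _ _ ⟨fun l => UPow.mk natUltra (z l), (hSz z).mpr he, rfl⟩⟩

end Model

variable {T : (expand L).Theory}

theorem finImage_rv (hT : GeneralHypothesis T 0) (K : Type u) [HenselianVF K] [L.Structure K] (hK : K ⊨ T) :
    FinImage L K (RV K) := fun f hf =>
  hT.finiteImages K hK f (definableMap_univ_iff.mpr hf)

/-- The induction runs over all models at once. If the sets of values over the first coordinate are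
uniformly finite, their union over `RV` is finite; otherwise the induction hypothesis fails in an
ultrapower. -/
theorem finImage_rvPow (hT : GeneralHypothesis T 0) (k : ℕ) : ∀ (K : Type u) [HenselianVF K] [L.Structure K], K ⊨ T →
    FinImage L K (Fin k → RV K) := by
  induction k with
  | zero => exact fun K _ _ _ f _ => Set.finite_range f
  | succ k ih =>
    intro K _ _ hK f hf
    by_cases hb : ∃ N : ℕ, ∀ ξ, {t | ∃ η, f (Fin.cons ξ η) = t}.encard ≤ N
    · obtain ⟨N, hN⟩ := hb
      have hD : DP L (Set.univ : Set K) fun p : RV K × K => ∃ η, f (Fin.cons p.1 η) = p.2 :=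
        .ex (.eq (by fun_prop) (by fun_prop))
      refine ((finImage_rv hT K hK).finite_union hD hN).subset ?_
      rintro _ ⟨x, rfl⟩
      exact ⟨x 0, Fin.tail x, by rw [Fin.cons_self_tail]⟩
    · push Not at hb
      exact absurd (ih (NatPow K) (UPow.models hK)) (finImage_upow_not hf hb)

end FiniteImageRV

/-! ### Infinite definable subsets of the field and uniform finiteness -/

section BMinimal

variable {L : FirstOrder.Language.{u, u}} {T : (expand L).Theory}

section Basic

variable {K : Type u} [HenselianVF K]

/-- The set defined by `P` contains a ball of `K`. -/
def HasBall (P : K → Prop) : Prop := ∃ a r : K, r ≠ 0 ∧ ∀ x, val (x - a) < val r → P x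

/-- The set defined by `P` contains a ball of `K ^ m`. -/
def Big {m : ℕ} (P : (Fin m → K) → Prop) : Prop :=
  ∃ (a : Fin m → K) (r : K), r ≠ 0 ∧ ∀ x, valn (x - a) < val r → P x

/-- The set defined by `P` contains a ball of `K ^ m × K`. -/
def BigPair {m : ℕ} (P : (Fin m → K) → K → Prop) : Prop :=
  ∃ (a : Fin m → K) (b r : K), r ≠ 0 ∧
    ∀ x t, valn (x - a) < val r → val (t - b) < val r → P x t

theorem exists_val_le_both {r s : K} (hr : r ≠ 0) (hs : s ≠ 0) :
    ∃ q : K, q ≠ 0 ∧ val q ≤ val r ∧ val q ≤ val s := by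
  rcases le_total (val r) (val s) with h | h
  · exact ⟨r, hr, le_rfl, h⟩
  · exact ⟨s, hs, h, le_rfl⟩

theorem val_sub_lt_trans {x y z : K} {γ : Val K} (h : val (x - y) < γ) (h' : val (y - z) < γ) :
    val (x - z) < γ := by
  have := val_add_le (x - y) (y - z)
  rw [sub_add_sub_cancel] at this
  exact this.trans_lt (max_lt h h')

variable [L.Structure K]

/-- For a trivial valuation the open unit ball is `{0}`, the image of a one-point auxiliary sort,
which b-minimality forbids. -/
theorem exists_val_lt_one (hT : GeneralHypothesis T 0) (hK : K ⊨ T) :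
    ∃ ε : K, ε ≠ 0 ∧ val ε < 1 := by
  by_contra hcon
  push Not at hcon
  let s : AuxSort L K := ⟨0, ⊤, (DP.const True : DP L (∅ : Set K) _)⟩
  refine (hT.bMinimal K hK).no_surjection s Set.univ (fun _ => 0) ?_ (Or.inl (Or.inr ⟨0, 1, one_ne_zero, ?_⟩))
  · exact definableMap_univ_iff (f := fun _ => (0 : K)).mpr (DF.const 0)
  · have hne : Nonempty (Set.univ : Set s.Carrier) := ⟨⟨s.quot fun i => i.elim0, trivial⟩⟩
    ext x
    simp only [Set.range_const, Set.mem_singleton_iff, Set.mem_ofPred_eq, sub_zero,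
      valn_lt_iff zero_lt_one]
    constructor
    · intro h i
      rw [Subsingleton.elim i 0, h, val_zero]
      exact zero_lt_one
    · intro h
      by_contra h0
      exact absurd (h 0) (not_lt.mpr (hcon _ h0))

theorem infinite_ball (hT : GeneralHypothesis T 0) (hK : K ⊨ T) (a : K) {r : K} (hr : r ≠ 0) :
    {x | val (x - a) < val r}.Infinite := by
  obtain ⟨ε, hε0, hε⟩ := exists_val_lt_one hT hK
  refine Set.infinite_of_injective_forall_mem (f := fun m : ℕ => a + r * ε * m) ?_ fun m => ?_
  · intro m m' h
    have h1 : r * ε * (m : K) = r * ε * m' := add_left_cancel h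
    exact Nat.cast_injective (mul_left_cancel₀ (mul_ne_zero hr hε0) h1)
  · simp only [Set.mem_ofPred_eq, add_sub_cancel_left, val_mul]
    have hm : val (m : K) ≤ 1 := by
      rcases eq_or_ne m 0 with rfl | hm
      · simp
      · exact (val_natCast hm).le
    calc val r * val ε * val (m : K) ≤ val r * val ε * 1 := mul_le_mul_right hm _
      _ < val r := by
        rw [mul_one]
        exact mul_lt_of_lt_one_right (val_pos.mpr hr) hε

theorem HasBall.infinite (hT : GeneralHypothesis T 0) (hK : K ⊨ T) {P : K → Prop}
    (h : HasBall P) : {t | P t}.Infinite := by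
  obtain ⟨a, r, hr, h⟩ := h
  exact (infinite_ball hT hK a hr).mono h

theorem finImage_aux (hT : GeneralHypothesis T 0) (hK : K ⊨ T) (s : AuxSort L K) :
    FinImage L K s.Carrier :=
  (finImage_rvPow hT s.k K hK).of_surjective (DF.auxQuot s) s.quot_surjective

theorem finite_range_of_definableMap (hT : GeneralHypothesis T 0) (hK : K ⊨ T) {s : AuxSort L K}
    {Q : Set s.Carrier} {c : Q → K} (hc : DefinableMap (K := K) L c) : (Set.range c).Finite := by
  obtain ⟨g, hg, hgc⟩ := exists_df_of_functional
    (R := fun x t => ∃ h : x ∈ Q, c ⟨x, h⟩ = t) (definableMap_iff.mp hc) (by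
    rintro x t t' ⟨h, rfl⟩ ⟨h', rfl⟩; rfl)
  refine (finImage_aux hT hK s g hg).subset ?_
  rintro _ ⟨q, rfl⟩
  exact ⟨q, hgc _ _ ⟨q.2, rfl⟩⟩

/-- In a decomposition with centers, a cell with nonzero `ξ q` is an open ball. If all `ξ q` vanish,
the set is the range of the centers, hence finite. -/
theorem hasBall_of_infinite (hT : GeneralHypothesis T 0) (hK : K ⊨ T) {P : K → Prop}
    (hP : DP L (Set.univ : Set K) P) (hinf : {t | P t}.Infinite) : HasBall P := by
  obtain ⟨s, Q, c, ξ, -, hc, -, -, hU⟩ := (hT.bMinimal K hK).centers Set.univ {t | P t}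
    (definable_iff_dp.mpr hP)
  by_cases h : ∃ q, ξ q ≠ rv 0
  · obtain ⟨q, hq⟩ := h
    obtain ⟨y, hy⟩ := rv_surjective (ξ q)
    have hy0 : y ≠ 0 := by rintro rfl; exact hq hy.symm
    refine ⟨c q + y, y, hy0, fun x hx => ?_⟩
    have : x ∈ ⋃ q, {x : K | rv (x - c q) = ξ q} := by
      refine Set.mem_iUnion.mpr ⟨q, ?_⟩
      rw [Set.mem_ofPred_eq, ← hy, eq_comm, rv_eq_iff]
      left
      rwa [val_sub_comm, sub_sub]
    rwa [hU] at this
  · push Not at h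
    refine absurd ?_ hinf
    refine (finite_range_of_definableMap hT hK hc).subset fun x hx => ?_
    rw [← hU] at hx
    obtain ⟨q, hq⟩ := Set.mem_iUnion.mp hx
    rw [Set.mem_ofPred_eq, h q, eq_comm, rv_eq_iff] at hq
    rcases hq with hq | hq
    · simp at hq
    · exact ⟨q, (sub_eq_zero.mp hq.2).symm⟩

theorem infinite_iff_hasBall (hT : GeneralHypothesis T 0) (hK : K ⊨ T) {P : K → Prop}
    (hP : DP L (Set.univ : Set K) P) : {t | P t}.Infinite ↔ HasBall P :=
  ⟨hasBall_of_infinite hT hK hP, HasBall.infinite hT hK⟩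

variable {X Y : Type u} [Interpreted K X] [Interpreted K Y] [GoodSort L K X] [GoodSort L K Y]

theorem dp_slice {D : X → Y → Prop}
    (hD : DP L (Set.univ : Set K) fun p : X × Y => D p.1 p.2) (x : X) :
    DP L (Set.univ : Set K) (D x) :=
  hD.comp (g := fun t => (x, t)) ((DF.const x).prodMk (by fun_prop))

/-- Infinity of a definable subset of `K` is first order because it amounts to containing a ball. -/
theorem dp_infinite (hT : GeneralHypothesis T 0) (hK : K ⊨ T) {D : X → K → Prop}
    (hD : DP L (Set.univ : Set K) fun p : X × K => D p.1 p.2) :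
    DP L (Set.univ : Set K) fun x => {t | D x t}.Infinite := by
  have : DP L (Set.univ : Set K) fun x => ∃ a r : K, ¬ r = 0 ∧ ∀ t, val (t - a) < val r → D x t :=
    .ex (.ex (.and (.not (.eq (by fun_prop) .zero)) (.all (.imp
      (.val_lt (by fun_prop) (by fun_prop))
      (hD.comp (g := fun q : ((X × K) × K) × K => (q.1.1.1, q.2)) (by fun_prop))))))
  exact this.congr fun x => infinite_iff_hasBall hT hK (dp_slice hD x)

/-- Uniform finiteness. -/
theorem exists_encard_bound (hT : GeneralHypothesis T 0) (hK : K ⊨ T) {D : X → K → Prop}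
    (hD : DP L (Set.univ : Set K) fun p : X × K => D p.1 p.2) (hfin : ∀ x, {t | D x t}.Finite) :
    ∃ N : ℕ, ∀ x, {t | D x t}.encard ≤ N := by
  by_contra hcon
  push Not at hcon
  choose y hy using hcon
  -- Fibers of unbounded size yield an infinite fiber in the ultrapower. It contains a ball there,
  -- and the ball descends to a fiber in `K` that was assumed finite.
  obtain ⟨s, hs, hinj⟩ := exists_injective_of_unbounded (A := fun i => {t | D (y i.down) t})
    fun i => (hy i.down).le
  obtain ⟨S, hS, hSz⟩ := UPow.exists_star_fiber (U := natUltra) hD fun i => y i.down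
  let P : NatPow K → Prop := fun t => (fun _ => t) ∈ S
  have hPS : ∀ t : ULift.{u} ℕ → K, P (UPow.mk natUltra t) ↔
      ∀ᶠ i in (natUltra : Ultrafilter (ULift.{u} ℕ)), D (y i.down) (t i) := fun t =>
    hSz fun _ => t
  have hP : DP L (Set.univ : Set (NatPow K)) P := hS
  have hPinf : {t | P t}.Infinite :=
    Set.infinite_of_injective_forall_mem hinj fun j => (hPS (s j)).mpr (hs j)
  obtain ⟨a, r, hr, hball⟩ := hasBall_of_infinite hT (UPow.models hK) hP hPinf
  obtain ⟨a, rfl⟩ := UPow.mk_surjective _ a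
  obtain ⟨r, rfl⟩ := UPow.mk_surjective _ r
  have hr' : ∀ᶠ i in (natUltra : Ultrafilter (ULift.{u} ℕ)), r i ≠ 0 := by
    rw [Ultrafilter.eventually_not]
    exact fun h => hr (UPow.mk_eq.mpr h)
  have hb : ∀ᶠ i in (natUltra : Ultrafilter (ULift.{u} ℕ)),
      ∀ x, val (x - a i) < val (r i) → D (y i.down) x := by
    by_contra h
    rw [← Ultrafilter.eventually_not] at h
    push Not at h
    let x : ULift.{u} ℕ → K := fun i => Classical.epsilon fun x =>
      val (x - a i) < val (r i) ∧ ¬ D (y i.down) x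
    have hx : ∀ᶠ i in (natUltra : Ultrafilter (ULift.{u} ℕ)),
        val (x i - a i) < val (r i) ∧ ¬ D (y i.down) (x i) := by
      filter_upwards [h] with i hi
      exact Classical.epsilon_spec hi
    have h1 := (hPS x).mp (hball _ (UPow.val_lt_iff.mpr (hx.mono fun _ h => h.1)))
    obtain ⟨i, h2, h3⟩ := (hx.and h1).exists
    exact h2.2 h3
  obtain ⟨i, h1, h2⟩ := (hr'.and hb).exists
  exact (infinite_ball hT hK (a i) h1).mono h2 (hfin _)

/-- A definable union of finite sets indexed by a sort with the finite image property is finite. -/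
theorem exists_infinite_of_infinite_union (hT : GeneralHypothesis T 0) (hK : K ⊨ T)
    (hX : FinImage L K X) {D : X → K → Prop}
    (hD : DP L (Set.univ : Set K) fun p : X × K => D p.1 p.2) (h : {t | ∃ x, D x t}.Infinite) :
    ∃ x, {t | D x t}.Infinite := by
  by_contra hcon
  simp only [not_exists, Set.not_infinite] at hcon
  obtain ⟨N, hN⟩ := exists_encard_bound hT hK hD hcon
  exact h (hX.finite_union hD hN)

theorem Enumerates.encard_eq {M : ℕ} {D : K → Prop} {t : Fin M → K} (h : Enumerates D t) :
    {s | D s}.encard = M := by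
  have : {s | D s} = Set.range t := Set.ext h.2
  rw [this, ← Set.image_univ, h.1.encard_image, Set.encard_univ]
  simp

/-- The elements of a set with at least two elements do not all have the same leading term with
respect to the average. -/
theorem Enumerates.exists_rv_ne {N : ℕ} {D : K → Prop} {t : Fin (N + 2) → K}
    (h : Enumerates D t) (η : RV K) :
    ∃ i, rv (t i - (((N + 2 : ℕ) : K))⁻¹ * ∑ j, t j) ≠ η := by
  by_contra hcon
  push Not at hcon
  set a := (((N + 2 : ℕ) : K))⁻¹ * ∑ j, t j with ha
  set w := t 0 - a with hw
  have hsum : ∑ j, (t j - a) = 0 := by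
    rw [Finset.sum_sub_distrib, Finset.sum_const, Finset.card_univ, Fintype.card_fin, nsmul_eq_mul,
      ha, mul_inv_cancel_left₀ (natCast_ne_zero (by omega)), sub_self]
  have hrv : ∀ i, rv w = rv (t i - a) := fun i => (hcon 0).trans (hcon i).symm
  by_cases hw0 : w = 0
  · have : ∀ i, t i = a := fun i => by
      have := hrv i
      rw [hw0, rv_eq_iff] at this
      rcases this with h | h
      · simp at h
      · exact sub_eq_zero.mp h.2
    exact absurd (h.1 ((this 0).trans (this 1).symm)) (by simp)
  · have hlt : ∀ i, val (w - (t i - a)) < val w := fun i => by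
      rcases rv_eq_iff.mp (hrv i) with h | h
      · exact h
      · exact absurd h.1 hw0
    -- The deviations from the average sum to zero, so this sum is `(N + 2) w`, which has the
    -- valuation of `w`.
    have h1 : val (∑ i, (w - (t i - a))) < val w :=
      (O K).valuation.map_sum_lt (fun h => hw0 (val_eq_zero.mp h)) fun i _ => hlt i
    rw [Finset.sum_sub_distrib, hsum, sub_zero, Finset.sum_const, Finset.card_univ,
      Fintype.card_fin, nsmul_eq_mul, val_mul, val_natCast (by omega), one_mul] at h1
    exact lt_irrefl _ h1

end Basic

/-! ### Dimension theory in the plane -/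

section Fubini

variable {K : Type u} [HenselianVF K] [L.Structure K]

/-- `Z` is the graph of a partial function `g` of `t`. Split its domain by an auxiliary sort into
classes on which `g` is injective or constant. An infinite fiber of `g` meets some class in
infinitely many points, so `g` is constant there; the constant values form a family of sets with at
most one element indexed by the auxiliary sort, hence are finite in number. -/
theorem finite_fibers_of_function (hT : GeneralHypothesis T 0) (hK : K ⊨ T) {Z : K → K → Prop}
    (hZ : DP L (Set.univ : Set K) fun q : K × K => Z q.1 q.2)
    (hfun : ∀ t p p', Z p t → Z p' t → p = p') : {p | {t | Z p t}.Infinite}.Finite := by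
  obtain ⟨g, hg, hgZ⟩ := exists_df_of_functional (X := K) (R := fun t p => Z p t)
    (hZ.comp (g := fun q : K × K => (q.2, q.1)) (by fun_prop)) hfun
  let D : Set K := {t | ∃ p, Z p t}
  have hD : DP L (Set.univ : Set K) fun t => t ∈ D :=
    .ex (hZ.comp (g := fun q : K × K => (q.2, q.1)) (by fun_prop))
  obtain ⟨s, χ, hχ, hinj⟩ := (hT.bMinimal K hK).injective_or_constant Set.univ D (fun t => g t)
    (definable_iff_dp.mpr hD) (definableMap_iff.mpr ((hD.fst.and hg).congr fun p => by simp))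
  have hR := definableMap_iff.mp hχ
  set R : K → s.Carrier → Prop := fun t q => ∃ h : t ∈ D, χ ⟨t, h⟩ = q with hRdef
  have hconst : DP L (Set.univ : Set K) fun q : s.Carrier × K =>
      (∃ t, R t q.1 ∧ Z q.2 t) ∧ ∀ t p', R t q.1 → Z p' t → p' = q.2 :=
    .and (.ex (.and (hR.comp (g := fun q : (s.Carrier × K) × K => (q.2, q.1.1)) (by fun_prop))
        (hZ.comp (g := fun q : (s.Carrier × K) × K => (q.1.2, q.2)) (by fun_prop))))
      (.all (.all (.imp (hR.comp (g := fun q : ((s.Carrier × K) × K) × K => (q.1.2, q.1.1.1))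
          (by fun_prop))
        (.imp (hZ.comp (g := fun q : ((s.Carrier × K) × K) × K => (q.2, q.1.2)) (by fun_prop))
          (.eq (by fun_prop) (by fun_prop))))))
  refine ((finImage_aux hT hK s).finite_union
    (D := fun q p => (∃ t, R t q ∧ Z p t) ∧ ∀ t p', R t q → Z p' t → p' = p)
    hconst (N := 1) fun q => ?_).subset fun p hp => ?_
  · rw [Nat.cast_one, Set.encard_le_one_iff]
    rintro p p' ⟨⟨t, ht, hp⟩, -⟩ ⟨-, h⟩
    exact h t p ht hp
  · have hD' : DP L (Set.univ : Set K) fun q : s.Carrier × K => R q.2 q.1 ∧ Z p q.2 :=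
      .and (hR.comp (g := fun q : s.Carrier × K => (q.2, q.1)) (by fun_prop))
        ((dp_slice hZ p).snd)
    have hsub : {t | ∃ q, R t q ∧ Z p t}.Infinite := by
      refine Set.Infinite.mono (fun t ht => ?_) hp
      exact ⟨χ ⟨t, p, ht⟩, ⟨⟨p, ht⟩, rfl⟩, ht⟩
    obtain ⟨q, hq⟩ := exists_infinite_of_infinite_union hT hK (finImage_aux hT hK s) hD' hsub
    obtain ⟨t₁, ht₁, t₂, ht₂, hne⟩ := hq.nontrivial
    refine ⟨q, ⟨t₁, ht₁⟩, ?_⟩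
    obtain ⟨⟨h₁, hχ₁⟩, hZ₁⟩ := ht₁
    obtain ⟨⟨h₂, hχ₂⟩, hZ₂⟩ := ht₂
    rcases hinj q with hi | hc
    · have := @hi ⟨t₁, h₁⟩ hχ₁ ⟨t₂, h₂⟩ hχ₂ ((hgZ _ _ hZ₁).trans (hgZ _ _ hZ₂).symm)
      exact absurd (congrArg Subtype.val this) hne
    · rintro t p' ⟨h, hχt⟩ hZt
      have := hc ⟨t, h⟩ hχt ⟨t₁, h₁⟩ hχ₁
      simp only at this
      rwa [hgZ _ _ hZt, hgZ _ _ hZ₁] at this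

/-- Induction on the size of the fibers over `t`. Fibers of less than maximal size fall under the
induction hypothesis, and fibers with one element form the graph of a function. Larger ones are
split by the leading term of `p - a t`, where `a t` is the average of the fiber: no leading term
captures the whole fiber, so each piece has smaller fibers. -/
theorem finite_infinite_fibers_aux (hT : GeneralHypothesis T 0) (hK : K ⊨ T) (N : ℕ) :
    ∀ Z : K → K → Prop, DP L (Set.univ : Set K) (fun q : K × K => Z q.1 q.2) →
      (∀ t, {p | Z p t}.encard ≤ N) → {p | {t | Z p t}.Infinite}.Finite := by
  induction N with
  | zero =>
    intro Z _ h
    refine Set.finite_empty.subset fun p hp => ?_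
    obtain ⟨t, ht⟩ := hp.nonempty
    have := h t
    rw [Nat.cast_zero, nonpos_iff_eq_zero, Set.encard_eq_zero] at this
    exact (Set.ext_iff.mp this p).mp ht
  | succ N ih =>
    intro Z hZ h
    have hZt : DP L (Set.univ : Set K) fun q : K × K => Z q.2 q.1 :=
      hZ.comp (g := fun q : K × K => (q.2, q.1)) (by fun_prop)
    let E : K → Prop := fun t => ∃ s : Fin (N + 1) → K, Enumerates (fun p => Z p t) s
    have hE : DP L (Set.univ : Set K) E :=
      .ex (dp_enumerates (X := K) (D := fun t p => Z p t) hZt (by fun_prop) (by fun_prop))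
    have h1 : {p | {t | Z p t ∧ ¬ E t}.Infinite}.Finite := by
      refine ih _ (hZ.and hE.snd.not) fun t => ?_
      by_cases ht : E t
      · simp [ht]
      · obtain ⟨M, hM, s, hs⟩ := exists_enumerates (h t)
        have hM' : M ≠ N + 1 := by rintro rfl; exact ht ⟨s, hs⟩
        simp only [ht, not_false_eq_true, and_true]
        rw [hs.encard_eq]
        exact_mod_cast (by omega : M ≤ N)
    suffices h2 : {p | {t | Z p t ∧ E t}.Infinite}.Finite by
      refine (h1.union h2).subset fun p hp => ?_
      by_contra hcon
      simp only [Set.mem_union, Set.mem_ofPred_eq, not_or, Set.not_infinite] at hcon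
      refine hp ((hcon.1.union hcon.2).subset fun t ht => ?_)
      by_cases hEt : E t
      · exact Or.inr ⟨ht, hEt⟩
      · exact Or.inl ⟨ht, hEt⟩
    rcases N with _ | N
    · refine finite_fibers_of_function hT hK (hZ.and hE.snd) ?_
      rintro t p p' ⟨hp, -⟩ ⟨hp', -⟩
      have := h t
      rw [zero_add, Nat.cast_one, Set.encard_le_one_iff] at this
      exact this p p' hp hp'
    · let F : (Fin (N + 2) → K) → K := fun s => (((N + 2 : ℕ) : K))⁻¹ * ∑ j, s j
      have hF : ∀ (D : K → Prop) t t', Enumerates D t → Enumerates D t' → F t = F t' :=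
        fun D t t' h h' => by simp only [F, h.sum_eq h']
      let a : K → K := enumFun (N + 2) (fun t p => Z p t) F
      have ha : DF L (Set.univ : Set K) a := df_enumFun hZt hF
        ((DF.const _).mul (DF.sum _ fun i => by fun_prop))
      have hZη : DP L (Set.univ : Set K) fun q : (RV K × K) × K =>
          (Z q.1.2 q.2 ∧ E q.2) ∧ rv (q.1.2 - a q.2) = q.1.1 :=
        .and (.and (hZ.comp (g := fun q : (RV K × K) × K => (q.1.2, q.2)) (by fun_prop))
          (hE.comp (by fun_prop))) (.eq (by fun_prop) (by fun_prop))
      have hfin : ∀ η, {p | {t | (Z p t ∧ E t) ∧ rv (p - a t) = η}.Infinite}.Finite := by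
        intro η
        refine ih _ (hZη.comp (g := fun q : K × K => ((η, q.1), q.2))
          (((DF.const η).prodMk (by fun_prop)).prodMk (by fun_prop))) fun t => ?_
        by_cases ht : E t
        · obtain ⟨s, hs⟩ := ht
          obtain ⟨i, hi⟩ := hs.exists_rv_ne η
          have hat : a t = F s := enumFun_eq hF hs
          have hss : {p | (Z p t ∧ E t) ∧ rv (p - a t) = η} ⊂ {p | Z p t} := by
            refine ⟨fun p hp => hp.1.1, fun hsub => hi ?_⟩
            have := (hsub ((hs.2 (s i)).mpr ⟨i, rfl⟩)).2
            rwa [hat] at this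
          have hlt := Set.Finite.encard_lt_encard
            ((Set.finite_of_encard_le_coe (h t)).subset hss.1) hss
          rw [hs.encard_eq] at hlt
          refine Order.le_of_lt_add_one (lt_of_lt_of_eq hlt ?_)
          push_cast
          ring
        · simp [ht]
      -- Each `p` with an infinite fiber keeps an infinite fiber for some `η`. If there were
      -- infinitely many such `p`, a single `η` would serve infinitely many of them, against `hfin`.
      by_contra hinf
      have := exists_infinite_of_infinite_union hT hK (finImage_rv hT K hK)
        (D := fun η p => {t | (Z p t ∧ E t) ∧ rv (p - a t) = η}.Infinite)
        (dp_infinite hT hK (D := fun (q : RV K × K) t =>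
          (Z q.2 t ∧ E t) ∧ rv (q.2 - a t) = q.1) hZη) ?_
      · obtain ⟨η, hη⟩ := this
        exact hη (hfin η)
      · refine Set.Infinite.mono (fun p hp => ?_) hinf
        refine exists_infinite_of_infinite_union hT hK (finImage_rv hT K hK)
          (D := fun η t => (Z p t ∧ E t) ∧ rv (p - a t) = η) ?_ ?_
        · exact hZη.comp (g := fun q : RV K × K => ((q.1, p), q.2))
            (((DF.fst').prodMk (DF.const p)).prodMk (by fun_prop))
        · refine Set.Infinite.mono (fun t ht => ?_) hp
          exact ⟨_, ht, rfl⟩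

theorem finite_infinite_fibers (hT : GeneralHypothesis T 0) (hK : K ⊨ T) {Z : K → K → Prop}
    (hZ : DP L (Set.univ : Set K) fun q : K × K => Z q.1 q.2) (hfin : ∀ t, {p | Z p t}.Finite) :
    {p | {t | Z p t}.Infinite}.Finite := by
  obtain ⟨N, hN⟩ := exists_encard_bound hT hK (D := fun t p => Z p t)
    (hZ.comp (g := fun q : K × K => (q.2, q.1)) (by fun_prop)) hfin
  exact finite_infinite_fibers_aux hT hK N Z hZ hN

/-- For fixed `t`, only finitely many `p` in the slice are not interior to it, as an infinite set of
them would contain a ball. Hence for all but finitely many `p` with infinite fiber, almost every `t`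
in the fiber leaves room around `p`. The radius of this room depends on `t`, but its leading term
can be fixed on an infinite set of `t`, which contains a ball. -/
theorem exists_box (hT : GeneralHypothesis T 0) (hK : K ⊨ T) {X : K → K → Prop}
    (hX : DP L (Set.univ : Set K) fun q : K × K => X q.1 q.2)
    (h : {p | {t | X p t}.Infinite}.Infinite) :
    ∃ p₀ t₀ r : K, r ≠ 0 ∧ ∀ p t, val (p - p₀) < val r → val (t - t₀) < val r → X p t := by
  let B : K → K → Prop := fun p t => ∃ r : K, ¬ r = 0 ∧ ∀ p', val (p' - p) < val r → X p' t
  have hB : DP L (Set.univ : Set K) fun q : K × K => B q.1 q.2 :=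
    .ex (.and (.not (.eq (by fun_prop) .zero)) (.all (.imp (.val_lt (by fun_prop) (by fun_prop))
      (hX.comp (g := fun q : ((K × K) × K) × K => (q.2, q.1.1.2)) (by fun_prop)))))
  have hfin := finite_infinite_fibers hT hK (Z := fun p t => X p t ∧ ¬ B p t) (hX.and hB.not) (by
    intro t
    by_contra hinf
    obtain ⟨a, r, hr, hball⟩ := hasBall_of_infinite hT hK
      (dp_slice (X := K) (Y := K) (D := fun t p => X p t ∧ ¬ B p t)
        ((hX.and hB.not).comp (g := fun q : K × K => (q.2, q.1)) (by fun_prop)) t) hinf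
    refine (hball a ?_).2 ⟨r, hr, fun p' hp' => (hball p' hp').1⟩
    rw [sub_self, val_zero]
    exact val_pos.mpr hr)
  obtain ⟨p₀, hp₀, hn⟩ := (h.sdiff hfin).nonempty
  have hinf : {t | ∃ η : RV K, ∃ r, (¬ r = 0 ∧ rv r = η) ∧
      ∀ p', val (p' - p₀) < val r → X p' t}.Infinite := by
    refine (Set.Infinite.sdiff hp₀ (Set.not_infinite.mp hn)).mono fun t ht => ?_
    simp only [Set.mem_sdiff, Set.mem_ofPred_eq, not_and, not_not] at ht
    obtain ⟨r, hr, hball⟩ := ht.2 ht.1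
    exact ⟨rv r, r, ⟨hr, rfl⟩, hball⟩
  have hD : DP L (Set.univ : Set K) fun q : RV K × K => ∃ r, (¬ r = 0 ∧ rv r = q.1) ∧
      ∀ p', val (p' - p₀) < val r → X p' q.2 :=
    .ex (.and (.and (.not (.eq (by fun_prop) .zero)) (.eq (by fun_prop) (by fun_prop)))
      (.all (.imp (.val_lt (DF.sub (by fun_prop) (DF.const p₀)) (by fun_prop))
        (hX.comp (g := fun q : ((RV K × K) × K) × K => (q.2, q.1.1.2)) (by fun_prop)))))
  obtain ⟨η, hη⟩ := exists_infinite_of_infinite_union hT hK (finImage_rv hT K hK) hD hinf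
  obtain ⟨t₀, s, hs, hball⟩ := hasBall_of_infinite hT hK (dp_slice (D := fun (η : RV K) t =>
    ∃ r, (¬ r = 0 ∧ rv r = η) ∧ ∀ p', val (p' - p₀) < val r → X p' t) hD η) hη
  obtain ⟨r, ⟨hr, hrη⟩, -⟩ := hball t₀ (by rw [sub_self, val_zero]; exact val_pos.mpr hs)
  obtain ⟨q, hq, hqr, hqs⟩ := exists_val_le_both hr hs
  refine ⟨p₀, t₀, q, hq, fun p t hp ht => ?_⟩
  obtain ⟨r', ⟨-, hr'⟩, hX'⟩ := hball t (ht.trans_le hqs)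
  refine hX' p (hp.trans_le ?_)
  rwa [val_eq_of_rv_eq (hr'.trans hrη.symm)]

end Fubini
end BMinimal

/-! ### Dimension theory in higher powers of the field -/

section Dimension

variable {L : FirstOrder.Language.{u, u}} {T : (expand L).Theory}
variable {K : Type u} [HenselianVF K] [L.Structure K]

theorem valn_cons_sub_lt_iff {m : ℕ} {x y : K} {p q : Fin m → K} {γ : Val K} (hγ : 0 < γ) :
    valn ((Fin.cons x p : Fin (m + 1) → K) - Fin.cons y q) < γ ↔
      val (x - y) < γ ∧ valn (p - q) < γ := by
  rw [valn_lt_iff hγ, valn_lt_iff hγ, Fin.forall_fin_succ]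
  simp

variable (L K) in
/-- If a ball of `K ^ m` is covered by a definable family indexed by a sort with the finite image
property, then some member of the family contains a ball. -/
def CoverProp (m : ℕ) : Prop :=
  ∀ (Y : Type u) [Interpreted K Y] [GoodSort L K Y], FinImage L K Y →
    ∀ D : Y → (Fin m → K) → Prop,
      DP L (Set.univ : Set K) (fun q : Y × (Fin m → K) => D q.1 q.2) →
      Big (fun x => ∃ y, D y x) → ∃ y, Big (D y)

variable (L K) in
/-- A definable family of infinite subsets of `K` over a ball of `K ^ m` contains a box. -/
def BoxProp (m : ℕ) : Prop :=
  ∀ X : (Fin m → K) → K → Prop,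
    DP L (Set.univ : Set K) (fun q : (Fin m → K) × K => X q.1 q.2) →
    Big (fun x => {t | X x t}.Infinite) → BigPair X

theorem coverProp_zero : CoverProp L K 0 := by
  rintro Y _ _ - D - ⟨a, r, hr, h⟩
  obtain ⟨y, hy⟩ := h a (by rw [sub_self, valn_zero]; exact val_pos.mpr hr)
  exact ⟨y, a, r, hr, fun x _ => Subsingleton.elim a x ▸ hy⟩

theorem boxProp_zero (hT : GeneralHypothesis T 0) (hK : K ⊨ T) : BoxProp L K 0 := by
  rintro X hX ⟨a, r, hr, h⟩
  have := h a (by rw [sub_self, valn_zero]; exact val_pos.mpr hr)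
  obtain ⟨b, s, hs, hb⟩ := hasBall_of_infinite hT hK (dp_slice hX a) this
  exact ⟨a, b, s, hs, fun x t _ ht => Subsingleton.elim a x ▸ hb t ht⟩

/-- Over each tail `p`, some member of the family contains infinitely many first coordinates. By the
covering property in dimension `m` one member does so over a whole ball of tails, and the box
property then gives a ball inside it. -/
theorem coverProp_succ (hT : GeneralHypothesis T 0) (hK : K ⊨ T) {m : ℕ} (hC : CoverProp L K m)
    (hB : BoxProp L K m) : CoverProp L K (m + 1) := by
  rintro Y _ _ hY D hD ⟨a, r, hr, h⟩
  have hr' := val_pos.mpr hr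
  have hD' : DP L (Set.univ : Set K) fun q : (Y × (Fin m → K)) × K =>
      D q.1.1 (Fin.cons q.2 q.1.2) :=
    hD.comp (g := fun q : (Y × (Fin m → K)) × K => (q.1.1, (Fin.cons q.2 q.1.2 : Fin (m + 1) → K)))
      (by fun_prop)
  obtain ⟨y, hy⟩ := hC Y hY (fun y p => {t | D y (Fin.cons t p)}.Infinite)
    (dp_infinite hT hK (D := fun (q : Y × (Fin m → K)) t => D q.1 (Fin.cons t q.2)) hD')
    ⟨Fin.tail a, r, hr, fun p hp => by
      refine exists_infinite_of_infinite_union hT hK hY (D := fun y t => D y (Fin.cons t p))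
        (hD'.comp (g := fun q : Y × K => ((q.1, p), q.2))
          (((DF.fst').prodMk (DF.const p)).prodMk (by fun_prop)))
        ((infinite_ball hT hK (a 0) hr).mono fun t ht => h _ ?_)
      rw [← Fin.cons_self_tail a, valn_cons_sub_lt_iff hr']
      exact ⟨ht, hp⟩⟩
  obtain ⟨p₀, t₀, s, hs, hbox⟩ := hB (fun p t => D y (Fin.cons t p))
    (hD'.comp (g := fun q : (Fin m → K) × K => ((y, q.1), q.2))
      (((DF.const y).prodMk (by fun_prop)).prodMk (by fun_prop))) hy
  refine ⟨y, Fin.cons t₀ p₀, s, hs, fun x hx => ?_⟩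
  rw [← Fin.cons_self_tail x, valn_cons_sub_lt_iff (val_pos.mpr hs)] at hx
  rw [← Fin.cons_self_tail x]
  exact hbox _ _ hx.2 hx.1

/-- Over each tail `p` the planar case gives a square in the remaining two coordinates. The covering
property makes the leading term of its radius constant on a ball of tails. Any point of a square can
serve as its center, so the admissible centers form infinite sets; two uses of the box property then
make the two coordinates of the center constant. -/
theorem boxProp_succ (hT : GeneralHypothesis T 0) (hK : K ⊨ T) {m : ℕ} (hC : CoverProp L K m)
    (hB : BoxProp L K m) : BoxProp L K (m + 1) := by
  rintro X hX ⟨a, r, hr, h⟩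
  let cube : K → (Fin m → K) → K → K → Prop := fun ρ p s t =>
    ∀ s' t', val (s' - s) < val ρ → val (t' - t) < val ρ → X (Fin.cons s' p) t'
  have hcube : DP L (Set.univ : Set K) fun q : ((K × (Fin m → K)) × K) × K =>
      cube q.1.1.1 q.1.1.2 q.1.2 q.2 :=
    .all (.all (.imp (.val_lt (by fun_prop) (by fun_prop)) (.imp
      (.val_lt (by fun_prop) (by fun_prop)) (hX.comp (g := fun q :
        ((((K × (Fin m → K)) × K) × K) × K) × K =>
          ((Fin.cons q.1.2 q.1.1.1.1.2 : Fin (m + 1) → K), q.2)) (by fun_prop)))))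
  have hcube_shift : ∀ {ρ p s t s' t'}, cube ρ p s t → val (s' - s) < val ρ → val (t' - t) < val ρ →
      cube ρ p s' t' := fun h hs ht s'' t'' hs' ht' =>
    h _ _ (val_sub_lt_trans hs' hs) (val_sub_lt_trans ht' ht)
  obtain ⟨η, a₁, r₁, hr₁, h₁⟩ := hC (RV K) (finImage_rv hT K hK)
    (fun η p => ∃ s t ρ, (¬ ρ = 0 ∧ rv ρ = η) ∧ cube ρ p s t)
    (.ex (.ex (.ex (.and (.and (.not (.eq (by fun_prop) .zero)) (.eq (by fun_prop) (by fun_prop)))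
      (hcube.comp (g := fun q : (((RV K × (Fin m → K)) × K) × K) × K =>
        (((q.2, q.1.1.1.2), q.1.1.2), q.1.2)) (by fun_prop))))))
    ⟨Fin.tail a, r, hr, fun p hp => by
      obtain ⟨s, t, ρ, hρ, hbox⟩ := exists_box hT hK (X := fun s t => X (Fin.cons s p) t)
        (hX.comp (g := fun q : K × K => ((Fin.cons q.1 p : Fin (m + 1) → K), q.2))
          ((DF.cons (by fun_prop) (DF.const p)).prodMk (by fun_prop)))
        ((infinite_ball hT hK (a 0) hr).mono fun t ht => h _ (by
          rw [← Fin.cons_self_tail a, valn_cons_sub_lt_iff (val_pos.mpr hr)]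
          exact ⟨ht, hp⟩))
      exact ⟨rv ρ, s, t, ρ, ⟨hρ, rfl⟩, hbox⟩⟩
  obtain ⟨-, -, ρ, ⟨hρ, hρη⟩, -⟩ := h₁ a₁ (by rw [sub_self, valn_zero]; exact val_pos.mpr hr₁)
  have hρ' := val_pos.mpr hρ
  have h₁' : ∀ p, valn (p - a₁) < val r₁ → ∃ s t, cube ρ p s t := fun p hp => by
    obtain ⟨s, t, ρ', ⟨-, hη⟩, hc⟩ := h₁ p hp
    refine ⟨s, t, fun s' t' hs ht => hc s' t' ?_ ?_⟩
    · rwa [val_eq_of_rv_eq (hη.trans hρη.symm)]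
    · rwa [val_eq_of_rv_eq (hη.trans hρη.symm)]
  have hcρ : DP L (Set.univ : Set K) fun q : ((Fin m → K) × K) × K => cube ρ q.1.1 q.1.2 q.2 :=
    hcube.comp (g := fun q : ((Fin m → K) × K) × K => (((ρ, q.1.1), q.1.2), q.2))
      ((((DF.const ρ).prodMk (by fun_prop)).prodMk (by fun_prop)).prodMk (by fun_prop))
  obtain ⟨a₂, b₂, r₂, hr₂, h₂⟩ := hB (fun p s => ∃ t, cube ρ p s t) (.ex hcρ)
    ⟨a₁, r₁, hr₁, fun p hp => by
      obtain ⟨s, t, hc⟩ := h₁' p hp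
      refine (infinite_ball hT hK s hρ).mono fun s' hs' => ⟨t, hcube_shift hc hs' ?_⟩
      rwa [sub_self, val_zero]⟩
  obtain ⟨a₃, b₃, r₃, hr₃, h₃⟩ := hB (fun p t => cube ρ p b₂ t)
    (hcρ.comp (g := fun q : (Fin m → K) × K => ((q.1, b₂), q.2))
      (((DF.fst').prodMk (DF.const b₂)).prodMk (by fun_prop)))
    ⟨a₂, r₂, hr₂, fun p hp => by
      obtain ⟨t, hc⟩ := h₂ p b₂ hp (by rw [sub_self, val_zero]; exact val_pos.mpr hr₂)
      refine (infinite_ball hT hK t hρ).mono fun t' ht' => hcube_shift hc ?_ ht'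
      rwa [sub_self, val_zero]⟩
  obtain ⟨q, hq, hqr, hqρ⟩ := exists_val_le_both hr₃ hρ
  refine ⟨Fin.cons b₂ a₃, b₃, q, hq, fun x t hx ht => ?_⟩
  rw [← Fin.cons_self_tail x, valn_cons_sub_lt_iff (val_pos.mpr hq)] at hx
  rw [← Fin.cons_self_tail x]
  refine h₃ (Fin.tail x) b₃ (hx.2.trans_le hqr) ?_ _ _ (hx.1.trans_le hqρ) (ht.trans_le hqρ)
  rw [sub_self, val_zero]
  exact val_pos.mpr hr₃

theorem coverProp_and_boxProp (hT : GeneralHypothesis T 0) (hK : K ⊨ T) (m : ℕ) :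
    CoverProp L K m ∧ BoxProp L K m := by
  induction m with
  | zero => exact ⟨coverProp_zero, boxProp_zero hT hK⟩
  | succ m ih => exact ⟨coverProp_succ hT hK ih.1 ih.2, boxProp_succ hT hK ih.1 ih.2⟩

theorem rv_natCast_injective : Function.Injective fun j : ℕ => rv (j : K) := by
  have key : ∀ i j : ℕ, i < j → rv (j : K) ≠ rv (i : K) := by
    intro i j hij h
    rw [rv_eq_iff, ← Nat.cast_sub hij.le, val_natCast (by omega), val_natCast (by omega)] at h
    rcases h with h | h
    · exact lt_irrefl _ h
    · exact natCast_ne_zero (by omega) h.1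
  intro i j h
  rcases lt_trichotomy i j with hij | rfl | hij
  · exact absurd h.symm (key i j hij)
  · rfl
  · exact absurd h (key j i hij)

/-- The finite index set is coded in `RV` by leading terms of natural numbers, which are distinct in
residue characteristic zero. -/
theorem Big.exists_of_finite (hT : GeneralHypothesis T 0) (hK : K ⊨ T) {m n : ℕ}
    {Q : Fin n → (Fin m → K) → Prop} (hQ : ∀ j, DP L (Set.univ : Set K) (Q j))
    (h : Big fun x => ∃ j, Q j x) : ∃ j, Big (Q j) := by
  obtain ⟨η, a, r, hr, hη⟩ := (coverProp_and_boxProp hT hK m).1 (RV K) (finImage_rv hT K hK)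
    (fun η x => ∃ j : Fin n, η = rv ((j : ℕ) : K) ∧ Q j x)
    (.ex_fin fun j => .and (.eq (by fun_prop) (DF.const _)) (hQ j).snd) (by
      obtain ⟨a, r, hr, h⟩ := h
      refine ⟨a, r, hr, fun x hx => ?_⟩
      obtain ⟨j, hj⟩ := h x hx
      exact ⟨_, j, rfl, hj⟩)
  obtain ⟨j, hj, -⟩ := hη a (by rw [sub_self, valn_zero]; exact val_pos.mpr hr)
  refine ⟨j, a, r, hr, fun x hx => ?_⟩
  obtain ⟨j', hj', hx⟩ := hη x hx
  obtain rfl : j = j' := Fin.ext (rv_natCast_injective (K := K) (hj.symm.trans hj'))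
  exact hx

/-- A definable set with infinite fibers over a ball of `K ^ d` has dimension at least `d + 1`. -/
theorem le_dim_of_big_infinite (hT : GeneralHypothesis T 0) (hK : K ⊨ T) {n d : ℕ}
    {G : Set (Fin n → K)} (hG : DP L (Set.univ : Set K) fun z => z ∈ G) {e : Fin d → Fin n}
    (he : Function.Injective e)
    (h : Big fun p : Fin d → K => {z | z ∈ G ∧ ∀ i, z (e i) = p i}.Infinite) :
    (((d + 1 : ℕ) : ℕ∞) : WithBot ℕ∞) ≤ dim G := by
  classical
  have hD : ∀ j, DP L (Set.univ : Set K) fun q : (Fin d → K) × K =>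
      ∃ z, (z ∈ G ∧ ∀ i, z (e i) = q.1 i) ∧ z j = q.2 := fun j =>
    .ex (.and (.and (hG.comp (by fun_prop)) (.all_fin fun i => .eq (by fun_prop) (by fun_prop)))
      (.eq (by fun_prop) (by fun_prop)))
  -- An infinite subset of `K ^ n` has an infinite projection to some coordinate; one coordinate `j`
  -- works over a whole ball. It is not among the coordinates `e i`, which are constant on the
  -- fiber.
  obtain ⟨j, hj⟩ := Big.exists_of_finite hT hK
    (Q := fun (j : Fin n) (p : Fin d → K) =>
      {t | ∃ z, (z ∈ G ∧ ∀ i, z (e i) = p i) ∧ z j = t}.Infinite)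
    (fun j => dp_infinite hT hK
      (D := fun (p : Fin d → K) t => ∃ z, (z ∈ G ∧ ∀ i, z (e i) = p i) ∧ z j = t) (hD j)) (by
      obtain ⟨a, r, hr, h⟩ := h
      refine ⟨a, r, hr, fun p hp => ?_⟩
      by_contra hcon
      simp only [not_exists, Set.not_infinite] at hcon
      refine h p hp ((Set.Finite.pi fun j => hcon j).subset fun z hz j _ => ?_)
      exact ⟨z, hz, rfl⟩)
  have hje : ∀ i, e i ≠ j := by
    rintro i rfl
    obtain ⟨a, r, hr, h⟩ := hj
    refine h a (by rw [sub_self, valn_zero]; exact val_pos.mpr hr)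
      ((Set.finite_singleton (a i)).subset ?_)
    rintro _ ⟨z, hz, rfl⟩
    exact hz.2 i
  obtain ⟨p₀, t₀, r, hr, hbox⟩ := (coverProp_and_boxProp hT hK d).2 _ (hD j) hj
  have hr' := val_pos.mpr hr
  -- `dim` requires the coordinates in increasing order, so those of `e` together with `j` are
  -- re-enumerated by `e'`, with inverse `l`; `c` is the center of the box, indexed by the original
  -- coordinates.
  let J : Finset (Fin n) := insert j (Finset.univ.image e)
  have hJ : J.card = d + 1 := by
    rw [Finset.card_insert_of_notMem (by simpa using hje), Finset.card_image_of_injective _ he,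
      Finset.card_univ, Fintype.card_fin]
  let e' := J.orderEmbOfFin hJ
  have hrange : ∀ i ∈ J, ∃ l, e' l = i := fun i hi => by
    have : i ∈ Set.range e' := by rw [Finset.range_orderEmbOfFin]; exact hi
    exact this
  choose! l hl using hrange
  let c : Fin n → K := fun i => if h : ∃ i', e i' = i then p₀ h.choose else t₀
  have hce : ∀ i, c (e i) = p₀ i := fun i => by
    have h : ∃ i', e i' = e i := ⟨i, rfl⟩
    simp only [c, dif_pos h]
    exact congrArg p₀ (he h.choose_spec)
  have hcj : c j = t₀ := by
    have h : ¬ ∃ i', e i' = j := fun ⟨i, hi⟩ => hje i hi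
    simp only [c, dif_neg h]
  have hlJ : ∀ i ∈ J, ∀ x : Fin (d + 1) → K, valn (x - c ∘ e') < val r →
      val (x (l i) - c i) < val r := fun i hi x hx => by
    have := (valn_lt_iff hr').mp hx (l i)
    simpa [hl i hi] using this
  refine le_iSup₂_of_le (d + 1) ⟨e', {x | valn (x - c ∘ e') < val r},
    Or.inl (Or.inr ⟨_, _, hr'.ne', rfl⟩), fun x hx => ?_⟩ le_rfl
  have heJ : ∀ i, e i ∈ J := fun i =>
    Finset.mem_insert_of_mem (Finset.mem_image_of_mem e (Finset.mem_univ i))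
  have hjJ : j ∈ J := Finset.mem_insert_self _ _
  obtain ⟨z, ⟨hzG, hze⟩, hzj⟩ := hbox (fun i => x (l (e i))) (x (l j))
    ((valn_lt_iff hr').mpr fun i => by
      have := hlJ (e i) (heJ i) x hx
      rwa [hce] at this)
    (by
      have := hlJ j hjJ x hx
      rwa [hcj] at this)
  refine ⟨z, hzG, funext fun k => ?_⟩
  have hk : e' k ∈ J := Finset.orderEmbOfFin_mem J hJ k
  have hlk : l (e' k) = k := e'.injective (hl _ hk)
  change z (e' k) = x k
  rcases Finset.mem_insert.mp hk with hkj | hke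
  · rw [hkj, hzj, ← hkj, hlk]
  · obtain ⟨i, -, hi⟩ := Finset.mem_image.mp hke
    rw [← hi, hze]
    change x (l (e i)) = x k
    rw [hi, hlk]

end Dimension

/-! ### Definable spherical completeness -/

section SphericalCompleteness

variable {L : FirstOrder.Language.{u, u}} {T : (expand L).Theory}

section Centers

variable {K : Type u} [HenselianVF K] [L.Structure K]

variable (L K) in
/-- The sort `RV` as an auxiliary sort. -/
def rvSort : AuxSort L K :=
  ⟨1, ⊥, GoodSort.eq_def (L := L) (K := K) (X := Fin 1 → RV K)⟩

theorem rvSort_quot_injective {ξ η : RV K}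
    (h : (rvSort L K).quot (fun _ => ξ) = (rvSort L K).quot fun _ => η) : ξ = η :=
  congrFun (Quotient.exact h : (fun _ : Fin 1 => ξ) = fun _ => η) (0 : Fin 1)

/-- A set definable over elements of the field and one element of `RV` is a union of translates
of fibers of `rv` around finitely many centers definable over the same parameters. -/
theorem exists_finite_centers (hT : GeneralHypothesis T 0) (hK : K ⊨ T) (A₀ : Set K) (β : K) {m : ℕ}
    {a : Fin m → K} (ha : ∀ i, a i ∈ A₀) {D : K → (Fin m → K) → K → Prop}
    (hD : DP L (∅ : Set K) fun q : K × ((Fin m → K) × K) => D q.1 q.2.1 q.2.2)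
    (hinv : ∀ β', rv β' = rv β → ∀ x, D x a β' → D x a β) :
    ∃ (m' : ℕ) (a' : Fin m' → K) (C : K → (Fin m' → K) → RV K → Prop), (∀ i, a' i ∈ A₀) ∧
      (DP L (∅ : Set K) fun q : K × ((Fin m' → K) × RV K) => C q.1 q.2.1 q.2.2) ∧
      {t | C t a' (rv β)}.Finite ∧
      ∀ x, D x a β → ∃ c, C c a' (rv β) ∧ ∀ z, rv (z - c) = rv (x - c) → D z a β := by
  -- The parameter is passed as an element of an auxiliary sort, so that the centers depend on `β`
  -- only through `rv β`.
  let b : (rvSort L K).Carrier := (rvSort L K).quot fun _ => rv β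
  let A : Set (Param L K) := Sum.inl '' A₀ ∪ {Sum.inr ⟨rvSort L K, b⟩}
  have hA : DefinableOver A {x | D x a β} := by
    refine ⟨m, a, 1, fun _ => rvSort L K, fun _ => b, {q | ∃ β',
      (rvSort L K).quot (fun _ => rv β') = q.2.2 0 ∧ D q.1 q.2.1 β'}, fun i => ?_, fun j => ?_, ?_, ?_⟩
    · exact Or.inl ⟨_, ha i, rfl⟩
    · exact Or.inr rfl
    · rw [zeroDefinable_iff]
      refine DP.ex (.and (.eq ?_ (by fun_prop)) (hD.comp (g := fun q :
        (K × (Fin m → K) × (Fin 1 → (rvSort L K).Carrier)) × K => (q.1.1, q.1.2.1, q.2))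
        (by fun_prop)))
      exact (DF.auxQuot (rvSort L K)).comp (DF.pi fun _ => by fun_prop)
    · ext x
      constructor
      · exact fun h => ⟨β, rfl, h⟩
      · rintro ⟨β', h, h'⟩
        exact hinv β' (rvSort_quot_injective h) x h'
  obtain ⟨s, Q, c, ξ, -, hc, -, -, hU⟩ := (hT.bMinimal K hK).centers A _ hA
  have hfin : (Set.range c).Finite := by
    obtain ⟨m', a', r, s', b', W, -, -, h⟩ := hc
    exact finite_range_of_definableMap hT hK ⟨m', a', r, s', b', W, fun _ => trivial, fun _ => trivial, h⟩
  obtain ⟨m', a', r, s', b', W, ha', hb', hW, hgr⟩ := hc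
  have hs : ∀ j, s' j = rvSort L K ∧ HEq (b' j) b := fun j => by
    rcases hb' j with ⟨_, -, h⟩ | h
    · cases h
    · have := Sum.inr.inj h
      exact Sigma.mk.inj this
  obtain rfl : s' = fun _ => rvSort L K := funext fun j => (hs j).1
  obtain rfl : b' = fun _ => b := funext fun j => eq_of_heq (hs j).2
  have hgr' : ∀ q t, (∃ h : q ∈ Q, c ⟨q, h⟩ = t) ↔ ((q, t), a', fun _ => b) ∈ W := fun q t =>
    Set.ext_iff.mp hgr (q, t)
  refine ⟨m', a', fun t a' η => ∃ q, ((q, t), a', fun _ => (rvSort L K).quot fun _ => η) ∈ W,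
    fun i => ?_, ?_, hfin.subset ?_, fun x hx => ?_⟩
  · rcases ha' i with ⟨_, h, h'⟩ | h
    · exact Sum.inl.inj h' ▸ h
    · cases h
  · refine DP.ex (DP.comp (P := fun w => w ∈ W) hW (.prodMk (by fun_prop) (.prodMk (by fun_prop)
      (DF.pi fun _ => (DF.auxQuot (rvSort L K)).comp (DF.pi fun _ => by fun_prop)))))
  · rintro t ⟨q, hq⟩
    obtain ⟨h, rfl⟩ := (hgr' q t).mpr hq
    exact ⟨_, rfl⟩
  · have hx' : x ∈ ⋃ q, {x : K | rv (x - c q) = ξ q} := hU ▸ hx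
    obtain ⟨q, hq⟩ := Set.mem_iUnion.mp hx'
    refine ⟨c q, ⟨q, (hgr' _ _).mp ⟨q.2, rfl⟩⟩, fun z hz => ?_⟩
    have : z ∈ ⋃ q, {x : K | rv (x - c q) = ξ q} := Set.mem_iUnion.mpr ⟨q, hz.trans hq⟩
    rwa [hU] at this

/-- The realizations of a formula, as a definable predicate. -/
theorem dp_realize {m : ℕ} (φ : (expand L).Formula (Unit ⊕ ((Σ _ : Fin m, Unit) ⊕ Unit))) :
    DP L (∅ : Set K) fun q : K × ((Fin m → K) × K) => φ.Realize
      (Sum.elim (fun _ => q.1) (Sum.elim (fun i => q.2.1 i.1) fun _ => q.2.2)) := by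
  unfold DP
  rw [Set.empty_definable_iff]
  refine ⟨φ, ?_⟩
  ext y
  refine iff_of_eq (congrArg φ.Realize (funext fun j => ?_))
  rcases j with j | j | j <;> rfl

theorem exists_formula_triple {m : ℕ} {P : K → (Fin m → K) → K → Prop}
    (h : DP L (∅ : Set K) fun q : K × ((Fin m → K) × K) => P q.1 q.2.1 q.2.2) :
    ∃ φ : (expand L).Formula (Unit ⊕ ((Σ _ : Fin m, Unit) ⊕ Unit)), ∀ x a y, P x a y ↔
      φ.Realize (Sum.elim (fun _ => x) (Sum.elim (fun i => a i.1) fun _ => y)) := by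
  unfold DP at h
  rw [Set.empty_definable_iff] at h
  obtain ⟨φ, hφ⟩ := h
  exact ⟨φ, fun x a y => Set.ext_iff.mp hφ
    (Sum.elim (fun _ => x) (Sum.elim (fun i => a i.1) fun _ => y))⟩

end Centers

variable {K : Type u} [HenselianVF K] [L.Structure K]

theorem exists_params {P : K → K → Prop} (h : DP L (Set.univ : Set K) fun p : K × K => P p.1 p.2) :
    ∃ (m : ℕ) (a : Fin m → K) (φ : (expand L).Formula (Unit ⊕ ((Σ _ : Fin m, Unit) ⊕ Unit))),
      ∀ x y, P x y ↔
        φ.Realize (Sum.elim (fun _ => x) (Sum.elim (fun i => a i.1) fun _ => y)) := by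
  obtain ⟨m, a, φ, hφ⟩ := exists_formula_of_definable (α := Unit ⊕ Unit) h
  refine ⟨m, a, φ.relabel (Sum.elim (fun i => Sum.inr (Sum.inl ⟨i, ()⟩))
    (Sum.map id Sum.inr)), fun x y => ?_⟩
  rw [FirstOrder.Language.Formula.realize_relabel]
  refine (hφ (Sum.elim (fun _ => x) fun _ => y)).trans
    (iff_of_eq (congrArg φ.Realize (funext fun j => ?_)))
  rcases j with j | j | j <;> rfl

theorem realize_triple_mk {I : Type u} {U : Ultrafilter I} {m : ℕ}
    (φ : (expand L).Formula (Unit ⊕ ((Σ _ : Fin m, Unit) ⊕ Unit))) (x y : I → K) (a : Fin m → K) :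
    φ.Realize (Sum.elim (fun _ => UPow.mk U x) (Sum.elim (fun i => UPow.diag U (a i.1))
      fun _ => UPow.mk U y)) ↔
      ∀ᶠ i in U, φ.Realize (Sum.elim (fun _ => x i) (Sum.elim (fun j => a j.1) fun _ => y i)) := by
  rw [← Filter.eventually_congr (Filter.Eventually.of_forall fun i => iff_of_eq (congrArg φ.Realize
    (funext fun j => ?_))), ← UPow.realize_mk φ (Sum.elim (fun _ => x) (Sum.elim (fun j _ => a j.1)
      fun _ => y))]
  · refine iff_of_eq (congrArg φ.Realize (funext fun j => ?_))
    rcases j with j | j | j <;> rfl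
  · rcases j with j | j | j <;> rfl

/-- In an ultrapower, a finite set definable over the ground field and one element of `RV`
consists of elements of the ground field. -/
theorem exists_diag_of_finite (hT : GeneralHypothesis T 0) (hK : K ⊨ T) {I : Type u}
    {U : Ultrafilter I} {m : ℕ} (a : Fin m → K)
    {C : UPow U K → (Fin m → UPow U K) → RV (UPow U K) → Prop}
    (hC : DP L (∅ : Set (UPow U K)) fun q : UPow U K × ((Fin m → UPow U K) × RV (UPow U K)) =>
      C q.1 q.2.1 q.2.2) (β : UPow U K) (hfin : {t | C t (fun i => UPow.diag U (a i)) (rv β)}.Finite) :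
    ∀ t, C t (fun i => UPow.diag U (a i)) (rv β) → ∃ c : K, UPow.diag U c = t := by
  obtain ⟨β, rfl⟩ := UPow.mk_surjective U β
  obtain ⟨φ, hφ⟩ := exists_formula_triple (P := fun x a y => C x a (rv y))
    (hC.comp (g := fun q : UPow U K × ((Fin m → UPow U K) × UPow U K) => (q.1, q.2.1, rv q.2.2))
      (by fun_prop))
  let G : K → K → Prop := fun t β =>
    φ.Realize (Sum.elim (fun _ => t) (Sum.elim (fun i => a i.1) fun _ => β))
  have hG : DP L (Set.univ : Set K) fun q : K × K => G q.1 q.2 :=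
    (DP.of_empty (dp_realize φ)).comp (g := fun q : K × K => (q.1, a, q.2))
      (.prodMk (by fun_prop) (.prodMk (DF.const a) (by fun_prop)))
  have hCG : ∀ t β : I → K, C (UPow.mk U t) (fun i => UPow.diag U (a i)) (rv (UPow.mk U β)) ↔
      ∀ᶠ i in U, G (t i) (β i) := fun t β => (hφ _ _ _).trans (realize_triple_mk φ t β a)
  obtain ⟨N, τ, hτ⟩ : ∃ (N : ℕ) (τ : Fin N → I → K), ∀ t,
      C t (fun i => UPow.diag U (a i)) (rv (UPow.mk U β)) → ∃ j, UPow.mk U (τ j) = t := by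
    let e := hfin.toFinset.equivFin
    choose τ hτ using fun j => UPow.mk_surjective U (e.symm j : UPow U K)
    exact ⟨_, τ, fun t ht => ⟨e ⟨t, hfin.mem_toFinset.mpr ht⟩, by rw [hτ, Equiv.symm_apply_apply]⟩⟩
  -- A parameter is good if its fiber depends only on its leading term and has at most `N` elements.
  -- This is a definable condition, and `β i` satisfies it for almost every `i`.
  let good : K → Prop := fun β => (∀ β' t, rv β' = rv β → (G t β' ↔ G t β)) ∧
    ∃ τ : Fin N → K, ∀ t, G t β → ∃ j, τ j = t
  have hgood : DP L (Set.univ : Set K) good := by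
    refine .and (.all (.all (.imp (.eq (by fun_prop) (by fun_prop)) (.iff
      (hG.comp (g := fun q : (K × K) × K => (q.2, q.1.2)) (by fun_prop))
      (hG.comp (g := fun q : (K × K) × K => (q.2, q.1.1)) (by fun_prop))))))
      (.ex (.all (.imp (hG.comp (g := fun q : (K × (Fin N → K)) × K => (q.2, q.1.1)) (by fun_prop))
        (.ex_fin fun j => .eq (by fun_prop) (by fun_prop)))))
  have hβ : ∀ᶠ i in U, good (β i) := by
    refine Filter.Eventually.and ?_ ?_
    · by_contra h
      rw [← Ultrafilter.eventually_not] at h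
      push Not at h
      have hw : ∀ i, ∃ w : K × K, (∃ β' t, rv β' = rv (β i) ∧ ¬ (G t β' ↔ G t (β i))) →
          rv w.1 = rv (β i) ∧ ¬ (G w.2 w.1 ↔ G w.2 (β i)) := fun i => by
        by_cases h : ∃ β' t, rv β' = rv (β i) ∧ ¬ (G t β' ↔ G t (β i))
        · obtain ⟨β', t, h⟩ := h
          exact ⟨(β', t), fun _ => h⟩
        · exact ⟨0, fun h' => absurd h' h⟩
      choose w hw using hw
      have h' : ∀ᶠ i in U, rv (w i).1 = rv (β i) ∧ ¬ (G (w i).2 (w i).1 ↔ G (w i).2 (β i)) := by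
        filter_upwards [h] with i hi
        refine hw i ?_
        obtain ⟨β', t, h1, h2⟩ := hi
        refine ⟨β', t, h1, fun h3 => ?_⟩
        rcases h2 with h2 | h2
        · exact h2.2 (h3.mp h2.1)
        · exact h2.1 (h3.mpr h2.2)
      have h1 : rv (UPow.mk U fun i => (w i).1) = rv (UPow.mk U β) :=
        UPow.rv_eq_iff.mpr (h'.mono fun _ h => h.1)
      have h2 := hCG (fun i => (w i).2) fun i => (w i).1
      have h3 := hCG (fun i => (w i).2) β
      rw [h1, h3] at h2
      by_cases h4 : ∀ᶠ i in U, G (w i).2 (β i)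
      · obtain ⟨i, ⟨h5, h6⟩, h7⟩ := ((h4.and (h2.mp h4)).and h').exists
        exact h7.2 (iff_of_true h6 h5)
      · have h5 : ¬ ∀ᶠ i in U, G (w i).2 (w i).1 := fun h => h4 (h2.mpr h)
        rw [← Ultrafilter.eventually_not] at h4 h5
        obtain ⟨i, ⟨h5, h6⟩, h7⟩ := ((h4.and h5).and h').exists
        exact h7.2 (iff_of_false h6 h5)
    · have : ∀ᶠ i in U, ∀ t, G t (β i) → ∃ j, τ j i = t := by
        by_contra h
        rw [← Ultrafilter.eventually_not] at h
        push Not at h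
        let t : I → K := fun i => Classical.epsilon fun t => G t (β i) ∧ ∀ j, τ j i ≠ t
        have ht : ∀ᶠ i in U, G (t i) (β i) ∧ ∀ j, τ j i ≠ t i := h.mono fun i hi =>
          Classical.epsilon_spec hi
        obtain ⟨j, hj⟩ := hτ _ ((hCG t β).mpr (ht.mono fun _ h => h.1))
        obtain ⟨i, h1, h2⟩ := ((UPow.mk_eq.mp hj).and ht).exists
        exact h2.2 j h1
      exact this.mono fun i hi => ⟨fun j => τ j i, hi⟩
  -- Over good parameters the fibers form a uniformly finite family indexed by `RV` of the ground
  -- field, so their union is finite.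
  have hF : {t | ∃ η : RV K, ∃ β, rv β = η ∧ good β ∧ G t β}.Finite := by
    refine (finImage_rv hT K hK).finite_union (D := fun η t => ∃ β, rv β = η ∧ good β ∧ G t β)
      (N := N) ?_ fun η => ?_
    · refine .ex (.and (.eq (by fun_prop) (by fun_prop)) (.and (hgood.comp (by fun_prop))
        (hG.comp (g := fun q : (RV K × K) × K => (q.1.2, q.2)) (by fun_prop))))
    · by_cases h : ∃ β, rv β = η ∧ good β
      · obtain ⟨β, rfl, hβ⟩ := h
        obtain ⟨τ, hτ⟩ := hβ.2
        have : {t | ∃ β', rv β' = rv β ∧ good β' ∧ G t β'} ⊆ Set.range τ := by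
          rintro t ⟨β', h1, h2, h3⟩
          exact hτ t ((hβ.1 β' t h1).mp h3)
        refine (Set.encard_le_encard this).trans ?_
        rw [← Set.image_univ]
        refine (Set.encard_image_le _ _).trans ?_
        simp
      · have : {t | ∃ β', rv β' = η ∧ good β' ∧ G t β'} = ∅ := by
          refine Set.eq_empty_of_forall_notMem ?_
          rintro t ⟨β', h1, h2, -⟩
          exact h ⟨β', h1, h2⟩
        simp [this]
  intro t ht
  obtain ⟨t, rfl⟩ := UPow.mk_surjective U t
  -- A family with values in a finite set is constant along an ultrafilter, so its class is
  -- diagonal.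
  have h1 : ∀ᶠ i in U, ∃ c ∈ {t | ∃ η : RV K, ∃ β, rv β = η ∧ good β ∧ G t β}, c = t i := by
    filter_upwards [(hCG t β).mp ht, hβ] with i h1 h2
    exact ⟨t i, ⟨_, β i, rfl, h2, h1⟩, rfl⟩
  obtain ⟨c, -, hc⟩ := (Ultrafilter.eventually_exists_mem_iff hF).mp h1
  exact ⟨c, UPow.mk_eq.mpr hc⟩

/-- Definable families of nested balls have nonempty intersection. -/
theorem exists_mem_forall_ball (hT : GeneralHypothesis T 0) (hK : K ⊨ T) {D : K → K → Prop}
    (hD : DP L (Set.univ : Set K) fun p : K × K => D p.1 p.2) (hne : ∃ x β, D x β)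
    (hmono : ∀ β β' x x', D x β → D x' β' → val β ≤ val β' → D x β')
    (hinv : ∀ β β' x, D x β → val β = val β' → D x β')
    (hball : ∀ β x x', D x β → (D x' β ↔ val (x' - x) ≤ val β)) :
    ∃ x, ∀ β, (∃ x', D x' β) → D x β := by
  let I : Type u := {β : K // ∃ x, D x β}
  obtain ⟨x₁, β₁, h₁⟩ := hne
  -- Along this filter the radii eventually drop below each given radius of the family. The class
  -- `mk U b` of the radii thus defines, in the ultrapower, a ball contained in the extension of
  -- every ball of the family, and a point of `K` in it solves the problem.
  let F : Filter I := ⨅ γ : I, Filter.principal {i | val i.1 ≤ val γ.1}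
  have hdir : Directed (· ≥ ·) fun γ : I => Filter.principal {i : I | val i.1 ≤ val γ.1} := by
    intro γ γ'
    rcases le_total (val γ.1) (val γ'.1) with h | h
    · exact ⟨γ, le_rfl, Filter.principal_mono.mpr
        fun i (hi : val i.1 ≤ val γ.1) => show val i.1 ≤ val γ'.1 from hi.trans h⟩
    · exact ⟨γ', Filter.principal_mono.mpr
        fun i (hi : val i.1 ≤ val γ'.1) => show val i.1 ≤ val γ.1 from hi.trans h, le_rfl⟩
  have hF : F.NeBot := by
    have : Nonempty I := ⟨⟨β₁, x₁, h₁⟩⟩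
    refine Filter.iInf_neBot_of_directed' hdir fun γ => ?_
    rw [Filter.principal_neBot_iff]
    exact ⟨γ, show val γ.1 ≤ val γ.1 from le_rfl⟩
  let U : Ultrafilter I := Ultrafilter.of F
  have hU : ∀ γ : I, ∀ᶠ i : I in U, val i.1 ≤ val γ.1 := fun γ =>
    Ultrafilter.of_le F (Filter.mem_iInf_of_mem γ (Filter.mem_principal_self _))
  obtain ⟨m, a, ψ, hψ⟩ := exists_params hD
  let Ds : UPow U K → (Fin m → UPow U K) → UPow U K → Prop := fun x a β =>
    ψ.Realize (Sum.elim (fun _ => x) (Sum.elim (fun i => a i.1) fun _ => β))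
  let as : Fin m → UPow U K := fun i => UPow.diag U (a i)
  have hDs : ∀ x β : I → K, Ds (UPow.mk U x) as (UPow.mk U β) ↔ ∀ᶠ i in U, D (x i) (β i) :=
    fun x β => (realize_triple_mk ψ x β a).trans
      (Filter.eventually_congr (Filter.Eventually.of_forall fun i => (hψ _ _).symm))
  let b : I → K := fun i => i.1
  obtain ⟨m', a', C, ha', hC, hCfin, hcell⟩ := exists_finite_centers hT (UPow.models hK)
    (Set.range (UPow.diag U)) (UPow.mk U b) (a := as) (fun i => ⟨_, rfl⟩) (D := Ds)
    (dp_realize ψ) (by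
      intro β' h x hx
      obtain ⟨β', rfl⟩ := UPow.mk_surjective U β'
      obtain ⟨x, rfl⟩ := UPow.mk_surjective U x
      refine (hDs _ _).mpr ?_
      filter_upwards [UPow.rv_eq_iff.mp h, (hDs _ _).mp hx] with i h1 h2
      exact hinv _ _ _ h2 (val_eq_of_rv_eq h1))
  choose α hα using ha'
  obtain rfl : (fun i => UPow.diag U (α i)) = a' := funext hα
  choose x hx using fun i : I => i.2
  obtain ⟨c, hc, hz⟩ := hcell (UPow.mk U x) ((hDs x b).mpr (Filter.Eventually.of_forall hx))
  obtain ⟨c, rfl⟩ := exists_diag_of_finite hT hK α hC _ hCfin c hc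
  have key : ∀ z : K, Ds (UPow.diag U z) as (UPow.mk U b) → ∀ β, (∃ x', D x' β) → D z β := by
    intro z hz β hβ
    obtain ⟨i, h1, h2⟩ := (((hDs (fun _ => z) b).mp hz).and (hU ⟨β, hβ⟩)).exists
    obtain ⟨x', hx'⟩ := hβ
    exact hmono _ _ _ _ h1 hx' h2
  by_cases hcin : Ds (UPow.diag U c) as (UPow.mk U b)
  · exact ⟨c, key c hcin⟩
  -- If the center `c` of the cell is outside the small ball, it is already outside the ball of some
  -- radius `γ`. Seen from `c`, all points of that ball have the same leading term, so `x γ` lies in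
  -- the cell and hence in the small ball.
  · have h1 : ∀ᶠ i in U, ¬ D c (b i) :=
      Ultrafilter.eventually_not.mpr fun h => hcin ((hDs (fun _ => c) b).mpr h)
    obtain ⟨γ, hγ⟩ := h1.exists
    refine ⟨x γ, key _ (hz _ (UPow.rv_eq_iff.mpr ?_))⟩
    filter_upwards [hU γ] with i hi
    have h2 : D (x i) γ.1 := hmono _ _ _ _ (hx i) (hx γ) hi
    rw [rv_eq_iff]
    left
    rw [sub_sub_sub_cancel_right]
    have h3 : val (x γ - x i) ≤ val γ.1 := (hball _ _ _ h2).mp (hx γ)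
    have h4 : ¬ val (c - x γ) ≤ val γ.1 := fun h => hγ ((hball _ _ _ (hx γ)).mpr h)
    rw [val_sub_comm c] at h4
    exact h3.trans_lt (not_le.mp h4)

end SphericalCompleteness

/-! ### Zeros of maps that are close to the identity -/

section Surjectivity

variable {L : FirstOrder.Language.{u, u}} {T : (expand L).Theory}
  {K : Type u} [HenselianVF K] [L.Structure K] {d : ℕ}

/-- A definable self-map of a closed ball of `K ^ d` that is infinitesimally close to the identity
attains the value `0`. -/
theorem exists_eq_zero_of_risometry (hT : GeneralHypothesis T 0) (hK : K ⊨ T)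
    {g : (Fin d → K) → Fin d → K} (hg : DF L (Set.univ : Set K) g) {c : K}
    (hmap : ∀ u, valn u ≤ val c → valn (g u) ≤ val c)
    (hris : ∀ u u', valn u ≤ val c → valn u' ≤ val c → u ≠ u' →
      valn (g u - g u' - (u - u')) < valn (u - u')) :
    ∃ u, valn u ≤ val c ∧ g u = 0 := by
  -- Preimages of closed balls around `0`. As `g` preserves distances, for radii at most that of `c`
  -- each is empty or a closed ball of the same radius (`hsub`, `hadd`). Spherical completeness,
  -- applied to each coordinate projection, gives a point `y` common to the nonempty ones.
  let B : K → (Fin d → K) → Prop := fun β u => valn u ≤ val c ∧ valn (g u) ≤ val β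
  have hsub : ∀ β u u', B β u → B β u' → valn (u - u') ≤ val β := by
    intro β u u' h h'
    rcases eq_or_ne u u' with rfl | hne
    · simp
    have h1 := hris u u' h.1 h'.1 hne
    rw [valn_sub_comm] at h1
    rw [← valn_eq_of_sub_lt h1]
    exact (valn_sub_le _ _).trans (max_le h.2 h'.2)
  have hadd : ∀ β u u', val β ≤ val c → B β u → valn (u - u') ≤ val β → B β u' := by
    intro β u u' hβ h h'
    have h0 : valn u' ≤ val c := by
      have := valn_sub_le u (u - u')
      rw [sub_sub_cancel] at this
      exact this.trans (max_le h.1 (h'.trans hβ))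
    refine ⟨h0, ?_⟩
    rcases eq_or_ne u u' with rfl | hne
    · exact h.2
    have h1 := hris u u' h.1 h0 hne
    rw [valn_sub_comm] at h1
    have h2 := valn_eq_of_sub_lt h1
    have h3 := valn_sub_le (g u) (g u - g u')
    rw [sub_sub_cancel, h2] at h3
    exact h3.trans (max_le h.2 h')
  have hc : B c 0 := ⟨by simp, hmap 0 (by simp)⟩
  have hex : ∀ i, ∃ x, ∀ β, (∃ x', val β ≤ val c ∧ ∃ u, B β u ∧ u i = x') →
      val β ≤ val c ∧ ∃ u, B β u ∧ u i = x := by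
    intro i
    refine exists_mem_forall_ball hT hK (D := fun x β => val β ≤ val c ∧ ∃ u, B β u ∧ u i = x)
      (.and (.val_le (by fun_prop) (DF.const c)) (.ex (.and (.and
        (.valn_le_val (by fun_prop) (DF.const c)) (.valn_le_val (by fun_prop) (by fun_prop)))
        (.eq (by fun_prop) (by fun_prop))))) ⟨_, c, le_rfl, 0, hc, rfl⟩ ?_ ?_ ?_
    · rintro β β' _ _ ⟨-, u, hu, rfl⟩ ⟨h', -⟩ hle
      exact ⟨h', u, ⟨hu.1, hu.2.trans hle⟩, rfl⟩
    · rintro β β' _ ⟨h, u, hu, rfl⟩ hββ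
      exact ⟨hββ ▸ h, u, ⟨hu.1, hββ ▸ hu.2⟩, rfl⟩
    · rintro β _ x' ⟨h, u, hu, rfl⟩
      constructor
      · rintro ⟨-, u', hu', rfl⟩
        exact (val_le_valn (u' - u) i).trans (hsub β u' u hu' hu)
      · intro hx'
        refine ⟨h, Function.update u i x', hadd β u _ h hu ?_, by simp⟩
        refine valn_le_iff.mpr fun j => ?_
        rcases eq_or_ne j i with rfl | hj
        · simpa [val_sub_comm] using hx'
        · simp [hj]
  choose y hy using hex
  have hyB : ∀ β u, val β ≤ val c → B β u → B β y := by
    intro β u hβ hu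
    refine hadd β u y hβ hu (valn_le_iff.mpr fun i => ?_)
    obtain ⟨-, u', hu', hi⟩ := hy i β ⟨u i, hβ, u, hu, rfl⟩
    rw [Pi.sub_apply, ← hi]
    exact (val_le_valn (u - u') i).trans (hsub β u u' hu hu')
  have hyc := hyB c 0 le_rfl hc
  refine ⟨y, hyc.1, ?_⟩
  -- One Newton step: replacing `y` by `y - g y` makes `g` strictly smaller. But `y` belongs to
  -- every nonempty `B β` with `val β ≤ val c`, so the value of `g` at `y` is already minimal.
  by_contra hne
  have h1 : valn (y - g y) ≤ val c := (valn_sub_le _ _).trans (max_le hyc.1 hyc.2)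
  have h2 : valn (g (y - g y)) < valn (g y) := by
    have := hris y (y - g y) hyc.1 h1 (fun h => hne (by rw [eq_comm, sub_eq_self] at h; exact h))
    rw [sub_sub_cancel, sub_sub, add_comm, ← sub_sub, sub_self, zero_sub, valn_neg] at this
    exact this
  obtain ⟨β, hβ⟩ := val_surjective (valn (g (y - g y)))
  have h3 := hyB β (y - g y) (hβ.le.trans (h2.le.trans hyc.2)) ⟨h1, hβ.ge⟩
  exact absurd (h3.2.trans hβ.le) (not_le.mpr h2)

theorem DF.linearMap {m : ℕ} (f : (Fin d → K) →ₗ[K] (Fin m → K)) : DF L (Set.univ : Set K) f := by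
  refine DF.pi fun i => ?_
  have : (fun u : Fin d → K => f u i) = fun u => ∑ j, u j * f (fun k => if j = k then 1 else 0) i := by
    funext u
    rw [LinearMap.pi_apply_eq_sum_univ f u]
    simp
  rw [this]
  exact DF.sum _ fun j => .mul (by fun_prop) (DF.const _)

end Surjectivity

/-! ### Linear sections of lifts of residual subspaces -/

section Lift

variable {K : Type u} [HenselianVF K] {n : ℕ}

/-- A subspace of dimension `d` of `k ^ n` projects isomorphically to some coordinate subspace. -/
theorem exists_coordinates {k : Type*} [Field k] (V : Submodule k (Fin n → k)) {d : ℕ}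
    (hd : Module.finrank k V = d) :
    ∃ (e : Fin d → Fin n) (b : Fin d → Fin n → k), (∀ j, b j ∈ V) ∧
      (Matrix.of fun i j => b i (e j)).det ≠ 0 := by
  let B := Module.finBasisOfFinrankEq k V hd
  let b : Fin d → Fin n → k := fun j => B j
  have hb : LinearIndependent k b := B.linearIndependent.map' V.subtype V.ker_subtype
  let M : Matrix (Fin d) (Fin n) k := Matrix.of b
  have hrank : Module.finrank k (Submodule.span k (Set.range M.col)) = d := by
    rw [← Matrix.rank_eq_finrank_span_cols, LinearIndependent.rank_matrix (M := M) hb,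
      Fintype.card_fin]
  have hf := Submodule.exists_fun_fin_finrank_span_eq k (Set.range M.col)
  rw [hrank] at hf
  obtain ⟨f, hf, -, hli⟩ := hf
  choose e he using hf
  refine ⟨e, b, fun j => (B j).2, ?_⟩
  have hcol : (Matrix.of fun i j => b i (e j)).col = f := funext fun j => he j
  have h1 := Matrix.linearIndependent_cols_iff_isUnit.mp (hcol ▸ hli)
  exact ((Matrix.isUnit_iff_isUnit_det _).mp h1).ne_zero

/-- A lift of a `d`-dimensional subspace contains the graph of a linear map on some
`d`-dimensional coordinate subspace that does not increase the valuation. -/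
theorem IsLift.exists_section {W : Submodule K (Fin n → K)} {V : Submodule (Res K) (Fin n → Res K)}
    (h : IsLift W V) {d : ℕ} (hd : Module.finrank (Res K) V = d) :
    ∃ (e : Fin d → Fin n) (l : (Fin d → K) →ₗ[K] (Fin n → K)), Function.Injective e ∧
      (∀ u, l u ∈ W) ∧ (∀ u, l u ∘ e = u) ∧ ∀ u, valn (l u) ≤ valn u := by
  classical
  obtain ⟨e, b, hb, hdet⟩ := exists_coordinates V hd
  have hw : ∀ j, ∃ x : Fin n → O K, (fun i => (x i : K)) ∈ W ∧
      b j = fun i => IsLocalRing.residue (O K) (x i) := fun j => by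
    have : b j ∈ (V : Set (Fin n → Res K)) := hb j
    rw [h] at this
    exact this
  choose w hwW hwb using hw
  let N : Matrix (Fin d) (Fin d) (O K) := Matrix.of fun i j => w i (e j)
  have hN : IsUnit N.det := by
    have : IsLocalRing.residue (O K) N.det ≠ 0 := by
      rw [RingHom.map_det]
      convert hdet using 1
      congr 1
      ext i j
      simp [N, hwb]
    rw [ne_eq, IsLocalRing.residue_eq_zero_iff, IsLocalRing.mem_maximalIdeal, mem_nonunits_iff,
      not_not] at this
    exact this
  -- The minor `N` is invertible over the valuation ring because its reduction is nonsingular.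
  -- Normalizing by its inverse gives the identity on the chosen coordinates and keeps all entries
  -- integral, which bounds the section.
  let M : Matrix (Fin d) (Fin d) K := (N⁻¹).map (algebraMap (O K) K)
  let P : Matrix (Fin d) (Fin n) K := Matrix.of fun j i => (w j i : K)
  have hMP : ∀ i j, (M * P) i (e j) = if i = j then 1 else 0 := by
    intro i j
    have h1 : N⁻¹ * N = 1 := Matrix.nonsing_inv_mul _ hN
    have h2 := congrFun (congrFun h1 i) j
    rw [Matrix.mul_apply] at h2 ⊢
    have h3 := congrArg (algebraMap (O K) K) h2
    rw [map_sum] at h3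
    simp only [map_mul, Matrix.one_apply] at h3
    rw [apply_ite (algebraMap (O K) K), map_one, map_zero] at h3
    exact h3
  have hl : ∀ u, ((M * P).vecMulLinear u) ∘ e = u := fun u => by
    funext j
    simp [Matrix.vecMul, dotProduct, hMP]
  refine ⟨e, (M * P).vecMulLinear, fun i j hij => ?_, fun u => ?_, hl, fun u => ?_⟩
  · by_contra hne
    have h1 := congrFun (hl (Pi.single i 1)) i
    have h2 := congrFun (hl (Pi.single i 1)) j
    simp only [Function.comp_apply, hij] at h1
    rw [Function.comp_apply, h1] at h2
    simp [Ne.symm hne] at h2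
  · have : (M * P).vecMulLinear u = ∑ j, (Matrix.vecMul u M) j • fun i => (w j i : K) := by
      rw [Matrix.vecMulLinear_apply, ← Matrix.vecMul_vecMul, Matrix.vecMul_eq_sum]
      rfl
    rw [this]
    exact W.sum_mem fun j _ => W.smul_mem _ (hwW j)
  · have hint : ∀ i j, val ((M * P) i j) ≤ 1 := fun i j => by
      rw [val_le_one_iff, Matrix.mul_apply]
      exact sum_mem fun k _ => mul_mem (N⁻¹ i k).2 (w k j).2
    refine valn_le_iff.mpr fun i => ?_
    rw [Matrix.vecMulLinear_apply, Matrix.vecMul, dotProduct]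
    refine Valuation.map_sum_le _ fun j _ => ?_
    change val (u j * (M * P) j i) ≤ _
    rw [val_mul]
    exact (mul_le_of_le_one_right' (hint j i)).trans (val_le_valn u j)

end Lift

/-! ### Definable risometries and straightened translations -/

section Risometries

variable {L : FirstOrder.Language.{u, u}} {T : (expand L).Theory}
  {K : Type u} [HenselianVF K] [L.Structure K] {n : ℕ} {B B₀ : Set (Fin n → K)}

theorem perm_apply_inv {α : Type*} (F : Equiv.Perm α) (x : α) : F (F⁻¹ x) = x := F.apply_symm_apply x

theorem perm_inv_apply {α : Type*} (F : Equiv.Perm α) (x : α) : F⁻¹ (F x) = x := F.symm_apply_apply x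

/-- By the ultrametric inequality, a point no farther from `x` than `x'` is lies in every ball
containing both. No radius is mentioned, so open balls, closed balls and the whole space can be
treated alike afterwards. -/
theorem IsBall.sub_lt_sub (hB : IsBall B) {x x' y : Fin n → K} (hx : x ∈ B) (hx' : x' ∈ B)
    (hy : y ∉ B) : valn (x - x') < valn (x - y) := by
  by_contra hlt
  rw [not_lt] at hlt
  apply hy
  have key : ∀ a : Fin n → K, valn (y - a) ≤ max (valn (x - a)) (valn (x' - a)) := fun a => by
    have h1 := valn_sub_le (x - a) (x - y)
    rw [sub_sub_sub_cancel_left] at h1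
    have h2 := valn_sub_le (x - a) (x' - a)
    rw [sub_sub_sub_cancel_right] at h2
    exact h1.trans (max_le (le_max_left _ _) (hlt.trans h2))
  rcases hB with (rfl | ⟨a, δ, -, rfl⟩) | ⟨a, δ, -, rfl⟩
  · trivial
  · exact (key a).trans_lt (max_lt hx hx')
  · exact (key a).trans (max_le hx hx')

theorem IsBall.add_sub_mem (hB : IsBall B) {x a a' : Fin n → K} (hx : x ∈ B) (ha : a ∈ B)
    (ha' : a' ∈ B) : x + (a - a') ∈ B := by
  by_contra hy
  have h1 := hB.sub_lt_sub hx ha hy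
  have h2 := hB.sub_lt_sub hx ha' hy
  have h3 := valn_sub_le (x - a') (x - a)
  rw [sub_sub_sub_cancel_left] at h3
  rw [sub_add_cancel_left, valn_neg] at h1 h2
  exact absurd h3 (not_le.mpr (max_lt h2 h1))

theorem IsBall.dp (hB : IsBall B) : DP L (Set.univ : Set K) fun x => x ∈ B := by
  rcases hB with (rfl | ⟨a, δ, -, rfl⟩) | ⟨a, δ, -, rfl⟩
  · exact DP.const True
  all_goals obtain ⟨r, rfl⟩ := val_surjective δ
  · exact .valn_lt_val (.sub_pi (by fun_prop) (DF.const a)) (DF.const r)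
  · exact .valn_le_val (.sub_pi (by fun_prop) (DF.const a)) (DF.const r)

variable (L) in
/-- Definable risometries of the whole space. -/
structure DefRiso (F : Equiv.Perm (Fin n → K)) : Prop where
  df : DF L (Set.univ : Set K) F
  rvn_sub : ∀ x x', rvn (F x - F x') = rvn (x - x')

namespace DefRiso

variable {F G : Equiv.Perm (Fin n → K)}

theorem mul (hF : DefRiso L F) (hG : DefRiso L G) : DefRiso L (F * G) :=
  ⟨hF.df.comp hG.df, fun _ _ => (hF.rvn_sub _ _).trans (hG.rvn_sub _ _)⟩

theorem inv (hF : DefRiso L F) : DefRiso L F⁻¹ := by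
  refine ⟨?_, fun x x' => ?_⟩
  · refine (DP.eq (hF.df.comp (g := fun p : (Fin n → K) × (Fin n → K) => p.2) (by fun_prop))
      (g := fun p => p.1) (by fun_prop)).congr fun p => ?_
    rw [Equiv.Perm.inv_eq_iff_eq, eq_comm]
  · rw [← hF.rvn_sub]
    simp

theorem valn_sub (hF : DefRiso L F) (x x' : Fin n → K) : valn (F x - F x') = valn (x - x') :=
  valn_eq_of_rvn_eq (hF.rvn_sub x x')

theorem sub_lt (hF : DefRiso L F) {x x' : Fin n → K} (h : x ≠ x') :
    valn (F x - F x' - (x - x')) < valn (x - x') := by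
  rw [valn_sub_comm]
  exact valn_sub_lt_of_rvn_eq (hF.rvn_sub x x').symm (sub_ne_zero.mpr h)

end DefRiso

/-- A definable risometry of a ball extends by the identity to the whole space. -/
theorem exists_defRiso_extension (hB : IsBall B) {f : (Fin n → K) → Fin n → K}
    (hf : DP L (Set.univ : Set K) fun p : (Fin n → K) × (Fin n → K) => p.1 ∈ B ∧ f p.1 = p.2)
    (hbij : Set.BijOn f B B)
    (hris : ∀ x ∈ B, ∀ x' ∈ B, rvn (f x - f x') = rvn (x - x')) :
    ∃ F : Equiv.Perm (Fin n → K), DefRiso L F ∧ (∀ x, F x ∈ B ↔ x ∈ B) ∧ (∀ x ∈ B, F x = f x) ∧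
      ∀ x ∉ B, F x = x := by
  classical
  let F : Equiv.Perm (Fin n → K) := Equiv.Perm.ofSubtype (p := (· ∈ B)) hbij.equiv
  have h1 : ∀ x ∈ B, F x = f x := fun x hx => Equiv.Perm.ofSubtype_apply_of_mem _ hx
  have h2 : ∀ x ∉ B, F x = x := fun x hx => Equiv.Perm.ofSubtype_apply_of_not_mem _ hx
  have h3 : ∀ x, F x ∈ B ↔ x ∈ B := fun x => by
    by_cases hx : x ∈ B
    · rw [h1 x hx]
      exact iff_of_true (hbij.mapsTo hx) hx
    · rw [h2 x hx]
  -- Moving a point within `B` changes it by less than its distance to any outside point, so gluing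
  -- with the identity preserves these leading terms.
  have hmixed : ∀ x ∈ B, ∀ x' ∉ B, rvn (F x - F x') = rvn (x - x') := fun x hx x' hx' => by
    rw [h2 x' hx', eq_comm]
    refine rvn_eq_of_sub_lt ?_
    rw [sub_sub_sub_cancel_right]
    exact hB.sub_lt_sub hx ((h3 x).mpr hx) hx'
  have hneg : ∀ x y x' y' : Fin n → K, rvn (x - y) = rvn (x' - y') → rvn (y - x) = rvn (y' - x') := by
    intro x y x' y' h
    rw [rvn_eq_iff] at h ⊢
    refine h.imp (fun h => ?_) fun h => ⟨?_, ?_⟩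
    · rwa [← neg_sub x y, ← neg_sub x' y', neg_sub_neg, valn_sub_comm, valn_neg]
    · rw [← neg_sub, h.1, neg_zero]
    · rw [← neg_sub, h.2, neg_zero]
  refine ⟨F, ⟨?_, fun x x' => ?_⟩, h3, h1, h2⟩
  · refine (hf.or (.and (hB.dp.fst.not) (.eq (f := fun p : (Fin n → K) × (Fin n → K) => p.1)
      (g := fun p => p.2) (by fun_prop) (by fun_prop)))).congr fun p => ?_
    by_cases hp : p.1 ∈ B
    · simp [h1 _ hp, hp]
    · simp [h2 _ hp, hp]
  · by_cases hx : x ∈ B <;> by_cases hx' : x' ∈ B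
    · rw [h1 x hx, h1 x' hx', hris x hx x' hx']
    · exact hmixed x hx x' hx'
    · exact hneg _ _ _ _ (hmixed x' hx' x hx)
    · rw [h2 x hx, h2 x' hx']

/-- Straightening maps become permutations of the whole space, so they can be composed, inverted and
conjugated in a group. -/
theorem IsDTranslatable.exists_defRiso {C : Type*} (hB : IsBall B) {χ : B → C} {d : ℕ}
    (h : IsDTranslatable L χ d) :
    ∃ (V : Submodule (Res K) (Fin n → Res K)) (W : Submodule K (Fin n → K))
      (F : Equiv.Perm (Fin n → K)) (hF : ∀ x, F x ∈ B ↔ x ∈ B),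
      Module.finrank (Res K) V = d ∧ IsLift W V ∧ DefRiso L F ∧
      ∀ x x' : B, (x : Fin n → K) - x' ∈ W →
        χ ⟨F x, (hF x).mpr x.2⟩ = χ ⟨F x', (hF x').mpr x'.2⟩ := by
  classical
  obtain ⟨V, hV, W, φ, hW, hφ, hris, hcol⟩ := h
  let f : (Fin n → K) → Fin n → K := fun x => if h : x ∈ B then φ ⟨x, h⟩ else x
  have hf : ∀ x : B, f x = φ x := fun x => dif_pos x.2
  obtain ⟨F, hF, hFB, hFf, -⟩ := exists_defRiso_extension (L := L) hB (f := f)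
    ((definableMap_iff.mp hφ).congr fun p => by
      constructor
      · rintro ⟨h, h'⟩
        exact ⟨h, (hf ⟨p.1, h⟩).symm.trans h'⟩
      · rintro ⟨h, h'⟩
        exact ⟨h, (hf ⟨p.1, h⟩).trans h'⟩) ⟨fun x hx => by
      rw [hf ⟨x, hx⟩]; exact (φ _).2, fun x hx x' hx' h => by
      rw [hf ⟨x, hx⟩, hf ⟨x', hx'⟩] at h
      exact congrArg Subtype.val (hris.1.1 (Subtype.ext h)), fun y hy => by
      obtain ⟨x, hx⟩ := hris.1.2 ⟨y, hy⟩
      exact ⟨x, x.2, by rw [hf, hx]⟩⟩ fun x hx x' hx' => by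
      rw [hf ⟨x, hx⟩, hf ⟨x', hx'⟩]
      exact hris.2 ⟨x, hx⟩ ⟨x', hx'⟩
  have hFφ : ∀ x : B, (⟨F x, (hFB x).mpr x.2⟩ : B) = φ x := fun x =>
    Subtype.ext ((hFf x x.2).trans (hf x))
  refine ⟨V, W, F, hFB, hV, hW, hF, fun x x' h => ?_⟩
  rw [hFφ, hFφ]
  exact hcol x x' h

variable {S : Fin (n + 1) → Set (Fin n → K)}

/-- Conjugates of translations along the direction of translatability of a ball, extended by the
identity, respect the stratification. -/
theorem exists_defRiso_translation (hB : IsBall B) {W : Submodule K (Fin n → K)}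
    {F : Equiv.Perm (Fin n → K)} (hF : DefRiso L F) (hFB : ∀ x, F x ∈ B ↔ x ∈ B)
    (hcol : ∀ x ∈ B, ∀ x' ∈ B, x - x' ∈ W → ∀ i, F x ∈ S i ↔ F x' ∈ S i)
    {a a' : Fin n → K} (ha : a ∈ B) (ha' : a' ∈ B) (haW : a - a' ∈ W) :
    ∃ G : Equiv.Perm (Fin n → K), DefRiso L G ∧ G (F a') = F a ∧ (∀ x, G x ∈ B ↔ x ∈ B) ∧
      (∀ x ∉ B, G x = x) ∧ ∀ x i, G x ∈ S i ↔ x ∈ S i := by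
  have hadd := fun x (hx : x ∈ B) => hB.add_sub_mem hx ha ha'
  have hsub : ∀ x ∈ B, x - (a - a') ∈ B := fun x hx => by
    have := hB.add_sub_mem hx ha' ha
    rwa [← neg_sub a a', ← sub_eq_add_neg] at this
  -- `τ` translates `B` by `a - a'`, an element of `W`, and is the identity elsewhere. Its conjugate
  -- by `F` preserves the strata because on `B` they become `W`-invariant after straightening.
  obtain ⟨τ, hτ, hτB, hτx, hτid⟩ := exists_defRiso_extension (L := L) hB
    (f := fun x => x + (a - a')) (.and hB.dp.fst (.eq (.add_pi (by fun_prop) (DF.const _))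
      (by fun_prop))) ⟨hadd, fun x _ x' _ h => add_right_cancel h, fun y hy =>
        ⟨y - (a - a'), hsub y hy, sub_add_cancel _ _⟩⟩ fun x _ x' _ => by
      rw [add_sub_add_right_eq_sub]
  have hFB' : ∀ x, F⁻¹ x ∈ B ↔ x ∈ B := fun x => by rw [← hFB, perm_apply_inv]
  have hid : ∀ x ∉ B, (F * τ * F⁻¹) x = x := fun x hx => by
    simp only [Equiv.Perm.mul_apply]
    rw [hτid _ (fun h => hx ((hFB' x).mp h)), perm_apply_inv]
  refine ⟨F * τ * F⁻¹, (hF.mul hτ).mul hF.inv, ?_, fun x => ?_, hid, fun x i => ?_⟩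
  · simp only [Equiv.Perm.mul_apply, perm_inv_apply]
    rw [hτx _ ha', add_sub_cancel]
  · simp only [Equiv.Perm.mul_apply, hFB, hτB, hFB']
  · by_cases hx : x ∈ B
    · have hx' := (hFB' x).mpr hx
      have := hcol (τ (F⁻¹ x)) ((hτB _).mpr hx') (F⁻¹ x) hx' (by
        rw [hτx _ hx', add_sub_cancel_left]; exact haW) i
      rw [perm_apply_inv] at this
      exact this
    · rw [hid x hx]

/-- A definable risometry of the whole space fixing `B₀` setwise restricts to `B₀`. -/
theorem DefRiso.restrict (hB₀ : IsBall B₀) {G : Equiv.Perm (Fin n → K)} (hG : DefRiso L G)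
    (hGB : ∀ x, G x ∈ B₀ ↔ x ∈ B₀) :
    DefinableMap (K := K) L (fun x : B₀ => G x) ∧
      IsRisometry (fun x : B₀ => (⟨G x, (hGB x).mpr x.2⟩ : B₀)) := by
  refine ⟨definableMap_iff.mpr ((hB₀.dp.fst.and hG.df).congr fun p => ?_), ⟨fun x x' h => ?_,
    fun y => ?_⟩, fun x x' => hG.rvn_sub x x'⟩
  · simp
  · exact Subtype.ext (G.injective (congrArg Subtype.val h))
  · exact ⟨⟨G⁻¹ y, by rw [← hGB, perm_apply_inv]; exact y.2⟩,
      Subtype.ext (perm_apply_inv _ _)⟩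

/-- A point `s` of a stratum seen from `x` corresponds to `φ s` seen from `φ x`, with the same
leading term; surjectivity of `φ` gives the other inclusion. -/
theorem rainbow_risometry {φ : B₀ → B₀} (hφ : IsRisometry φ) (hS : ∀ i, S i ⊆ B₀)
    (hresp : ∀ x i, (φ x : Fin n → K) ∈ S i ↔ (x : Fin n → K) ∈ S i) (x : B₀) :
    rainbow S (φ x) = rainbow S x := by
  funext i
  ext ξ
  constructor
  · rintro ⟨s, hs, rfl⟩
    obtain ⟨s', hs'⟩ := hφ.1.2 ⟨s, hS i hs⟩
    have hs'' : (φ s' : Fin n → K) = s := congrArg Subtype.val hs'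
    refine ⟨s', (hresp s' i).mp (hs''.symm ▸ hs), ?_⟩
    change rvn ((x : Fin n → K) - (s' : Fin n → K)) = rvn ((φ x : Fin n → K) - s)
    rw [← hs'', hφ.2]
  · rintro ⟨s, hs, rfl⟩
    exact ⟨φ ⟨s, hS i hs⟩, (hresp ⟨s, hS i hs⟩ i).mpr hs, hφ.2 x ⟨s, hS i hs⟩⟩

end Risometries

/-! ### Reflection, rainbows and risometries: the implications -/

section Reflection

variable {L : FirstOrder.Language.{u, u}} {T : (expand L).Theory}
  {K : Type u} [HenselianVF K] [L.Structure K] {n : ℕ} {B₀ : Set (Fin n → K)}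
  {S : Fin (n + 1) → Set (Fin n → K)}

theorem valn_comp_le {d : ℕ} (x : Fin n → K) (e : Fin d → Fin n) : valn (x ∘ e) ≤ valn x :=
  valn_le_iff.mpr fun i => val_le_valn x (e i)

theorem IsTStratification.subset (hS : IsTStratification L S B₀) (i : Fin (n + 1)) : S i ⊆ B₀ :=
  hS.iUnion_eq ▸ Set.subset_iUnion S i

theorem IsTStratification.upper_subset (hS : IsTStratification L S B₀) (d : Fin (n + 1)) :
    upper S d ⊆ B₀ := Set.iUnion₂_subset fun i _ => hS.subset i

theorem IsTStratification.upper_zero (hS : IsTStratification L S B₀) : upper S 0 = B₀ := by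
  rw [← hS.iUnion_eq]
  simp [upper]

/-- Points outside `S d` that lie in the `d`-th upper set lie in the next one. -/
theorem mem_upper_succ {d : Fin (n + 1)} {x : Fin n → K} (hx : x ∈ upper S d) (hxd : x ∉ S d) :
    ∃ h : (d : ℕ) + 1 < n + 1, x ∈ upper S ⟨d + 1, h⟩ := by
  simp only [upper, Set.mem_iUnion] at hx ⊢
  obtain ⟨i, hi, hxi⟩ := hx
  have hlt : d < i := lt_of_le_of_ne hi fun h => hxd (h ▸ hxi)
  exact ⟨by have := i.2; have : (d : ℕ) < i := hlt; omega, i, hlt, hxi⟩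

theorem IsBall.closedBall_subset {B : Set (Fin n → K)} (hB : IsBall B) {x x' : Fin n → K}
    (hx : x ∈ B) (hx' : x' ∈ B) : {y | valn (y - x) ≤ valn (x - x')} ⊆ B := by
  intro y hy
  by_contra h
  have := hB.sub_lt_sub hx hx' h
  rw [valn_sub_comm x y] at this
  exact absurd hy (not_le.mpr this)

theorem isBall_closedBall (x : Fin n → K) {δ : Val K} (hδ : δ ≠ 0) :
    IsBall {y | valn (y - x) ≤ δ} := Or.inr ⟨x, δ, hδ, rfl⟩

theorem rainbow_eq_of_defRiso (hB₀ : IsBall B₀) (hS : IsTStratification L S B₀)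
    {G : Equiv.Perm (Fin n → K)} (hG : DefRiso L G) (hGB : ∀ x, G x ∈ B₀ ↔ x ∈ B₀)
    (hGS : ∀ x i, G x ∈ S i ↔ x ∈ S i) (x : B₀) :
    rainbow S (⟨G x, (hGB x).mpr x.2⟩ : B₀) = rainbow S x :=
  rainbow_risometry (φ := fun x : B₀ => (⟨G x, (hGB x).mpr x.2⟩ : B₀))
    (hG.restrict hB₀ hGB).2 hS.subset (fun x i => hGS x i) x

/-- Points of equal rainbow see a point of a stratum in the same direction. -/
theorem exists_translate_of_rainbow_eq {x x' : B₀} (hrain : rainbow S x = rainbow S x')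
    (hne : x.1 ≠ x'.1) {i : Fin (n + 1)} {z : Fin n → K} (hzS : z ∈ S i)
    (hz : valn (z - x.1) ≤ valn (x.1 - x'.1)) :
    ∃ z', (z' ∈ S i ∧ valn (z' - x.1) ≤ valn (x.1 - x'.1)) ∧
      valn (z - z' - (x.1 - x'.1)) < valn (x.1 - x'.1) := by
  have h1 : rvn (x.1 - z) ∈ rainbow S x i := ⟨z, hzS, rfl⟩
  rw [hrain] at h1
  obtain ⟨z', hz'S, h2⟩ := h1
  change rvn (x'.1 - z') = rvn (x.1 - z) at h2
  have h3 : valn (z - z' - (x.1 - x'.1)) < valn (x.1 - x'.1) := by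
    have h4 : z - z' - (x.1 - x'.1) = x'.1 - z' - (x.1 - z) := by abel
    rw [h4]
    rcases rvn_eq_iff.mp h2 with h | ⟨h, h'⟩
    · refine h.trans_le ?_
      rw [valn_eq_of_rvn_eq h2, valn_sub_comm]
      exact hz
    · rw [h, h', sub_zero, valn_zero]
      exact valn_pos.mpr (sub_ne_zero.mpr hne)
  refine ⟨z', ⟨hz'S, ?_⟩, h3⟩
  have h5 : z' - x.1 = (z - x.1) - (x.1 - x'.1) - (z - z' - (x.1 - x'.1)) := by abel
  rw [h5]
  exact (valn_sub_le _ _).trans (max_le ((valn_sub_le _ _).trans (max_le hz le_rfl)) h3.le)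

/-- Iterated translation by `v`, up to an error of smaller size. -/
theorem exists_translate_sequence {P : (Fin n → K) → Prop} {v : Fin n → K} (hv : v ≠ 0)
    (hP : ∀ z, P z → ∃ z', P z' ∧ valn (z - z' - v) < valn v) (h0 : ∃ z, P z) :
    ∃ z : ℕ → Fin n → K, (∀ m, P (z m)) ∧
      ∀ m k : ℕ, valn (z m - z (m + k) - (k : K) • v) < valn v := by
  obtain ⟨z₀, hz₀⟩ := h0
  choose! next hnext using hP
  let z : ℕ → Fin n → K := fun m => next^[m] z₀
  have hz : ∀ m, P (z m) := fun m => by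
    induction m with
    | zero => exact hz₀
    | succ m ih =>
      simp only [z, Function.iterate_succ_apply']
      exact (hnext _ ih).1
  have hs : ∀ m, valn (z m - z (m + 1) - v) < valn v := fun m => by
    have := (hnext _ (hz m)).2
    simpa only [z, Function.iterate_succ_apply'] using this
  refine ⟨z, hz, fun m k => ?_⟩
  induction k with
  | zero => simpa using valn_pos.mpr hv
  | succ k ih =>
    have h1 : z m - z (m + (k + 1)) - ((k + 1 : ℕ) : K) • v =
        (z m - z (m + k) - (k : K) • v) + (z (m + k) - z (m + k + 1) - v) := by
      rw [Nat.cast_succ, add_smul, one_smul, add_assoc m k 1]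
      abel
    rw [h1]
    exact valn_add_lt ih (hs _)

/-- The straightened translate of the section `l` through `z` meets all points of a ball of
`K ^ d`. -/
theorem exists_comp_eq_of_section (hT : GeneralHypothesis T 0) (hK : K ⊨ T) {d : ℕ}
    {F : Equiv.Perm (Fin n → K)} (hF : DefRiso L F) {e : Fin d → Fin n}
    {l : (Fin d → K) →ₗ[K] (Fin n → K)} (hle : ∀ u, l u ∘ e = u) (hlv : ∀ u, valn (l u) ≤ valn u)
    (y : Fin n → K) {p : Fin d → K} {δ : K} (hp : valn (F y ∘ e - p) ≤ val δ) :
    ∃ u, valn u ≤ val δ ∧ F (y + l u) ∘ e = p := by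
  have hmap : ∀ u, valn u ≤ val δ → valn (F (y + l u) ∘ e - p) ≤ val δ := fun u hu => by
    have h1 : F (y + l u) ∘ e - p = (F (y + l u) - F y) ∘ e + (F y ∘ e - p) := by
      funext i
      simp
    rw [h1]
    refine (valn_add_le _ _).trans (max_le ((valn_comp_le _ e).trans ?_) hp)
    rw [hF.valn_sub, add_sub_cancel_left]
    exact (hlv u).trans hu
  -- On the coordinates `e`, `l` is the identity, and `F` alters differences only by a smaller
  -- error, so `u ↦ F (y + l u) ∘ e - p` is infinitesimally close to the identity.
  have hris : ∀ u u', valn u ≤ val δ → valn u' ≤ val δ → u ≠ u' →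
      valn (F (y + l u) ∘ e - p - (F (y + l u') ∘ e - p) - (u - u')) < valn (u - u') :=
    fun u u' _ _ huu' => by
    have hne' : y + l u ≠ y + l u' := fun h => huu' (by rw [← hle u, ← hle u', add_left_cancel h])
    have h1 := hF.sub_lt hne'
    rw [add_sub_add_left_eq_sub, ← map_sub l] at h1
    have h2 : F (y + l u) ∘ e - p - (F (y + l u') ∘ e - p) - (u - u') =
        (F (y + l u) - F (y + l u') - l (u - u')) ∘ e := by
      funext i
      have := congrFun (hle (u - u')) i
      simp only [Pi.sub_apply, Function.comp_apply] at this ⊢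
      rw [this, sub_sub_sub_cancel_right]
    rw [h2]
    exact (valn_comp_le _ e).trans_lt (h1.trans_le (hlv _))
  obtain ⟨u, hu, hu0⟩ := exists_eq_zero_of_risometry hT hK
    (g := fun u => F (y + l u) ∘ e - p) (c := δ)
    (.sub_pi (.pi fun i => (DF.apply' (e i)).comp (hF.df.comp (.add_pi (DF.const _)
      (DF.linearMap l)))) (DF.const p)) hmap hris
  exact ⟨u, hu, sub_eq_zero.mp hu0⟩

/-- Straightened translates of a section through points that differ in a direction transversal to
it do not meet. -/
theorem add_section_ne {d : ℕ} {F : Equiv.Perm (Fin n → K)} (hF : DefRiso L F) {e : Fin d → Fin n}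
    {l : (Fin d → K) →ₗ[K] (Fin n → K)} (hle : ∀ u, l u ∘ e = u) (hlv : ∀ u, valn (l u) ≤ valn u)
    {y y' : Fin n → K} {w : Fin n → K} (hw : w ≠ 0) (hwe : valn (w ∘ e) < valn w)
    (hyw : valn (F y - F y' - w) < valn w) (u u' : Fin d → K) : y + l u ≠ y' + l u' := by
  intro h
  have h2 : y - y' = l (u' - u) := by
    rw [map_sub, sub_eq_sub_iff_add_eq_add, h, add_comm]
  have h3 : valn (y - y') = valn w := by
    rw [← hF.valn_sub]
    refine valn_eq_of_sub_lt ?_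
    rw [valn_sub_comm]
    exact hyw
  have hne : y ≠ y' := fun h => by
    rw [h, sub_self, valn_zero] at h3
    exact (valn_pos.mpr hw).ne h3
  have h4 := hF.sub_lt hne
  rw [h3] at h4
  have h5 : (y - y') ∘ e = (F y - F y' - w) ∘ e + w ∘ e - (F y - F y' - (y - y')) ∘ e := by
    funext i
    simp
  -- A common point would put `y - y'` on the graph of `l`, where the coordinates `e` control the
  -- size. But `y - y'` has the size of `w` while its coordinates `e` are smaller.
  have h6 : valn ((y - y') ∘ e) < valn w := by
    rw [h5]
    exact valn_sub_lt (valn_add_lt ((valn_comp_le _ e).trans_lt hyw) hwe)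
      ((valn_comp_le _ e).trans_lt h4)
  rw [h2, hle] at h6
  rw [h2] at h3
  exact absurd (hlv (u' - u)) (not_le.mpr (h3 ▸ h6))

/-- If two points of equal rainbow differ in a direction transversal to the direction of
translatability on a ball, then the stratum of least dimension does not come close to them. -/
theorem notMem_of_rainbow_eq (hT : GeneralHypothesis T 0) (hK : K ⊨ T)
    (hS : IsTStratification L S B₀) {d : Fin (n + 1)} {B : Set (Fin n → K)} {F : Equiv.Perm (Fin n → K)}
    (hF : DefRiso L F) (hFB : ∀ x, F x ∈ B ↔ x ∈ B) {e : Fin d → Fin n} (he : Function.Injective e)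
    {l : (Fin d → K) →ₗ[K] (Fin n → K)} (hle : ∀ u, l u ∘ e = u) (hlv : ∀ u, valn (l u) ≤ valn u)
    (hcol : ∀ x ∈ B, ∀ u, x + l u ∈ B → (F (x + l u) ∈ S d ↔ F x ∈ S d))
    {x x' : B₀} (hrain : rainbow S x = rainbow S x') {y y' : Fin n → K} (hy : F y = x) (hy' : F y' = x')
    (hyy : (y - y') ∘ e = 0) (hne : x.1 ≠ x'.1)
    (hB : {z | valn (z - x.1) ≤ valn (x.1 - x'.1)} ⊆ B) :
    ∀ z, valn (z - x.1) ≤ valn (x.1 - x'.1) → z ∉ S d := by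
  intro z₀ hz₀ hz₀S
  obtain ⟨z, hz, hzm⟩ := exists_translate_sequence
    (P := fun z => z ∈ S d ∧ valn (z - x.1) ≤ valn (x.1 - x'.1)) (sub_ne_zero.mpr hne)
    (fun z hz => exists_translate_of_rainbow_eq hrain hne hz.1 hz.2) ⟨z₀, hz₀S, hz₀⟩
  have hv0 : x.1 - x'.1 ≠ 0 := sub_ne_zero.mpr hne
  -- Transversality survives the straightening: `y - y'` vanishes on the coordinates `e`, and `x -
  -- x'` differs from it by a smaller error.
  have hve : valn ((x.1 - x'.1) ∘ e) < valn (x.1 - x'.1) := by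
    have hyne : y ≠ y' := fun h => hne (by rw [← hy, ← hy', h])
    have h1 := (hF.sub_lt hyne).trans_eq (hF.valn_sub y y').symm
    rw [hy, hy'] at h1
    have h2 : (x.1 - x'.1 - (y - y')) ∘ e = (x.1 - x'.1) ∘ e - (y - y') ∘ e := rfl
    rw [hyy, sub_zero] at h2
    rw [← h2]
    exact (valn_comp_le _ e).trans_lt h1
  generalize x.1 - x'.1 = v at *
  obtain ⟨δ, hδ⟩ := val_surjective (valn v)
  have hδ0 : 0 < val δ := hδ ▸ valn_pos.mpr hv0
  have hbig : Big fun p : Fin d → K => {z | z ∈ S d ∧ ∀ i, z (e i) = p i}.Infinite := by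
    refine ⟨x.1 ∘ e, δ, val_pos.mp hδ0, fun p hp => ?_⟩
    have hpz : ∀ m, valn (F (F⁻¹ (z m)) ∘ e - p) ≤ val δ := fun m => by
      have h1 : F (F⁻¹ (z m)) ∘ e - p = (z m - x.1) ∘ e - (p - x.1 ∘ e) := by
        rw [perm_apply_inv]
        funext i
        simp
      rw [h1]
      exact (valn_sub_le _ _).trans (max_le ((valn_comp_le _ e).trans ((hz m).2.trans hδ.ge)) hp.le)
    -- The leaf through each `z m` contains a point over `p`. It lies in `S d`, as leaves within `B`
    -- do not leave the stratum.
    choose u hu hup using fun m => exists_comp_eq_of_section hT hK hF hle hlv (F⁻¹ (z m)) (hpz m)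
    have hmB : ∀ m, F⁻¹ (z m) ∈ B := fun m => by
      rw [← hFB, perm_apply_inv]
      exact hB (hz m).2
    have hzB : ∀ m, F⁻¹ (z m) + l (u m) ∈ B := fun m => by
      rw [← hFB]
      apply hB
      have h1 : F (F⁻¹ (z m) + l (u m)) - x.1 = (F (F⁻¹ (z m) + l (u m)) - F (F⁻¹ (z m))) +
          (z m - x.1) := by rw [perm_apply_inv]; abel
      rw [Set.mem_ofPred_eq, h1]
      refine (valn_add_le _ _).trans (max_le ?_ (hz m).2)
      rw [hF.valn_sub, add_sub_cancel_left, ← hδ]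
      exact (hlv _).trans (hu m)
    have key : ∀ m k : ℕ, F (F⁻¹ (z m) + l (u m)) ≠
        F (F⁻¹ (z (m + (k + 1))) + l (u (m + (k + 1)))) := by
      intro m k h
      -- Different points of the sequence differ by about `(k + 1) • v`, which has the size of `v`
      -- and is as transversal as `v`, so their leaves are disjoint.
      have hk : ((k + 1 : ℕ) : K) ≠ 0 := natCast_ne_zero (by omega)
      have hkv : ∀ {j : ℕ} (v : Fin j → K), valn (((k + 1 : ℕ) : K) • v) = valn v := fun v => by
        rw [valn_smul, val_natCast (by omega), one_mul]
      refine add_section_ne hF hle hlv (w := ((k + 1 : ℕ) : K) • v) (smul_ne_zero hk hv0) ?_ ?_ _ _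
        (F.injective h)
      · have : (((k + 1 : ℕ) : K) • v) ∘ e = ((k + 1 : ℕ) : K) • (v ∘ e) := rfl
        rw [this, hkv, hkv]
        exact hve
      · rw [perm_apply_inv, perm_apply_inv, hkv]
        exact hzm m (k + 1)
    refine Set.infinite_of_injective_forall_mem (f := fun m => F (F⁻¹ (z m) + l (u m))) ?_
      fun m => ⟨?_, fun i => congrFun (hup m) i⟩
    · intro m m' h
      rcases lt_trichotomy m m' with hlt | rfl | hlt
      · obtain ⟨k, rfl⟩ := Nat.exists_eq_add_of_lt hlt
        exact absurd h (key m k)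
      · rfl
      · obtain ⟨k, rfl⟩ := Nat.exists_eq_add_of_lt hlt
        exact absurd h.symm (key m' k)
    · rw [hcol _ (hmB m) _ (hzB m), perm_apply_inv]
      exact (hz m).1
  have h1 := (le_dim_of_big_infinite hT hK (dp_of_definable (hS.definable d)) he hbig).trans
    (hS.dim_le d)
  have h2 : ((d : ℕ) + 1 : ℕ) ≤ (d : ℕ) := by exact_mod_cast h1
  omega

/-- A reflected coloring is refined by the rainbow. -/
theorem Reflects.rainbow_refines (hT : GeneralHypothesis T 0) (hK : K ⊨ T) (hB₀ : IsBall B₀)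
    (hS : IsTStratification L S B₀) {C : Type*} {χ : B₀ → C} (h : Reflects L S χ) :
    Refines (rainbow S) χ := by
  -- The induction goes upward in `d`: the ball spanned by the two points is pushed into higher and
  -- higher strata.
  have main : ∀ k (d : Fin (n + 1)), n + 1 - (d : ℕ) = k → ∀ x x' : B₀, rainbow S x = rainbow S x' →
      {y | valn (y - x.1) ≤ valn (x.1 - x'.1)} ⊆ upper S d → χ x = χ x' := by
    intro k
    induction k using Nat.strong_induction_on with
    | _ k ih =>
    intro d hd x x' hrain hup
    by_cases hxx : x = x'
    · rw [hxx]
    have hδ : valn (x.1 - x'.1) ≠ 0 := fun h =>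
      hxx (Subtype.ext (sub_eq_zero.mp (valn_eq_zero.mp h)))
    have hBB₀ : {y | valn (y - x.1) ≤ valn (x.1 - x'.1)} ⊆ B₀ :=
      hup.trans (hS.upper_subset d)
    have hB := isBall_closedBall x.1 hδ
    obtain ⟨V, W, F, hFB, hV, hW, hF, hcol⟩ := (h d _ hBB₀ hB hup).exists_defRiso hB
    obtain ⟨e, l, he, hlW, hle, hlv⟩ := hW.exists_section hV
    set B : Set (Fin n → K) := {y | valn (y - x.1) ≤ valn (x.1 - x'.1)} with hBdef
    have hcolS : ∀ a ∈ B, ∀ a' ∈ B, a - a' ∈ W → ∀ i, F a ∈ S i ↔ F a' ∈ S i :=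
      fun a ha a' ha' haa i =>
        iff_of_eq (congrFun (congrArg Prod.fst (hcol ⟨a, ha⟩ ⟨a', ha'⟩ haa)) i)
    have hxB : x.1 ∈ B := by simp [hBdef]
    have hx'B : x'.1 ∈ B := (valn_sub_comm _ _).le
    have hinvB : ∀ a, F⁻¹ a ∈ B ↔ a ∈ B := fun a => by rw [← hFB, perm_apply_inv]
    let y := F⁻¹ x.1
    let y' := F⁻¹ x'.1
    -- In straightened coordinates `y'` is moved along the leaf to `y''`, which agrees with `y` on
    -- the coordinates `e`.
    let u : Fin d → K := (y - y') ∘ e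
    let y'' := y' + l u
    have hy'B : y' ∈ B := (hinvB _).mpr hx'B
    have hyB : y ∈ B := (hinvB _).mpr hxB
    have hy''B : y'' ∈ B := by
      by_contra hcon
      have h1 := hB.sub_lt_sub hy'B hyB hcon
      rw [sub_add_cancel_left, valn_neg, valn_sub_comm] at h1
      exact absurd ((hlv u).trans (valn_comp_le _ e)) (not_le.mpr h1)
    have hdiff : y'' - y' ∈ W := by
      rw [add_sub_cancel_left]; exact hlW u
    let x'' : B₀ := ⟨F y'', hBB₀ ((hFB _).mpr hy''B)⟩
    have hχ : χ x'' = χ x' := by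
      have h1 := congrArg Prod.snd (hcol ⟨y'', hy''B⟩ ⟨y', hy'B⟩ hdiff)
      have h2 : F y' = x' := perm_apply_inv _ _
      simp only at h1
      convert h1 using 2
      exact Subtype.ext h2.symm
    have hrain' : rainbow S x'' = rainbow S x' := by
      -- The move along the leaf is realized by a risometry of `B₀` respecting the strata, so the
      -- rainbow is unchanged.
      obtain ⟨G, hG, hGy, hGB, hGid, hGS⟩ := exists_defRiso_translation hB hF hFB hcolS hy''B hy'B hdiff
      have hGB₀ : ∀ a, G a ∈ B₀ ↔ a ∈ B₀ := fun a => by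
        by_cases ha : a ∈ B
        · exact iff_of_true (hBB₀ ((hGB a).mpr ha)) (hBB₀ ha)
        · rw [hGid a ha]
      rw [← rainbow_eq_of_defRiso hB₀ hS hG hGB₀ hGS x']
      congr 1
      refine Subtype.ext ?_
      rw [perm_apply_inv] at hGy
      exact hGy.symm
    rw [← hχ]
    by_cases hne : x = x''
    · exact congrArg χ hne
    have hle' : valn (x.1 - x''.1) ≤ valn (x.1 - x'.1) := by
      rw [valn_sub_comm]
      exact (hFB _).mpr hy''B
    have hsub : {z | valn (z - x.1) ≤ valn (x.1 - x''.1)} ⊆ B := fun z hz =>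
      le_trans hz hle'
    have hnot := notMem_of_rainbow_eq hT hK hS hF hFB he hle hlv
      (fun a ha u hau => hcolS _ hau _ ha (by rw [add_sub_cancel_left]; exact hlW u) d)
      (hrain.trans hrain'.symm) (perm_apply_inv F _) (rfl : F y'' = x'') (by
        have : y - y'' = (y - y') - l u := by simp only [y'']; abel
        funext i
        change (y - y'') (e i) = 0
        rw [this, Pi.sub_apply, ← Function.comp_apply (f := l u) (g := e), hle]
        exact sub_self _) (fun h => hne (Subtype.ext h)) hsub
    -- This point lies in `S_{≥ d}` but not in `S d`, so `d < n`. In particular the case `d = n`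
    -- cannot reach this step, and the induction can continue at `d + 1`.
    have hxd : x.1 ∉ S d := hnot x (by simp)
    obtain ⟨hd', -⟩ := mem_upper_succ (hup hxB) hxd
    refine ih (n + 1 - (d + 1)) (by omega) ⟨d + 1, hd'⟩ rfl x x'' (hrain.trans hrain'.symm) fun z hz => ?_
    exact (mem_upper_succ (hup (hsub hz)) (hnot z hz)).2
  intro x x' hrain
  refine main _ 0 rfl x x' hrain ?_
  rw [hS.upper_zero]
  exact hB₀.closedBall_subset x.2 x'.2

/-- A coloring respected by all definable risometries respecting the stratification is
reflected. -/
theorem reflects_of_respects (hB₀ : IsBall B₀) (hS : IsTStratification L S B₀) {C : Type*}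
    {χ : B₀ → C}
    (h : ∀ φ : B₀ → B₀, DefinableMap (K := K) L (fun x : B₀ => (φ x : Fin n → K)) → IsRisometry φ →
        Respects φ (stratColor S B₀) → Respects φ χ) : Reflects L S χ := by
  intro d B hBB₀ hB hup
  obtain ⟨V, W, F, hFB, hV, hW, hF, hcol⟩ := (hS.translatable d B hB hup).exists_defRiso hB
  refine ⟨V, hV, W, fun x => ⟨F x, (hFB x).mpr x.2⟩, hW, (hF.restrict hB hFB).1,
    (hF.restrict hB hFB).2, fun x x' hxx => Prod.ext (hcol x x' hxx) ?_⟩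
  -- `G` carries `F x'` to `F x` and respects the strata, so by assumption the two points have the
  -- same color.
  obtain ⟨G, hG, hGx, hGB, hGid, hGS⟩ := exists_defRiso_translation hB hF hFB
    (fun a ha a' ha' haa i => iff_of_eq (congrFun (hcol ⟨a, ha⟩ ⟨a', ha'⟩ haa) i)) x.2 x'.2 hxx
  have hGB₀ : ∀ a, G a ∈ B₀ ↔ a ∈ B₀ := fun a => by
    by_cases ha : a ∈ B
    · exact iff_of_true (hBB₀ ((hGB a).mpr ha)) (hBB₀ ha)
    · rw [hGid a ha]
  have h1 := congrFun (h _ (hG.restrict hB₀ hGB₀).1 (hG.restrict hB₀ hGB₀).2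
    (funext fun a => funext fun i => propext (hGS a i))) ⟨F x', hBB₀ ((hFB x').mpr x'.2)⟩
  exact (congrArg χ (Subtype.ext hGx.symm)).trans h1

end Reflection

end TStrat

open TStrat in
theorem proposition4p12 {L : FirstOrder.Language.{u, u}} (T : (expand L).Theory)
    (hT : GeneralHypothesis T 0)
    (K : Type u) [HenselianVF K] [L.Structure K] (hK : K ⊨ T)
    (n : ℕ) (B₀ : Set (Fin n → K)) (hB₀ : IsBall B₀)
    (S : Fin (n + 1) → Set (Fin n → K)) (hS : IsTStratification L S B₀)
    (χ : Coloring L B₀) :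
    List.TFAE [
      Reflects L S χ.toFun,
      Refines (rainbow S) χ.toFun,
      ∀ φ : B₀ → B₀, DefinableMap (K := K) L (fun x : B₀ => (φ x : Fin n → K)) → IsRisometry φ →
        Respects φ (stratColor S B₀) → Respects φ χ.toFun] := by
  tfae_have 1 → 2 := Reflects.rainbow_refines hT hK hB₀ hS
  tfae_have 2 → 3 := fun h φ _ hφ hresp => funext fun x => h _ _
    (rainbow_risometry hφ hS.subset
      (fun x i => iff_of_eq (congrFun (congrFun hresp x) i)) x)
  tfae_have 3 → 1 := reflects_of_respects hB₀ hS
  tfae_finish
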